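/- Let $p$ be a prime. For an abelian group $G$ let $P_G$ be the poset of proper nontrivial subgroups of $G$, and let $\widetilde C_\bullet(P_G)$ be the reduced simplicial chain complex of its order complex: $\widetilde C_q(P_G)$ is the free abelian group on chains $G_1\subsetneq\cdots\subsetneq G_{q+1}$ in $P_G$ for $q\ge 0$, $\widetilde C_{-1}(P_G)=\mathbb Z$, and $\widetilde C_q(P_G)=0$ for $q<-1$. For a module $M$ over a commutative ring $R$ (for instance an abelian group, with $R=\mathbb Z$), let $D_G^\bullet(M)$ be the following cochain complex of $R$-modules: if $G=0$, then $D^0_G(M)=M$ and $D^q_G(M)=0$ for $q\ne 0$; if $G\neq 0$, then $D_G^q(M)=\operatorname{Hom}(\widetilde C_{q-2}(P_G),M)$, with coboundary induced by the boundary map of $\widetilde C_{\bullet-2}(P_G)$. (I) Let $G$ be a finite abelian $p$-group. 1. If $pG\ne 0$, then $H_q(\widetilde C_\bullet(P_G))=0$ for all $q$, and $H^q(D_G^\bullet(M))=0$ for all $q$ and all $M$. 2. If $pG=0$, then $G\cong(\mathbb Z/p)^r$ for some $r\ge 0$. For this $r$: if $G\ne0$, then $H_q(\widetilde C_\bullet(P_G))=0$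 for $q\neq r-2$, and $H_{r-2}(\widetilde C_\bullet(P_G))$ is a free abelian group. For every $M$ one has $H^q(D_G^\bullet(M))=0$ for $q\ne r$; and if $M$ is a free $R$-module, then $H^r(D_G^\bullet(M))$ is a free $R$-module. (II) For an elliptic curve $E$ over an affine scheme $S=\operatorname{Spec}A$ and $N_1,\dots,N_q\ge 1$, let $\mathscr S_{N_1,\dots,N_q}(E/S)$ be the function ring of the moduli problem which assigns to an $A$-algebra $B$ the set of chains $G_1\subseteq\cdots\subseteq G_q$ of finite locally free subgroup schemes of $E_B$, with $G_i$ of rank $N_1\cdots N_i$. Let $\mathscr K_N^\bullet(E/S)$ be the modular $N$-isogeny complex $$\mathscr K_N^q(E/S)=\prod_{N_1\cdots N_q=N,\ N_i>1}\mathscr S_{N_1,\dots,N_q}(E/S),\qquad (\delta f)_{N_1,\dots,N_{q}}=\sum_{i=1}^{q-1}(-1)^i u_i\bigl(f_{N_1,\dots,N_iN_{i+1},\dots,N_q}\bigr),$$ where $u_i$ is induced by forgetting $G_i$. Let $k$ be an algebraically closed field in which $p$ is invertible, let $E$ be an elliptic curve over $S=\operatorname{Spec}k$, and let $r\ge 0$.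 Then there is an isomorphism of cochain complexes of $k$-modules $$\mathscr K^\bullet_{p^r}(E/S)\;\cong\;\prod_{G}D_G^\bullet(k),$$ where $G$ runs over the subgroups of order $p^r$ of $E(k)$ (equivalently, of $E[p^\infty](k)$). Moreover $H^j(\mathscr K_{p^r}^\bullet(E/S))=0$ for $j\ne r$, and $H^r(\mathscr K_{p^r}^\bullet(E/S))$ is a finitely generated projective $k$-module. -/

import Mathlib

open CategoryTheory AlgebraicGeometry MonObj

universe u v w

noncomputable section

namespace IsogenyComplex

/-! ## The reduced chain complex of the order complex of a poset -/

section OrderComplex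

variable (P : Type u) [PartialOrder P]

/-- The `q`-simplices of the order complex of `P`: the finite chains in `P` with `q + 1` elements.
For `q = -1` this is the empty chain, which spans the augmentation term; for `q < -1` there
are none. -/
def Simplices (q : ℤ) : Type u :=
  {s : Finset P // IsChain (· ≤ ·) (s : Set P) ∧ (s.card : ℤ) = q + 1}

variable {P}

open Classical in
/-- The face of the simplex `s` opposite to the vertex `x`. -/
def Simplices.face {q : ℤ} (s : Simplices P (q + 1)) (x : P) (hx : x ∈ s.1) : Simplices P q :=
  ⟨s.1.erase x, s.2.1.mono (by simp), by
    have h := Finset.card_erase_add_one hx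
    have h' := s.2.2
    omega⟩

open Classical in
/-- The position of `x` in the chain `s`, i.e. the number of vertices strictly below `x`. -/
def position (s : Finset P) (x : P) : ℕ := (s.filter (· < x)).card

variable (P)

/-- The boundary map: on a chain `x₀ < ⋯ < x_{q+1}` it is the sum over `i` of `(-1)^i` times the
chain with `xᵢ` removed. For `q = -1` it is the augmentation. -/
def boundary (q : ℤ) : (Simplices P (q + 1) →₀ ℤ) →ₗ[ℤ] (Simplices P q →₀ ℤ) :=
  Finsupp.lift _ ℤ _ fun s =>
    ∑ x : {x // x ∈ s.1}, (-1 : ℤ) ^ position s.1 x.1 • Finsupp.single (s.face x.1 x.2) 1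

lemma boundary_single {q : ℤ} (s : Simplices P (q + 1)) :
    boundary P q (Finsupp.single s 1) =
      ∑ x : {x // x ∈ s.1}, (-1 : ℤ) ^ position s.1 x.1 • Finsupp.single (s.face x.1 x.2) 1 := by
  simp [boundary]

lemma position_erase_of_lt [DecidableEq P] {s : Finset P} {x y : P} (hx : x ∈ s) (h : x < y) :
    position (s.erase x) y + 1 = position s y := by
  classical
  unfold position
  rw [Finset.filter_erase]
  convert Finset.card_erase_add_one (s := s.filter (· < y)) (a := x) (by simp [hx, h])

lemma position_erase_of_not_lt [DecidableEq P] {s : Finset P} {x y : P} (h : ¬ x < y) :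
    position (s.erase x) y = position s y := by
  classical
  unfold position
  rw [Finset.filter_erase]
  convert congrArg Finset.card (Finset.erase_eq_of_notMem (s := s.filter (· < y)) (a := x)
    (by simp [h]))

lemma boundary_boundary (q : ℤ) : boundary P q ∘ₗ boundary P (q + 1) = 0 := by
  classical
  refine Finsupp.lhom_ext' fun s => LinearMap.ext_ring ?_
  simp only [LinearMap.comp_apply, Finsupp.lsingle_apply, LinearMap.zero_apply]
  rw [boundary_single, map_sum]
  simp only [map_smul, boundary_single, Finset.smul_sum, smul_smul]
  rw [Finset.sum_sigma']
  have mem : ∀ a : (Σ x : {x // x ∈ s.1}, {y // y ∈ (s.face x.1 x.2).1}),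
      a.2.1 ∈ s.1 ∧ a.2.1 ≠ a.1.1 := fun a => by
    have := a.2.2
    simp only [Simplices.face, Finset.mem_erase] at this
    exact ⟨this.2, this.1⟩
  refine Finset.sum_involution
    (fun a _ => ⟨⟨a.2.1, (mem a).1⟩, ⟨a.1.1, by
      simp only [Simplices.face, Finset.mem_erase]
      exact ⟨(mem a).2.symm, a.1.2⟩⟩⟩) ?_ ?_ ?_ ?_
  · intro a _
    obtain ⟨⟨x, hx⟩, ⟨y, hy⟩⟩ := a
    have hy' : y ≠ x ∧ y ∈ s.1 := by simpa [Simplices.face] using hy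
    have hface : (s.face x hx).face y hy =
        (s.face y hy'.2).face x (by simp [Simplices.face, hx, hy'.1.symm]) := by
      apply Subtype.ext
      simp only [Simplices.face]
      exact Finset.erase_right_comm
    have hs : (-1 : ℤ) ^ position s.1 x * (-1) ^ position (s.face x hx).1 y
        = - ((-1 : ℤ) ^ position s.1 y * (-1) ^ position (s.face y hy'.2).1 x) := by
      have e1 : (s.face x hx).1 = s.1.erase x := rfl
      have e2 : (s.face y hy'.2).1 = s.1.erase y := rfl
      rw [e1, e2]
      rcases s.2.1.total hx hy'.2 with h | h
      · have hlt : x < y := lt_of_le_of_ne h hy'.1.symm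
        rw [position_erase_of_not_lt P (x := y) (y := x) hlt.not_gt,
          ← position_erase_of_lt P hx hlt]
        ring
      · have hlt : y < x := lt_of_le_of_ne h hy'.1
        rw [position_erase_of_not_lt P (x := x) (y := y) hlt.not_gt,
          ← position_erase_of_lt P hy'.2 hlt]
        ring
    simp only
    rw [hface, hs, neg_smul]
    exact neg_add_cancel _
  · intro a _ _ h
    exact (mem a).2 (congrArg (fun b => b.1.1) h)
  · intro a _
    simp
  · intro a _
    rfl

/-- The reduced simplicial chain complex of the order complex of `P`, with `ℤ` in degree `-1`. -/
def reducedChains : ChainComplex (ModuleCat.{u} ℤ) ℤ :=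
  ChainComplex.of (fun q => ModuleCat.of ℤ (Simplices P q →₀ ℤ))
    (fun q => ModuleCat.ofHom (boundary P q))
    (fun q => by
      rw [← ModuleCat.ofHom_comp, boundary_boundary]
      rfl)

end OrderComplex

/-! ## The cochain complex attached to a finite abelian group -/

section GroupComplex

/-- The poset of proper nontrivial subgroups of `G`. -/
abbrev ProperSubgroups (G : Type u) [AddCommGroup G] : Type u :=
  {H : AddSubgroup G // H ≠ ⊥ ∧ H ≠ ⊤}

variable (R : Type w) [CommRing R] (G : Type u) [AddCommGroup G]
  (M : Type v) [AddCommGroup M] [Module R M]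

/-- The complex `Hom(C̃_{q-2}, M)`, where `C̃` is the reduced chain complex of the order complex of
the poset of proper nontrivial subgroups of `G`. -/
def homComplex : CochainComplex (ModuleCat.{max u v} R) ℕ :=
  CochainComplex.of
    (fun q => ModuleCat.of R ((reducedChains (ProperSubgroups G)).X ((q : ℤ) - 2) →ₗ[ℤ] M))
    (fun q => ModuleCat.ofHom
      { toFun := fun f => f ∘ₗ
          ((reducedChains (ProperSubgroups G)).d (((q + 1 : ℕ) : ℤ) - 2) ((q : ℤ) - 2)).hom
        map_add' := fun _ _ => rfl
        map_smul' := fun _ _ => rfl })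
    (fun q => by
      ext f : 2
      refine LinearMap.ext fun x => ?_
      have h := (reducedChains (ProperSubgroups G)).d_comp_d
        (((q + 1 + 1 : ℕ) : ℤ) - 2) (((q + 1 : ℕ) : ℤ) - 2) ((q : ℤ) - 2)
      have hx := congrArg (fun g => f (g.hom x)) h
      exact hx.trans (map_zero f))

open Classical in
/-- The complex `D_G(M)`: it is `M` in degree `0` if `G = 0`, and `Hom(C̃_{q-2}, M)` in degree `q`
otherwise. If `M` is an `R`-module, it is a complex of `R`-modules; for `R = ℤ` it is the
complex of abelian groups. -/
def complexD : CochainComplex (ModuleCat.{max u v} R) ℕ :=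
  if Subsingleton G then
    (CochainComplex.single₀ (ModuleCat.{max u v} R)).obj (ModuleCat.of R (ULift.{u} M))
  else homComplex R G M

end GroupComplex

/-! ## Elliptic curves and their finite subgroup schemes -/

/-- An elliptic curve over `Spec A`: a commutative group scheme, proper and smooth of relative
dimension one, with geometrically connected fibres. -/
structure EllipticCurve (A : Type u) [CommRing A] where
  /-- The underlying scheme over `Spec A`. -/
  scheme : Over (Spec (CommRingCat.of A))
  [grpObj : GrpObj scheme]
  [isCommMonObj : IsCommMonObj scheme]
  [isProper : IsProper scheme.hom]
  [smooth : SmoothOfRelativeDimension 1 scheme.hom]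
  [geometricallyConnected : GeometricallyConnected scheme.hom]

attribute [instance] EllipticCurve.grpObj EllipticCurve.isCommMonObj EllipticCurve.isProper
  EllipticCurve.smooth EllipticCurve.geometricallyConnected

section Moduli

variable {A : Type u} [CommRing A] (E : EllipticCurve A)

/-- The spectrum of an `A`-algebra as a scheme over `Spec A`. -/
abbrev specOver (A : Type u) [CommRing A] (C : Type u) [CommRing C] [Algebra A C] :
    Over (Spec (CommRingCat.of A)) :=
  Over.mk (Spec.map (CommRingCat.ofHom (algebraMap A C)))

/-- The morphism of spectra over `Spec A` induced by a homomorphism of `A`-algebras. -/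
def specMap {C C' : Type u} [CommRing C] [Algebra A C] [CommRing C'] [Algebra A C']
    (ψ : C →ₐ[A] C') : specOver A C' ⟶ specOver A C :=
  Over.homMk (Spec.map (CommRingCat.ofHom ψ.toRingHom)) (by
    change Spec.map _ ≫ Spec.map _ = Spec.map _
    rw [← Spec.map_comp, ← CommRingCat.ofHom_comp]
    congr 2
    exact ψ.comp_algebraMap)

/-- The group `E(C)` of points of `E` with values in an `A`-algebra `C`, written additively. -/
abbrev EllipticCurve.Points (C : Type u) [CommRing C] [Algebra A C] : Type u :=
  Additive (specOver A C ⟶ E.scheme)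

/-- The map `E(C) → E(C')` induced by a homomorphism `C → C'` of `A`-algebras. -/
def EllipticCurve.mapPoints {C C' : Type u} [CommRing C] [Algebra A C] [CommRing C'] [Algebra A C']
    (ψ : C →ₐ[A] C') (x : E.Points C) : E.Points C' :=
  Additive.ofMul (specMap ψ ≫ x.toMul)

/-- A subgroup functor of the base change `E_B`: it assigns to every `B`-algebra, given as a
homomorphism `φ : B → C` of `A`-algebras, a subgroup of `E_B(C) = E(C)`, functorially. -/
@[ext]
structure SubgroupFunctor (B : Type u) [CommRing B] [Algebra A B] where
  /-- The subgroup of `E(C)`. -/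
  points : ∀ {C : Type u} [CommRing C] [Algebra A C], (B →ₐ[A] C) → AddSubgroup (E.Points C)
  mapPoints_mem : ∀ {C C' : Type u} [CommRing C] [Algebra A C] [CommRing C'] [Algebra A C']
    (φ : B →ₐ[A] C) (ψ : C →ₐ[A] C') (x : E.Points C),
    x ∈ points φ → E.mapPoints ψ x ∈ points (ψ.comp φ)

variable {E}

/-- The subgroup functor `G` of `E_B` is a finite locally free subgroup scheme of rank `N`: it is
represented by `Spec H` for a `B`-algebra `H` that is finite and locally free (finitely generated
projective) of constant rank `N` as a `B`-module. Here `x` is the universal point. (The inclusion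
`Spec H → E_B` is then a proper monomorphism, hence a closed immersion.) -/
def SubgroupFunctor.IsFiniteLocallyFree {B : Type u} [CommRing B] [Algebra A B]
    (G : SubgroupFunctor E B) (N : ℕ) : Prop :=
  ∃ (H : Type u) (_ : CommRing H) (_ : Algebra A H) (_ : Algebra B H) (_ : IsScalarTower A B H),
    Module.Finite B H ∧ Module.Projective B H ∧
    (∀ 𝔭 : PrimeSpectrum B, Module.rankAtStalk (R := B) H 𝔭 = N) ∧
    ∃ x ∈ G.points (IsScalarTower.toAlgHom A B H),
      ∀ (C : Type u) [CommRing C] [Algebra A C] (φ : B →ₐ[A] C), ∀ y ∈ G.points φ,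
        ∃! ψ : H →ₐ[A] C, ψ.comp (IsScalarTower.toAlgHom A B H) = φ ∧ E.mapPoints ψ x = y

/-- The relation that `G'` is the base change of `G` along `φ : B → B'`. -/
def SubgroupFunctor.IsBaseChange {B B' : Type u} [CommRing B] [Algebra A B] [CommRing B']
    [Algebra A B'] (φ : B →ₐ[A] B') (G : SubgroupFunctor E B) (G' : SubgroupFunctor E B') : Prop :=
  ∀ (C : Type u) [CommRing C] [Algebra A C] (ψ : B' →ₐ[A] C),
    G'.points ψ = G.points (ψ.comp φ)

variable (E)

/-- The set `[N₁,…,N_q-Isog](E_B/B)` of chains `G₁ ⊆ ⋯ ⊆ G_q` of finite locally free subgroup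
schemes of `E_B` such that `G_i` has rank `N₁⋯N_i`. -/
@[ext]
structure SubgroupChain (B : Type u) [CommRing B] [Algebra A B] {q : ℕ} (N : Fin q → ℕ) where
  /-- The subgroup schemes of the chain. -/
  group : Fin q → SubgroupFunctor E B
  isFiniteLocallyFree : ∀ i, (group i).IsFiniteLocallyFree (Fin.partialProd N i.succ)
  mono : ∀ i j, i ≤ j → ∀ (C : Type u) [CommRing C] [Algebra A C] (φ : B →ₐ[A] C),
    (group i).points φ ≤ (group j).points φ

variable {E} in
/-- Forgetting one group, but not the last one: for `i < q`, removing `G_i` from a chain of type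
`(N₁,…,N_{q+1})` gives a chain of type `(N₁,…,N_iN_{i+1},…,N_{q+1})`. -/
def SubgroupChain.forget {B : Type u} [CommRing B] [Algebra A B] {q : ℕ} {N : Fin (q + 1) → ℕ}
    (G : SubgroupChain E B N) (i : Fin q) :
    SubgroupChain E B (i.castSucc.contractNth (· * ·) N) where
  group j := G.group (i.castSucc.succAbove j)
  isFiniteLocallyFree j := by
    have h := G.isFiniteLocallyFree (i.castSucc.succAbove j)
    rw [Fin.partialProd_contractNth, Function.comp_apply, Fin.succ_succAbove_succ]
    exact h
  mono j l hjl := G.mono _ _ ((Fin.strictMono_succAbove _).monotone hjl)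

/-- The function ring `S_{N₁,…,N_q}(E/A)` of the moduli problem `[N₁,…,N_q-Isog]` of `E` over
`Spec A`: the ring of all natural transformations from it to the affine line, as functors on
`A`-algebras. (By the Yoneda lemma this is the ring of global functions of any scheme over `Spec A`
that represents the moduli problem.) -/
def functionRing {q : ℕ} (N : Fin q → ℕ) :
    Subalgebra A (∀ B : CommAlgCat.{u} A, SubgroupChain E B N → B) where
  carrier := {f | ∀ (B B' : CommAlgCat.{u} A) (φ : B →ₐ[A] B') (G : SubgroupChain E B N)
    (G' : SubgroupChain E B' N), (∀ i, (G.group i).IsBaseChange φ (G'.group i)) →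
      f B' G' = φ (f B G)}
  mul_mem' hf hg B B' φ G G' h := by
    simp only [Pi.mul_apply, map_mul, hf B B' φ G G' h, hg B B' φ G G' h]
  add_mem' hf hg B B' φ G G' h := by
    simp only [Pi.add_apply, map_add, hf B B' φ G G' h, hg B B' φ G G' h]
  algebraMap_mem' a B B' φ G G' h := by
    simp only [Pi.algebraMap_apply, AlgHom.commutes]

/-- The map `u_i` of function rings induced by forgetting the group `G_i`. -/
def forgetMap {q : ℕ} (N : Fin (q + 1) → ℕ) (i : Fin q) :
    functionRing E (i.castSucc.contractNth (· * ·) N) →ₐ[A] functionRing E N where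
  toFun f := ⟨fun B G => f.1 B (G.forget i), fun B B' φ G G' h =>
    f.2 B B' φ (G.forget i) (G'.forget i) fun _ => h _⟩
  map_one' := rfl
  map_mul' _ _ := rfl
  map_zero' := rfl
  map_add' _ _ := rfl
  commutes' _ := rfl

/-- Tuples `(N₁,…,N_q)` of integers `N_i > 1` with product `N`. -/
abbrev Factorizations (q N : ℕ) : Type := {n : Fin q → ℕ // (∀ i, 1 < n i) ∧ ∏ i, n i = N}

/-- `(N₁,…,N_{q+1}) ↦ (N₁,…,N_iN_{i+1},…,N_{q+1})`. -/
def Factorizations.merge {q N : ℕ} (n : Factorizations (q + 1) N) (i : Fin q) :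
    Factorizations q N :=
  ⟨i.castSucc.contractNth (· * ·) n.1, by
    intro j
    unfold Fin.contractNth
    split_ifs
    · exact n.2.1 _
    · exact one_lt_mul'' (n.2.1 _) (n.2.1 _)
    · exact n.2.1 _, by
    have h := congrFun (Fin.partialProd_contractNth n.1 i.castSucc) (Fin.last q)
    have h2 : i.castSucc.succ.succAbove (Fin.last q) = Fin.last (q + 1) := by
      rw [Fin.succAbove_of_le_castSucc]
      · rfl
      · rw [Fin.le_def]; simp
    rw [Function.comp_apply, h2] at h
    simp only [Fin.partialProd, Fin.val_last, List.take_of_length_le, List.length_ofFn, le_refl,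
      List.prod_ofFn] at h
    rw [h, n.2.2]⟩

/-- The `A`-module in degree `q` of the modular `N`-isogeny complex: the product of the rings
`S_{N₁,…,N_q}(E/A)` over all `(N₁,…,N_q)` with `N₁⋯N_q = N` and all `N_i > 1`. -/
abbrev IsogenyCochains (N q : ℕ) : Type (u + 1) :=
  ∀ n : Factorizations q N, functionRing E n.1

/-- The coboundary: the component of `δ f` at `(N₁,…,N_{q+1})` is the sum over `1 ≤ i ≤ q` of
`(-1)^i u_i (f_{N₁,…,N_iN_{i+1},…,N_{q+1}})`. The index `i : Fin q` below starts at `0`. -/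
def coboundary (N q : ℕ) : IsogenyCochains E N q →ₗ[A] IsogenyCochains E N (q + 1) :=
  LinearMap.pi fun n => ∑ i : Fin q,
    (-1 : A) ^ ((i : ℕ) + 1) • (forgetMap E n.1 i).toLinearMap ∘ₗ LinearMap.proj (n.merge i)

lemma coboundary_apply (N q : ℕ) (f : IsogenyCochains E N q) (n : Factorizations (q + 1) N)
    (B : CommAlgCat.{u} A) (G : SubgroupChain E B n.1) :
    (coboundary E N q f n).1 B G =
      ∑ i : Fin q, (-1 : A) ^ ((i : ℕ) + 1) • (f (n.merge i)).1 B (G.forget i) := by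
  simp only [coboundary, LinearMap.pi_apply, LinearMap.sum_apply, LinearMap.smul_apply]
  rw [AddSubmonoidClass.coe_finsetSum, Finset.sum_apply, Finset.sum_apply]
  rfl

lemma cochain_congr {N q : ℕ} (f : IsogenyCochains E N q) {n n' : Factorizations q N} (h : n = n')
    {B : CommAlgCat.{u} A} (G : SubgroupChain E B n.1) (G' : SubgroupChain E B n'.1)
    (hG : G.group = G'.group) : (f n).1 B G = (f n').1 B G' := by
  subst h
  rw [SubgroupChain.ext hG]

lemma eq_of_partialProd_eq {q : ℕ} {n n' : Fin q → ℕ} (hn : ∀ i, 1 < n i)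
    (h : Fin.partialProd n = Fin.partialProd n') : n = n' := by
  have pos : ∀ i, 0 < Fin.partialProd n i := fun i => by
    induction i using Fin.induction with
    | zero => simp
    | succ i ih =>
      rw [Fin.partialProd_succ]
      exact Nat.mul_pos ih (lt_trans one_pos (hn i))
  funext i
  have h1 := congrFun h i.succ
  rw [Fin.partialProd_succ, Fin.partialProd_succ, ← h] at h1
  exact Nat.eq_of_mul_eq_mul_left (pos _) h1

lemma merge_merge {q N : ℕ} (n : Factorizations (q + 2) N) (i : Fin (q + 1)) (j : Fin q) :
    (n.merge i).merge j = (n.merge (i.succAbove j)).merge (j.predAbove i) := by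
  apply Subtype.ext
  refine eq_of_partialProd_eq ((n.merge i).merge j).2.1 ?_
  simp only [Factorizations.merge, Fin.partialProd_contractNth]
  funext l
  simp only [Function.comp_apply]
  rw [← Fin.castSucc_succAbove_castSucc, ← Fin.castSucc_predAbove_castSucc,
    ← Fin.succ_succAbove_succ, ← Fin.succ_predAbove_succ,
    Fin.succAbove_succAbove_succAbove_predAbove]

lemma coboundary_coboundary (N q : ℕ) : coboundary E N (q + 1) ∘ₗ coboundary E N q = 0 := by
  refine LinearMap.ext fun f => funext fun n => Subtype.ext (funext fun B => funext fun G => ?_)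
  rw [LinearMap.comp_apply, coboundary_apply]
  refine (Finset.sum_congr rfl fun (i : Fin (q + 1)) _ => congrArg (fun b => (-1 : A) ^ ((i : ℕ) + 1) • b)
    (coboundary_apply E N q f (n.merge i) B (G.forget i))).trans ?_
  simp only [Finset.smul_sum, smul_smul]
  refine (Fintype.sum_prod_type' (f := fun (i : Fin (q + 1)) (j : Fin q) =>
    ((-1 : A) ^ ((i : ℕ) + 1) * (-1) ^ ((j : ℕ) + 1)) •
      (f ((n.merge i).merge j)).1 B ((G.forget i).forget j))).symm.trans ?_
  refine Finset.sum_involution (fun a _ => (a.1.succAbove a.2, a.2.predAbove a.1)) ?_ ?_ ?_ ?_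
  · rintro ⟨i, j⟩ -
    have hv : (f ((n.merge i).merge j)).1 B ((G.forget i).forget j) =
        (f ((n.merge (i.succAbove j)).merge (j.predAbove i))).1 B
          ((G.forget (i.succAbove j)).forget (j.predAbove i)) := by
      refine cochain_congr E f (merge_merge n i j) _ _ (funext fun l => ?_)
      simp only [SubgroupChain.forget]
      rw [← Fin.castSucc_succAbove_castSucc, ← Fin.castSucc_predAbove_castSucc,
        Fin.succAbove_succAbove_succAbove_predAbove]
    have hs : (-1 : A) ^ ((i.succAbove j : ℕ) + 1) * (-1) ^ ((j.predAbove i : ℕ) + 1) =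
        -((-1 : A) ^ ((i : ℕ) + 1) * (-1) ^ ((j : ℕ) + 1)) := by
      have h := Fin.neg_one_pow_succAbove_add_predAbove (R := A) i j
      simp only [pow_succ, pow_add] at h ⊢
      linear_combination h
    simp only
    rw [hv, hs, neg_smul]
    exact add_neg_cancel _
  · rintro ⟨i, j⟩ - - h
    exact Fin.succAbove_ne i j (congrArg Prod.fst h)
  · intro a _
    simp
  · rintro ⟨i, j⟩ -
    exact Prod.ext (Fin.succAbove_succAbove_predAbove i j) (Fin.predAbove_predAbove_succAbove i j)

/-- The modular `N`-isogeny complex `K_N(E/A)`. -/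
def isogenyComplex (N : ℕ) : CochainComplex (ModuleCat.{u + 1} A) ℕ :=
  CochainComplex.of (fun q => ModuleCat.of A (IsogenyCochains E N q))
    (fun q => ModuleCat.ofHom (coboundary E N q))
    (fun q => by
      rw [← ModuleCat.ofHom_comp, coboundary_coboundary]
      rfl)

end Moduli

end IsogenyComplex

end

noncomputable section

/-! ### Functoriality of points and separation of points by families of algebras -/

namespace IsogenyComplex
variable {k : Type u} [CommRing k] (E : EllipticCurve k)
variable {C C' C'' : Type u} [CommRing C] [Algebra k C] [CommRing C'] [Algebra k C'] [CommRing C''] [Algebra k C'']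

/-! Both halves come down to chains of subgroups of a finite abelian `p`-group.

Part (I) is discrete Morse theory on the modular lattice of subgroups of a nontrivial group `G` of
order `p ^ n`. Choose an atom `a x` in every nonzero subgroup `x`. If no member of a chain
complements the atom `a ⊤`, the chain is matched by inserting or removing `H ⊔ a ⊤`, where `H` is
the largest member (or `⊥`) not containing `a ⊤`. If some member complements `a ⊤`, modularity makes
it a maximal subgroup, and the same game is played inside it. The pivot is the place where this
descent stops. The chains left unmatched are complete flags in which every step is split by a chosen
atom (`IsProperChain.exists_of_critical`). Such a flag exists only if `p` kills `G`, and it then has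
`n - 1` members (`card_of_critical`), so reduced homology can live only in degree `n - 2`
(`reducedChains_exact`). This is the top degree, so the homology there is a submodule of a finitely
generated free group. Since all chain groups are finitely generated and free over `ℤ`, images of the
differentials split off; hence `Hom(-, M)` stays exact for every `M` (`exists_extension`), and the
top cohomology is `Hom(ker d, M)`, a finite power of `M`.

For part (II), multiplication by `N` acts on infinitesimal points as scaling by `N`, so the
`N`-torsion of `E` is unramified when `N` is invertible. Being proper as well, it is finite étale
and therefore constant over `k` (`EllipticCurve.exists_universal_torsion_point`). Deligne's theorem
(`conv_pow_finrank_eq_one`, `SubgroupFunctor.Represents.rank_nsmul_universal`) puts every subgroup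
scheme of rank dividing `N` inside this torsion, where it is cut out by idempotents of the base
(`SubgroupFunctor.Represents.exists_isDescribedBy`). Over a local base idempotents are `0` or `1`,
so chains of subgroup schemes are constant, and function rings become rings of functions on chains
of subgroups of `E(k)` (`functionRingEquiv`).

A chain of `q` such groups ending in `G` is the same as a simplex of dimension `q - 2` on the proper
nontrivial subgroups of `G`, and forgetting a group deletes a vertex. Up to a sign this identifies
the differentials (`comparisonEquiv_coboundary`), and the vanishing follows from part (I) applied to
each `G`. The case `N = 1` is separate. -/

lemma EllipticCurve.mapPoints_add (ψ : C →ₐ[k] C') (x y : E.Points C) :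
    E.mapPoints ψ (x + y) = E.mapPoints ψ x + E.mapPoints ψ y := by
  unfold EllipticCurve.mapPoints
  rw [toMul_add, MonObj.comp_mul]
  rfl

lemma EllipticCurve.mapPoints_comp (ψ : C →ₐ[k] C') (ψ' : C' →ₐ[k] C'') (x : E.Points C) :
    E.mapPoints (ψ'.comp ψ) x = E.mapPoints ψ' (E.mapPoints ψ x) := by
  unfold EllipticCurve.mapPoints
  rw [toMul_ofMul, ← Category.assoc]
  congr 2
  ext1
  simp only [specMap, Over.homMk_left, Over.comp_left, ← Spec.map_comp, ← CommRingCat.ofHom_comp]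
  rfl

lemma EllipticCurve.mapPoints_id (x : E.Points C) :
    E.mapPoints (AlgHom.id k C) x = x := by
  unfold EllipticCurve.mapPoints
  have : specMap (AlgHom.id k C) = 𝟙 (specOver k C) := by
    ext1
    simp [specMap]
  rw [this, Category.id_comp]
  rfl

/-- `mapPoints` as a homomorphism of groups. -/
def EllipticCurve.mapPointsHom (ψ : C →ₐ[k] C') : E.Points C →+ E.Points C' :=
  AddMonoidHom.mk' (E.mapPoints ψ) (E.mapPoints_add ψ)

@[simp] lemma EllipticCurve.mapPointsHom_apply (ψ : C →ₐ[k] C') (x : E.Points C) :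
    E.mapPointsHom ψ x = E.mapPoints ψ x := rfl

@[simp] lemma EllipticCurve.mapPoints_zero (ψ : C →ₐ[k] C') : E.mapPoints ψ (0 : E.Points C) = 0 :=
  map_zero (E.mapPointsHom ψ)

lemma EllipticCurve.mapPoints_nsmul (ψ : C →ₐ[k] C') (n : ℕ) (x : E.Points C) :
    E.mapPoints ψ (n • x) = n • E.mapPoints ψ x :=
  map_nsmul (E.mapPointsHom ψ) n x


/-- Points of `E` are separated by jointly injective families of algebra homomorphisms. -/
lemma EllipticCurve.points_ext {J : Type*} {D : J → Type u} [∀ i, CommRing (D i)]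
    [∀ i, Algebra k (D i)] (ψ : ∀ i, C →ₐ[k] D i) (hψ : ∀ c : C, (∀ i, ψ i c = 0) → c = 0)
    {x y : E.Points C} (h : ∀ i, E.mapPoints (ψ i) x = E.mapPoints (ψ i) y) : x = y := by
  have : IsSeparated E.scheme.hom := inferInstance
  -- Since `E` is separated, the equalizer is a closed subscheme, cut out by an ideal `I`. Every `ψ
  -- i` factors through it, so `I` dies under all of them and is zero.
  let ε := Limits.equalizer.ι x.toMul y.toMul
  have hε : IsClosedImmersion ε.left := inferInstance
  obtain ⟨I, e, he⟩ := IsClosedImmersion.Spec_iff.1 hε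
  have hI : I = ⊥ := by
    refine (Submodule.eq_bot_iff I).2 fun c hc => hψ c fun i => ?_
    have hi : specMap (ψ i) ≫ x.toMul = specMap (ψ i) ≫ y.toMul := h i
    have h1 : (Limits.equalizer.lift _ hi ≫ ε).left = Spec.map (CommRingCat.ofHom (ψ i).toRingHom) := by
      rw [Limits.equalizer.lift_ι]; rfl
    rw [Over.comp_left, he, ← Category.assoc] at h1
    obtain ⟨g, hg⟩ := Spec.map_surjective ((Limits.equalizer.lift _ hi).left ≫ e.hom)
    rw [← hg, ← Spec.map_comp, Spec.map_inj] at h1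
    have h2 := congrArg (fun f => f.hom c) h1
    simp only [CommRingCat.hom_comp, CommRingCat.hom_ofHom, RingHom.comp_apply] at h2
    rw [Ideal.Quotient.eq_zero_iff_mem.2 hc, map_zero] at h2
    exact h2.symm
  have : IsIso ε.left := by
    have : IsIso (CommRingCat.ofHom (Ideal.Quotient.mk I)) := by
      rw [ConcreteCategory.isIso_iff_bijective]
      refine ⟨?_, Ideal.Quotient.mk_surjective⟩
      subst hI
      exact (RingHom.injective_iff_ker_eq_bot _).2 Ideal.mk_ker
    rw [he]
    infer_instance
  have : IsIso ε := (isIso_iff_of_reflects_iso ε (Over.forget _)).1 this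
  have : Epi ε := inferInstance
  exact congrArg Additive.ofMul ((cancel_epi ε).1 (Limits.equalizer.condition _ _))

lemma EllipticCurve.mapPoints_injective {ψ : C →ₐ[k] C'} (hψ : Function.Injective ψ) :
    Function.Injective (E.mapPoints ψ) := fun _ _ h =>
  E.points_ext (fun _ : Unit => ψ) (fun c hc => hψ (by rw [hc (), map_zero])) fun _ => h

/-! ### Infinitesimal points, and unramifiedness of torsion -/

section Infinitesimal

variable {R : Type u} [CommRing R] [Algebra k R] {M : Type u} [AddCommGroup M] [Module R M]
  [Module k M] [IsScalarTower k R M] [Module Rᵐᵒᵖ M] [IsCentralScalar R M]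
open TrivSqZeroExt


variable (k) in
/-- The homomorphism `R[M] → R[M']` of `k`-algebras induced by a linear map. -/
def tszMap {M' : Type u} [AddCommGroup M'] [Module R M']
    [Module k M'] [IsScalarTower k R M'] [Module Rᵐᵒᵖ M'] [IsCentralScalar R M'] (f : M →ₗ[R] M') :
    TrivSqZeroExt R M →ₐ[k] TrivSqZeroExt R M' :=
  { TrivSqZeroExt.map f with
    commutes' := fun c => by
      simp [TrivSqZeroExt.algebraMap_eq_inl'] }

@[simp] lemma tszMap_apply {M' : Type u} [AddCommGroup M'] [Module R M']
    [Module k M'] [IsScalarTower k R M'] [Module Rᵐᵒᵖ M'] [IsCentralScalar R M'] (f : M →ₗ[R] M')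
    (x : TrivSqZeroExt R M) : tszMap k f x = inl x.fst + inr (f x.snd) := by
  ext
  · simp [tszMap]
  · simp [tszMap]

lemma tszMap_comp {M' M'' : Type u} [AddCommGroup M'] [Module R M']
    [Module k M'] [IsScalarTower k R M'] [Module Rᵐᵒᵖ M'] [IsCentralScalar R M']
    [AddCommGroup M''] [Module R M'']
    [Module k M''] [IsScalarTower k R M''] [Module Rᵐᵒᵖ M''] [IsCentralScalar R M'']
    (f : M →ₗ[R] M') (g : M' →ₗ[R] M'') :
    tszMap k (g ∘ₗ f) = (tszMap k g).comp (tszMap k f) := by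
  ext <;> simp

lemma tszMap_id : tszMap k (LinearMap.id : M →ₗ[R] M) = AlgHom.id k _ := by
  ext <;> simp

lemma EllipticCurve.mapPoints_tszMap_zero {M' : Type u} [AddCommGroup M'] [Module R M']
    [Module k M'] [IsScalarTower k R M'] [Module Rᵐᵒᵖ M'] [IsCentralScalar R M']
    {u : E.Points (TrivSqZeroExt R M)} (hu : E.mapPoints (TrivSqZeroExt.fstHom k R M) u = 0) :
    E.mapPoints (tszMap k (0 : M →ₗ[R] M')) u = 0 := by
  have : tszMap k (0 : M →ₗ[R] M') = (inlAlgHom k R M').comp (TrivSqZeroExt.fstHom k R M) := by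
    ext <;> simp
  rw [this, E.mapPoints_comp, hu, E.mapPoints_zero]

/-- The two projections `R[M' × M'] → R[M']` are jointly injective, so they show that the point
induced by `(f, g)` is the sum of its two coordinate points. Applying the addition map `M' × M' →
M'` gives the claim: the group law on infinitesimal points is the addition of the module. -/
lemma EllipticCurve.mapPoints_tszMap_add {M' : Type u} [AddCommGroup M'] [Module R M']
    [Module k M'] [IsScalarTower k R M'] [Module Rᵐᵒᵖ M'] [IsCentralScalar R M']
    (f g : M →ₗ[R] M') {u : E.Points (TrivSqZeroExt R M)}
    (hu : E.mapPoints (TrivSqZeroExt.fstHom k R M) u = 0) :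
    E.mapPoints (tszMap k (f + g)) u = E.mapPoints (tszMap k f) u + E.mapPoints (tszMap k g) u := by
  have key : E.mapPoints (tszMap k (f.prod g)) u =
      E.mapPoints (tszMap k (LinearMap.inl R M' M' ∘ₗ f)) u +
        E.mapPoints (tszMap k (LinearMap.inr R M' M' ∘ₗ g)) u := by
    refine E.points_ext (fun b : Bool => tszMap k (bif b then LinearMap.fst R M' M' else LinearMap.snd R M' M'))
      (fun c hc => ?_) fun b => ?_
    · have h1 := hc true
      have h2 := hc false
      simp only [cond_true, cond_false, tszMap_apply] at h1 h2
      have e0 := congrArg fst h1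
      have e1 := congrArg snd h1
      have e2 := congrArg snd h2
      simp only [fst_add, snd_add, fst_inl, fst_inr, snd_inl, snd_inr, fst_zero, snd_zero, add_zero, zero_add,
        LinearMap.fst_apply, LinearMap.snd_apply] at e0 e1 e2
      exact TrivSqZeroExt.ext e0 (Prod.ext e1 e2)
    · rw [E.mapPoints_add]
      simp only [← E.mapPoints_comp, ← tszMap_comp]
      cases b
      · simp only [cond_false, ← LinearMap.comp_assoc, LinearMap.snd_comp_inl, LinearMap.snd_comp_inr, LinearMap.zero_comp,
          LinearMap.id_comp, E.mapPoints_tszMap_zero hu, zero_add, LinearMap.snd_prod]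
      · simp only [cond_true, ← LinearMap.comp_assoc, LinearMap.fst_comp_inl, LinearMap.fst_comp_inr, LinearMap.zero_comp,
          LinearMap.id_comp, E.mapPoints_tszMap_zero hu, add_zero, LinearMap.fst_prod]
  have h := congrArg (E.mapPoints (tszMap k
    (LinearMap.coprod (LinearMap.id : M' →ₗ[R] M') (LinearMap.id : M' →ₗ[R] M')))) key
  rw [E.mapPoints_add] at h
  simp only [← E.mapPoints_comp, ← tszMap_comp, ← LinearMap.comp_assoc, LinearMap.coprod_inl, LinearMap.coprod_inr,
    LinearMap.id_comp] at h
  rw [← h]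
  congr 2

/-- Points of `E` with values in `R[M]`, where `M² = 0`, that are trivial in `E(R)` have no
`m`-torsion if `m` is invertible. -/
lemma EllipticCurve.infinitesimal_eq_zero {u : E.Points (TrivSqZeroExt R M)}
    (hu : E.mapPoints (TrivSqZeroExt.fstHom k R M) u = 0) {m : ℕ} (hm : IsUnit (m : k))
    (h : m • u = 0) : u = 0 := by
  -- Multiplication by `n` on an infinitesimal point is scaling of the square-zero ideal by `n`; for
  -- invertible `m` this scaling can be undone.
  have key : ∀ n : ℕ, E.mapPoints (tszMap k (n • (LinearMap.id : M →ₗ[R] M))) u = n • u := fun n => by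
    induction n with
    | zero => rw [zero_smul, zero_smul, E.mapPoints_tszMap_zero hu]
    | succ n ih =>
      rw [add_smul, one_smul, E.mapPoints_tszMap_add _ _ hu, ih, tszMap_id, E.mapPoints_id, add_smul, one_smul]
  obtain ⟨c, hc⟩ := hm.exists_right_inv
  have h1 : (algebraMap k R c • (LinearMap.id : M →ₗ[R] M)) ∘ₗ (m • (LinearMap.id : M →ₗ[R] M)) = LinearMap.id := by
    ext x
    simp only [LinearMap.comp_apply, LinearMap.smul_apply, LinearMap.id_apply, algebraMap_smul]
    rw [← Nat.cast_smul_eq_nsmul k, smul_smul, mul_comm, hc, one_smul]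
  rw [← E.mapPoints_id u, ← tszMap_id, ← h1, tszMap_comp, E.mapPoints_comp, key, h, E.mapPoints_zero]

end Infinitesimal

/-- An affine scheme over `k` with a monomorphism to the `m`-torsion of `E` is unramified over `k`
if `m` is invertible. -/
lemma EllipticCurve.formallyUnramified_of_mono {R : Type u} [CommRing R] [Algebra k R]
    (x : E.Points R) (hmono : ∀ (C : Type u) [CommRing C] [Algebra k C] (g₁ g₂ : R →ₐ[k] C),
      E.mapPoints g₁ x = E.mapPoints g₂ x → g₁ = g₂)
    {m : ℕ} (hm : IsUnit (m : k)) (hx : m • x = 0) : Algebra.FormallyUnramified k R := by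
  let _ : Module Rᵐᵒᵖ (Ω[R⁄k]) := Module.compHom _ ((RingHom.id R).fromOpposite mul_comm)
  have : IsCentralScalar R (Ω[R⁄k]) := ⟨fun r m => rfl⟩
  let D := KaehlerDifferential.D k R
  -- The map `r ↦ r + dr` and the inclusion both lift the identity of `R`. The difference of the two
  -- points is infinitesimal and `m`-torsion, hence zero, and the monomorphism hypothesis forces `d
  -- = 0`.
  let g₂ : R →ₐ[k] TrivSqZeroExt R (Ω[R⁄k]) :=
    { toFun := fun r => TrivSqZeroExt.inl r + TrivSqZeroExt.inr (D r)
      map_one' := by simp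
      map_mul' := fun a b => by
        ext
        · simp
        · simp [D]
      map_zero' := by simp
      map_add' := fun a b => by
        ext <;> simp
      commutes' := fun c => by
        ext <;> simp [TrivSqZeroExt.algebraMap_eq_inl'] }
  have h := E.infinitesimal_eq_zero (u := E.mapPoints (TrivSqZeroExt.inlAlgHom k R _) x - E.mapPoints g₂ x)
    (by
      rw [← mapPointsHom_apply, map_sub, mapPointsHom_apply, mapPointsHom_apply, ← E.mapPoints_comp, ← E.mapPoints_comp,
        sub_eq_zero]
      congr 1
      ext
      simp [g₂]) hm (by rw [smul_sub, ← E.mapPoints_nsmul, ← E.mapPoints_nsmul, hx, E.mapPoints_zero,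
        E.mapPoints_zero, sub_zero])
  have h2 := hmono _ _ _ (sub_eq_zero.1 h)
  have hD : ∀ r, D r = 0 := fun r => by
    have := congrArg (fun g => (g r).snd) h2
    simpa [g₂] using this.symm
  rw [Algebra.formallyUnramified_iff]
  refine ⟨fun a b => ?_⟩
  have : ∀ a : Ω[R⁄k], a = 0 := fun a => by
    have ha : a ∈ Submodule.span R (Set.range D) := by
      rw [KaehlerDifferential.span_range_derivation]; trivial
    have h0 : Set.range D ⊆ {0} := by rintro _ ⟨r, rfl⟩; exact hD r
    simpa using Submodule.span_mono h0 ha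
  rw [this a, this b]

end IsogenyComplex

namespace IsogenyComplex

/-! ### The torsion of an elliptic curve is a constant scheme -/

section TorsionScheme

variable {k : Type u} [Field k] (E : EllipticCurve k)

/-- The `m`-torsion of `E` is represented by a scheme that is proper over `k`. -/
lemma EllipticCurve.exists_torsion_scheme (m : ℕ) :
    ∃ (K : Over (Spec (CommRingCat.of k))) (ε : K ⟶ E.scheme), Mono ε ∧ IsProper K.hom ∧
      ε ^ m = 1 ∧ ∀ (T : Over (Spec (CommRingCat.of k))) (y : T ⟶ E.scheme), y ^ m = 1 →
        ∃ z, z ≫ ε = y := by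
  have hsep : IsSeparated E.scheme.hom := inferInstance
  let f : E.scheme ⟶ E.scheme := (𝟙 E.scheme) ^ m
  let ε := Limits.equalizer.ι f (1 : E.scheme ⟶ E.scheme)
  have hε : IsClosedImmersion ε.left := inferInstance
  refine ⟨_, ε, inferInstance, ?_, ?_, ?_⟩
  · rw [← Over.w ε]; infer_instance
  · have h := Limits.equalizer.condition f (1 : E.scheme ⟶ E.scheme)
    rw [MonObj.comp_one] at h
    change ε ≫ (𝟙 E.scheme) ^ m = 1 at h
    rwa [MonObj.comp_pow, Category.comp_id] at h
  · intro T y hy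
    refine ⟨Limits.equalizer.lift y ?_, Limits.equalizer.lift_ι _ _⟩
    rw [MonObj.comp_one]
    change y ≫ (𝟙 E.scheme) ^ m = 1
    rw [MonObj.comp_pow, Category.comp_id, hy]

lemma algHom_of_over_hom {C D : Type u} [CommRing C] [Algebra k C] [CommRing D] [Algebra k D]
    (g : specOver k D ⟶ specOver k C) : ∃ ψ : C →ₐ[k] D, specMap ψ = g := by
  obtain ⟨φ, hφ⟩ := Spec.map_surjective g.left
  have h := Over.w g
  rw [← hφ] at h
  change Spec.map φ ≫ Spec.map _ = Spec.map _ at h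
  rw [← Spec.map_comp, Spec.map_inj] at h
  refine ⟨⟨φ.hom, fun c => congrArg (fun f => f.hom c) h⟩, ?_⟩
  ext1
  exact hφ

lemma specMap_injective {C D : Type u} [CommRing C] [Algebra k C] [CommRing D] [Algebra k D]
    {ψ ψ' : C →ₐ[k] D} (h : specMap ψ = specMap ψ') : ψ = ψ' := by
  have h1 : Spec.map _ = Spec.map _ := congrArg (fun f => f.left) h
  rw [Spec.map_inj] at h1
  exact AlgHom.ext fun c => congrArg (fun f => f.hom c) h1

lemma of_forall_spec_openImmersion (P : MorphismProperty Scheme.{u}) [IsZariskiLocalAtSource P] {X Y : Scheme.{u}}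
    (f : X ⟶ Y) (h : ∀ (R : CommRingCat.{u}) (j : Spec R ⟶ X), IsOpenImmersion j → P (j ≫ f)) : P f :=
  (IsZariskiLocalAtSource.iff_of_openCover X.affineCover).2 fun i =>
    h _ _ (X.affineCover.map_prop i)

/-- A scheme over `k` with a monomorphism to the `m`-torsion of `E` is unramified over `k` if `m` is invertible. -/
lemma EllipticCurve.formallyUnramified_torsion_scheme {m : ℕ} (hm : (m : k) ≠ 0)
    {K : Over (Spec (CommRingCat.of k))} (ε : K ⟶ E.scheme) [Mono ε] (hε : ε ^ m = 1) :
    FormallyUnramified K.hom := by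
  have : IsZariskiLocalAtSource @FormallyUnramified.{u} :=
    HasRingHomProperty.instIsZariskiLocalAtSource (Q := RingHom.FormallyUnramified)
  refine of_forall_spec_openImmersion @FormallyUnramified _ fun R j hj => ?_
  obtain ⟨φ, hφ⟩ := Spec.map_surjective (j ≫ K.hom)
  rw [← hφ, HasRingHomProperty.Spec_iff (P := @FormallyUnramified)]
  let _ : Algebra k R := φ.hom.toAlgebra
  let j' : specOver k R ⟶ K := Over.homMk j hφ.symm
  have hj' : Mono j' := by
    have : Mono ((Over.forget _).map j') := (inferInstance : Mono j)
    exact (Over.forget _).mono_of_mono_map this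
  have hm' : Mono (j' ≫ ε) := mono_comp _ _
  refine E.formallyUnramified_of_mono (Additive.ofMul (j' ≫ ε)) (fun C _ _ g₁ g₂ h => ?_) (Ne.isUnit hm) ?_
  · exact specMap_injective ((cancel_mono (j' ≫ ε)).1 (congrArg Additive.toMul h))
  · rw [← ofMul_pow, ← MonObj.comp_pow, hε, MonObj.comp_one, ofMul_one]

/-- The `m`-torsion of `E` is represented by `Spec (J → k)` for some finite set `J`
if `m` is invertible in the algebraically closed field `k`. -/
theorem EllipticCurve.exists_universal_torsion_point [IsAlgClosed k] {m : ℕ} (hm : (m : k) ≠ 0) :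
    ∃ (J : Type u) (_ : Finite J) (t : E.Points (J → k)), m • t = 0 ∧
      ∀ (C : Type u) [CommRing C] [Algebra k C] (y : E.Points C), m • y = 0 →
        ∃! χ : (J → k) →ₐ[k] C, E.mapPoints χ t = y := by
  obtain ⟨K, ε, hmono, hprop, hεm, hlift⟩ := E.exists_torsion_scheme m
  have hunr := E.formallyUnramified_torsion_scheme hm ε hεm
  have hlft : LocallyOfFiniteType K.hom := inferInstance
  -- Unramified and of finite type gives quasi-finite; with properness this gives finite, and in
  -- particular affine.
  have hqf : LocallyQuasiFinite K.hom := by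
    have := HasRingHomProperty.instIsZariskiLocalAtSource (P := @LocallyQuasiFinite.{u}) (Q := RingHom.QuasiFinite)
    refine of_forall_spec_openImmersion @LocallyQuasiFinite _ fun R j hj => ?_
    have h1 : FormallyUnramified (j ≫ K.hom) :=
      MorphismProperty.comp_mem (W := @FormallyUnramified) _ _ inferInstance hunr
    have h2 : LocallyOfFiniteType (j ≫ K.hom) := inferInstance
    obtain ⟨φ, hφ⟩ := Spec.map_surjective (j ≫ K.hom)
    rw [← hφ] at h1 h2 ⊢
    rw [HasRingHomProperty.Spec_iff (P := @FormallyUnramified)] at h1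
    rw [HasRingHomProperty.Spec_iff (P := @LocallyOfFiniteType)] at h2
    rw [HasRingHomProperty.Spec_iff (P := @LocallyQuasiFinite)]
    algebraize [φ.hom]
    exact (inferInstance : Algebra.QuasiFinite k R)
  have hfin : IsFinite K.hom := IsFinite.of_isProper_of_locallyQuasiFinite K.hom
  have haff : IsAffine K.left := isAffine_of_isAffineHom K.hom
  obtain ⟨φ, hφ⟩ := Spec.map_surjective (K.left.isoSpec.inv ≫ K.hom)
  let A := Γ(K.left, ⊤)
  let _ : Algebra k A := φ.hom.toAlgebra
  let e : specOver k A ≅ K := Over.isoMk K.left.isoSpec.symm hφ.symm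
  have hfin' : Module.Finite k A := by
    have : IsFinite (Spec.map φ) := by rw [hφ]; infer_instance
    rw [IsFinite.SpecMap_iff] at this
    exact this
  have hunr' : Algebra.FormallyUnramified k A := by
    have : FormallyUnramified (Spec.map φ) := by
      rw [hφ]
      exact MorphismProperty.comp_mem (W := @FormallyUnramified) _ _ inferInstance hunr
    rw [HasRingHomProperty.Spec_iff (P := @FormallyUnramified)] at this
    exact this
  -- Over a field unramified implies étale, and a finite étale algebra over a separably closed field
  -- is a product of copies of that field, indexed by its prime ideals.
  have : Algebra.FormallyEtale k A := Algebra.FormallyEtale.of_formallyUnramified_of_field k A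
  have : IsArtinianRing A := isArtinian_of_tower k inferInstance
  let e' := Algebra.FormallyEtale.equivPiOfIsSepClosed k A
  let x : specOver k A ⟶ E.scheme := e.hom ≫ ε
  have : Mono x := mono_comp _ _
  have hx : x ^ m = 1 := by rw [← MonObj.comp_pow, hεm, MonObj.comp_one]
  refine ⟨PrimeSpectrum A, inferInstance, E.mapPoints e'.toAlgHom (Additive.ofMul x), ?_, ?_⟩
  · rw [← E.mapPoints_nsmul, ← ofMul_pow, hx, ofMul_one, E.mapPoints_zero]
  · intro C _ _ y hy
    obtain ⟨z, hz⟩ := hlift _ y.toMul hy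
    obtain ⟨ψ, hψ⟩ := algHom_of_over_hom (z ≫ e.inv)
    have hψ' : E.mapPoints ψ (Additive.ofMul x) = y := by
      unfold EllipticCurve.mapPoints
      rw [hψ, toMul_ofMul, Category.assoc, e.inv_hom_id_assoc, hz, ofMul_toMul]
    refine ⟨ψ.comp e'.symm.toAlgHom, ?_, ?_⟩
    · change E.mapPoints _ (E.mapPoints _ _) = y
      rw [← E.mapPoints_comp, AlgHom.comp_assoc]
      convert hψ'
      ext a
      simp
    · intro χ hχ
      rw [← E.mapPoints_comp, ← hψ'] at hχ
      have h2 : χ.comp e'.toAlgHom = ψ :=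
        specMap_injective ((cancel_mono x).1 (congrArg Additive.toMul hχ))
      rw [← h2]
      ext a
      simp

end TorsionScheme
end IsogenyComplex

namespace IsogenyComplex

/-! ### Deligne's theorem: a finite commutative group scheme is killed by its rank -/

section Deligne

open WithConv LinearMap Coalgebra Bialgebra
open scoped TensorProduct

variable (R : Type u) (A : Type v) [CommRing R] [CommRing A] [Bialgebra R A]

/-- The homomorphism of convolution algebras `Hom(A, R) → Hom(A, A)`. -/
def convLift : WithConv (A →ₗ[R] R) →+* WithConv (A →ₗ[R] A) where
  toFun f := toConv (Algebra.linearMap R A ∘ₗ f.ofConv)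
  map_one' := by
    ext; simp
  map_mul' f g := by
    have := algHom_comp_convMul_distrib (Algebra.ofId R A) f g
    exact ofConv_injective this
  map_zero' := by ext; simp
  map_add' f g := by ext; simp

/-- The algebra structure of `Hom(A, A)` over `Hom(A, R)`, for the convolution products. -/
abbrev convDualAlgebra [IsCocomm R A] : Algebra (WithConv (A →ₗ[R] R)) (WithConv (A →ₗ[R] A)) :=
  (convLift R A).toAlgebra

attribute [local instance] convDualAlgebra

variable {A R}

/-- `Hom(A, A)` is free over `Hom(A, R)` if `A` is free over `R`. -/
def convDualBasis [IsCocomm R A] {n : ℕ} (b : Module.Basis (Fin n) R A) :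
    Module.Basis (Fin n) (WithConv (A →ₗ[R] R)) (WithConv (A →ₗ[R] A)) :=
  .ofEquivFun
    { toFun := fun f i => toConv (b.coord i ∘ₗ f.ofConv)
      invFun := fun c => toConv (∑ i, (c i).ofConv.smulRight (b i))
      left_inv := fun f => by
        ext x
        simp
      right_inv := fun c => by
        ext i x
        simp [Finsupp.single_apply]
      map_add' := fun f g => by
        ext; simp
      map_smul' := fun f g => by
        funext i
        have h : b.coord i ∘ₗ mul' R A ∘ₗ TensorProduct.map (Algebra.linearMap R A ∘ₗ f.ofConv) g.ofConv =
            mul' R R ∘ₗ TensorProduct.map f.ofConv (b.coord i ∘ₗ g.ofConv) := by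
          ext x y
          simp [← Algebra.smul_def]
        ext x
        exact congrArg (fun l => l (comul x)) h }

/-- The convolution of the identity with a point `u` is the comorphism of translation by `u`, and
translations by mutually inverse points undo each other. -/
lemma algEquiv_of_convUnit_aux [IsCocomm R A] (u u' : WithConv (A →ₐ[R] R)) (h : u * u' = 1) :
    (toConv (AlgHom.id R A) * toConv ((Algebra.ofId R A).comp u.ofConv)).ofConv.comp
      (toConv (AlgHom.id R A) * toConv ((Algebra.ofId R A).comp u'.ofConv)).ofConv = AlgHom.id R A := by
  rw [AlgHom.comp_convMul_distrib]
  simp only [AlgHom.comp_id, ← AlgHom.comp_assoc]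
  have h1 : (toConv (AlgHom.id R A) * toConv ((Algebra.ofId R A).comp u.ofConv)).ofConv.comp (Algebra.ofId R A) = Algebra.ofId R A :=
    Subsingleton.elim _ _
  rw [h1, toConv_ofConv, _root_.mul_assoc]
  have h2 : toConv ((Algebra.ofId R A).comp u.ofConv) * toConv ((Algebra.ofId R A).comp u'.ofConv) = 1 := by
    apply ofConv_injective
    rw [← AlgHom.comp_convMul_distrib, h]
    ext; simp [Algebra.ofId_apply]
  rw [h2, _root_.mul_one]

/-- Deligne's theorem: a finite locally free commutative group scheme is killed by its rank. Here it is the spectrum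
of a bialgebra `A` that is free over `R`. -/
theorem conv_pow_finrank_eq_one [IsCocomm R A] [Nontrivial R] [Module.Free R A] [Module.Finite R A]
    (hid : IsUnit (toConv (AlgHom.id R A))) (u : WithConv (A →ₐ[R] R)) (hu : IsUnit u) :
    u ^ Module.finrank R A = 1 := by
  obtain ⟨u', hu'⟩ := hu.exists_right_inv
  let t : A ≃ₐ[R] A := AlgEquiv.ofAlgHom _ _ (algEquiv_of_convUnit_aux u u' hu')
    (algEquiv_of_convUnit_aux u' u (by rw [mul_comm, hu']))
  -- Translation by `u` acts on `Hom(A, A)` as an automorphism over `Hom(A, R)`, so it preserves the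
  -- norm.
  let T : WithConv (A →ₗ[R] A) ≃ₐ[WithConv (A →ₗ[R] R)] WithConv (A →ₗ[R] A) :=
    { toFun := fun f => toConv (t.toLinearMap ∘ₗ f.ofConv)
      invFun := fun f => toConv (t.symm.toLinearMap ∘ₗ f.ofConv)
      left_inv := fun f => by ext; simp
      right_inv := fun f => by ext; simp
      map_mul' := fun f g => ofConv_injective (algHom_comp_convMul_distrib (t : A →ₐ[R] A) f g)
      map_add' := fun f g => by ext; simp
      commutes' := fun f => by
        ext x
        exact t.commutes _ }
  let b := convDualBasis (Module.finBasis R A)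
  let i : WithConv (A →ₗ[R] A) := toConv LinearMap.id
  let u₀ : WithConv (A →ₗ[R] R) := toConv u.ofConv.toLinearMap
  -- The translate of the universal point `i` is `i * u`. Comparing norms gives `N(i) = N(i) * u ^
  -- rank`, and `N(i)` cancels because the universal point is invertible.
  have hT : T i = i * algebraMap _ _ u₀ := rfl
  have hN := Algebra.norm_eq_of_algEquiv T i
  rw [hT, map_mul, Algebra.norm_algebraMap_of_basis b, Fintype.card_fin] at hN
  have hi : IsUnit (Algebra.norm (WithConv (A →ₗ[R] R)) i) := by
    refine IsUnit.map _ ?_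
    obtain ⟨j, hj⟩ := hid.exists_right_inv
    refine IsUnit.of_mul_eq_one (toConv j.ofConv.toLinearMap) ?_
    exact congrArg (fun f => toConv (f.ofConv.toLinearMap)) hj
  have h1 : u₀ ^ Module.finrank R A = 1 := hi.mul_left_cancel (by rw [hN, _root_.mul_one])
  rw [← AlgHom.toLinearMap_convPow] at h1
  exact ofConv_injective (AlgHom.toLinearMap_injective (toConv_injective h1))

end Deligne
end IsogenyComplex

namespace IsogenyComplex

/-! ### From representable subgroup functors to bialgebras -/

section Rank

open scoped TensorProduct
open WithConv

variable {k : Type u} [CommRing k] {E : EllipticCurve k} {B : Type u} [CommRing B] [Algebra k B]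

/-- The algebra `A` represents the subgroup functor `G` of `E_B`, with universal point `x`. -/
structure SubgroupFunctor.Represents (G : SubgroupFunctor E B) (A : Type u) [CommRing A] [Algebra k A]
    [Algebra B A] [IsScalarTower k B A] (x : E.Points A) : Prop where
  mem : x ∈ G.points (IsScalarTower.toAlgHom k B A)
  exists_hom : ∀ (D : Type u) [CommRing D] [Algebra k D] [Algebra B D] [IsScalarTower k B D],
    ∀ y ∈ G.points (IsScalarTower.toAlgHom k B D),
      ∃ ψ : A →ₐ[B] D, E.mapPoints (ψ.restrictScalars k) x = y
  hom_ext : ∀ (D : Type u) [CommRing D] [Algebra k D] [Algebra B D] [IsScalarTower k B D]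
    (ψ ψ' : A →ₐ[B] D), E.mapPoints (ψ.restrictScalars k) x = E.mapPoints (ψ'.restrictScalars k) x → ψ = ψ'

variable {G : SubgroupFunctor E B} {A : Type u} [CommRing A] [Algebra k A]
    [Algebra B A] [IsScalarTower k B A] {x : E.Points A}

lemma SubgroupFunctor.mapPoints_mem_of_tower (G : SubgroupFunctor E B) {x : E.Points A}
    (hx : x ∈ G.points (IsScalarTower.toAlgHom k B A))
    {D : Type u} [CommRing D] [Algebra k D] [Algebra B D] [IsScalarTower k B D]
    (ψ : A →ₐ[B] D) : E.mapPoints (ψ.restrictScalars k) x ∈ G.points (IsScalarTower.toAlgHom k B D) := by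
  have := G.mapPoints_mem _ (ψ.restrictScalars k) x hx
  convert this
  ext b
  simp

lemma EllipticCurve.mapPoints_restrictScalars_comp (E : EllipticCurve k) {D D' : Type u} [CommRing D] [Algebra k D]
    [Algebra B D] [IsScalarTower k B D] [CommRing D'] [Algebra k D'] [Algebra B D'] [IsScalarTower k B D']
    (g : D →ₐ[B] D') (f : A →ₐ[B] D) (x : E.Points A) :
    E.mapPoints ((g.comp f).restrictScalars k) x =
      E.mapPoints (g.restrictScalars k) (E.mapPoints (f.restrictScalars k) x) := by
  have : (g.comp f).restrictScalars k = (g.restrictScalars k).comp (f.restrictScalars k) := by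
    ext; rfl
  rw [this, E.mapPoints_comp]

open Algebra.TensorProduct in
/-- A subgroup functor of `E_B` represented by a `B`-algebra that is free of rank `N` is killed by `N`. -/
theorem SubgroupFunctor.Represents.finrank_nsmul_eq_zero (h : G.Represents A x) [Nontrivial B]
    [Module.Free B A] [Module.Finite B A] (y : E.Points B) (hy : y ∈ G.points (AlgHom.id k B)) :
    Module.finrank B A • y = 0 := by
  have hcomp : ∀ {D D' : Type u} [CommRing D] [Algebra k D] [Algebra B D] [IsScalarTower k B D]
    [CommRing D'] [Algebra k D'] [Algebra B D'] [IsScalarTower k B D'] (g : D →ₐ[B] D') (f : A →ₐ[B] D),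
    E.mapPoints ((g.comp f).restrictScalars k) x =
      E.mapPoints (g.restrictScalars k) (E.mapPoints (f.restrictScalars k) x) :=
    fun g f => E.mapPoints_restrictScalars_comp g f x
  -- The comultiplication classifies the sum of the two universal points, the counit the zero point,
  -- and `S` the negative of the universal point. The bialgebra axioms are then identities between
  -- points, checked through `h.hom_ext`.
  obtain ⟨Δ, hΔ⟩ := h.exists_hom (A ⊗[B] A) _
    (add_mem (G.mapPoints_mem_of_tower h.mem (includeLeft : A →ₐ[B] A ⊗[B] A))
      (G.mapPoints_mem_of_tower h.mem (includeRight : A →ₐ[B] A ⊗[B] A)))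
  have hΔ' : ∀ {D : Type u} [CommRing D] [Algebra k D] [Algebra B D] [IsScalarTower k B D]
    (g : A ⊗[B] A →ₐ[B] D), E.mapPoints ((g.comp Δ).restrictScalars k) x =
      E.mapPoints ((g.comp includeLeft).restrictScalars k) x +
        E.mapPoints ((g.comp includeRight).restrictScalars k) x := fun g => by
    rw [hcomp, hΔ, E.mapPoints_add, hcomp, hcomp]
  have hid : IsScalarTower.toAlgHom k B B = AlgHom.id k B := by ext; simp
  obtain ⟨ε, hε⟩ := h.exists_hom B 0 (zero_mem _)
  have hε' : ∀ {D : Type u} [CommRing D] [Algebra k D] [Algebra B D] [IsScalarTower k B D]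
    (g : B →ₐ[B] D), E.mapPoints ((g.comp ε).restrictScalars k) x = 0 := fun g => by
    rw [hcomp, hε, E.mapPoints_zero]
  obtain ⟨S, hS⟩ := h.exists_hom A (-x) (neg_mem h.mem)
  let _ : Bialgebra B A := Bialgebra.ofAlgHom Δ ε
    (by
      refine h.hom_ext _ _ _ ?_
      have e1 : (Algebra.TensorProduct.assoc B B B A A A).toAlgHom.comp
          ((Algebra.TensorProduct.map Δ (.id B A)).comp includeLeft) =
          ((Algebra.TensorProduct.assoc B B B A A A).toAlgHom.comp includeLeft).comp Δ := by
        rw [map_comp_includeLeft, AlgHom.comp_assoc]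
      have e2 : (Algebra.TensorProduct.map (.id B A) Δ).comp includeRight =
          (includeRight : A ⊗[B] A →ₐ[B] A ⊗[B] (A ⊗[B] A)).comp Δ := map_comp_includeRight _ _
      have e3 : ((Algebra.TensorProduct.assoc B B B A A A).toAlgHom.comp includeLeft).comp includeLeft =
          (Algebra.TensorProduct.map (.id B A) Δ).comp includeLeft := by
        ext; simp [Algebra.TensorProduct.one_def]
      have e4 : ((Algebra.TensorProduct.assoc B B B A A A).toAlgHom.comp (Algebra.TensorProduct.map Δ (.id B A))).comp
          includeRight = (includeRight : A ⊗[B] A →ₐ[B] A ⊗[B] (A ⊗[B] A)).comp includeRight := by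
        ext; simp [Algebra.TensorProduct.one_def]
      have e5 : ((Algebra.TensorProduct.assoc B B B A A A).toAlgHom.comp includeLeft).comp includeRight =
          (includeRight : A ⊗[B] A →ₐ[B] A ⊗[B] (A ⊗[B] A)).comp includeLeft := by
        ext; simp
      rw [← AlgHom.comp_assoc, hΔ', hΔ', e2, hΔ', e4, AlgHom.comp_assoc, e1, hΔ', e3, e5, add_assoc])
    (by
      refine h.hom_ext _ _ _ ?_
      rw [hΔ', map_comp_includeLeft, map_comp_includeRight, hε', zero_add]
      congr 1)
    (by
      refine h.hom_ext _ _ _ ?_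
      rw [hΔ', map_comp_includeLeft, map_comp_includeRight, hε', add_zero]
      congr 1)
  have hcocomm : Coalgebra.IsCocomm B A := by
    refine ⟨?_⟩
    have : (Algebra.TensorProduct.comm B A A).toAlgHom.comp Δ = Δ := by
      refine h.hom_ext _ _ _ ?_
      rw [hΔ', hΔ, add_comm]
      congr 2
    exact congrArg AlgHom.toLinearMap this
  -- Evaluation at the universal point turns convolution of algebra homomorphisms into addition on
  -- `E`.
  have hmul : ∀ {D : Type u} [CommRing D] [Algebra k D] [Algebra B D] [IsScalarTower k B D]
      (f g : WithConv (A →ₐ[B] D)), E.mapPoints ((f * g).ofConv.restrictScalars k) x =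
        E.mapPoints (f.ofConv.restrictScalars k) x + E.mapPoints (g.ofConv.restrictScalars k) x := fun f g => by
    have e : (f * g).ofConv = ((lmul' B).comp (map f.ofConv g.ofConv)).comp Δ := rfl
    have e1 : ((lmul' B).comp (map f.ofConv g.ofConv)).comp includeLeft = f.ofConv := by
      ext; simp
    have e2 : ((lmul' B).comp (map f.ofConv g.ofConv)).comp includeRight = g.ofConv := by
      ext; simp
    rw [e, hΔ', e1, e2]
  have hone : ∀ {D : Type u} [CommRing D] [Algebra k D] [Algebra B D] [IsScalarTower k B D],
      E.mapPoints ((1 : WithConv (A →ₐ[B] D)).ofConv.restrictScalars k) x = 0 := fun {D} => hε' _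
  have hext : ∀ {D : Type u} [CommRing D] [Algebra k D] [Algebra B D] [IsScalarTower k B D]
      (f g : WithConv (A →ₐ[B] D)), E.mapPoints (f.ofConv.restrictScalars k) x =
        E.mapPoints (g.ofConv.restrictScalars k) x → f = g := fun f g hfg =>
    ofConv_injective (h.hom_ext _ _ _ hfg)
  have hx : E.mapPoints ((AlgHom.id B A).restrictScalars k) x = x := E.mapPoints_id x
  rw [← hid] at hy
  obtain ⟨u, hu⟩ := h.exists_hom B y hy
  obtain ⟨u', hu'⟩ := h.exists_hom B (-y) (neg_mem hy)
  have key := conv_pow_finrank_eq_one (R := B) (A := A)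
    (IsUnit.of_mul_eq_one (toConv S) (hext _ _ (by rw [hmul, hone, ofConv_toConv, ofConv_toConv, hS, hx, add_neg_cancel])))
    (toConv u) (IsUnit.of_mul_eq_one (toConv u') (hext _ _ (by rw [hmul, hone, ofConv_toConv, ofConv_toConv, hu, hu', add_neg_cancel])))
  have hpow : ∀ n : ℕ, E.mapPoints ((toConv u ^ n).ofConv.restrictScalars k) x = n • y := fun n => by
    induction n with
    | zero => rw [pow_zero, hone, zero_smul]
    | succ n ih => rw [pow_succ, hmul, ih, ofConv_toConv, hu, add_smul, one_smul]
  rw [← hpow, key, hone]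

end Rank
end IsogenyComplex

namespace IsogenyComplex
-- Base change of subgroup functors, and the rank theorem in the locally free case
section BaseChange
open scoped TensorProduct

variable {k : Type u} [CommRing k] {E : EllipticCurve k} {B : Type u} [CommRing B] [Algebra k B]

/-- The base change of a subgroup functor along `φ : B → B'`. -/
def SubgroupFunctor.baseChange (G : SubgroupFunctor E B) {B' : Type u} [CommRing B'] [Algebra k B']
    (φ : B →ₐ[k] B') : SubgroupFunctor E B' where
  points ψ := G.points (ψ.comp φ)
  mapPoints_mem ψ ψ' x hx := by
    rw [AlgHom.comp_assoc]
    exact G.mapPoints_mem _ _ _ hx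

variable {G : SubgroupFunctor E B} {A : Type u} [CommRing A] [Algebra k A]
    [Algebra B A] [IsScalarTower k B A] {x : E.Points A}

lemma SubgroupFunctor.Represents.baseChange (h : G.Represents A x) (B' : Type u) [CommRing B']
    [Algebra k B'] [Algebra B B'] [IsScalarTower k B B'] :
    (G.baseChange (IsScalarTower.toAlgHom k B B')).Represents (B' ⊗[B] A)
      (E.mapPoints ((Algebra.TensorProduct.includeRight : A →ₐ[B] B' ⊗[B] A).restrictScalars k) x) := by
  refine ⟨?_, ?_, ?_⟩
  · have := G.mapPoints_mem_of_tower h.mem (Algebra.TensorProduct.includeRight : A →ₐ[B] B' ⊗[B] A)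
    exact this
  · intro D _ _ _ _ y hy
    let _ : Algebra B D := ((algebraMap B' D).comp (algebraMap B B')).toAlgebra
    have : IsScalarTower B B' D := .of_algebraMap_eq' rfl
    have : IsScalarTower k B D := .of_algebraMap_eq fun c => by
      rw [IsScalarTower.algebraMap_apply B B' D, ← IsScalarTower.algebraMap_apply k B B',
        ← IsScalarTower.algebraMap_apply k B' D]
    obtain ⟨ψ, hψ⟩ := h.exists_hom D y hy
    refine ⟨Algebra.TensorProduct.lift (Algebra.ofId B' D) ψ fun _ _ => Commute.all _ _, ?_⟩
    rw [← hψ, ← E.mapPoints_comp]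
    congr 1
    ext; simp
  · intro D _ _ _ _ ψ ψ' hψ
    let _ : Algebra B D := ((algebraMap B' D).comp (algebraMap B B')).toAlgebra
    have : IsScalarTower B B' D := .of_algebraMap_eq' rfl
    have : IsScalarTower k B D := .of_algebraMap_eq fun c => by
      rw [IsScalarTower.algebraMap_apply B B' D, ← IsScalarTower.algebraMap_apply k B B',
        ← IsScalarTower.algebraMap_apply k B' D]
    refine Algebra.TensorProduct.ext (Subsingleton.elim _ _) (h.hom_ext D _ _ ?_)
    rw [← E.mapPoints_comp, ← E.mapPoints_comp] at hψ
    exact hψ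

/-- The free case of the rank theorem concerns points over the base. The universal point lives over
`A`, so the base is changed to `A` itself, which preserves the rank. -/
lemma SubgroupFunctor.Represents.finrank_nsmul_universal [Nontrivial B] (h : G.Represents A x) [Module.Free B A] [Module.Finite B A] :
    Module.finrank B A • x = 0 := by
  cases subsingleton_or_nontrivial A
  · rw [Module.finrank_zero_of_subsingleton, zero_smul]
  · rw [← Module.finrank_baseChange (R := A)]
    refine (h.baseChange A).finrank_nsmul_eq_zero x ?_
    exact h.mem

/-- A finite locally free subgroup scheme of rank `N` is killed by `N`. -/
theorem SubgroupFunctor.Represents.rank_nsmul_universal (h : G.Represents A x) [Module.Projective B A]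
    [Module.Finite B A] {N : ℕ} (hN : ∀ 𝔭 : PrimeSpectrum B, Module.rankAtStalk (R := B) A 𝔭 = N) :
    N • x = 0 := by
  refine E.points_ext (J := PrimeSpectrum B) (D := fun 𝔭 => Localization 𝔭.asIdeal.primeCompl ⊗[B] A)
    (fun 𝔭 => (Algebra.TensorProduct.includeRight : A →ₐ[B] Localization 𝔭.asIdeal.primeCompl ⊗[B] A).restrictScalars k)
    (fun a ha => ?_) fun 𝔭 => ?_
  -- An element of `A` is zero once it vanishes locally on `B`, so it suffices to kill the universal
  -- point over each local ring, where `A` is free of rank `N`.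
  · refine Module.eq_zero_of_localization_maximal (R := B)
      (fun P _ => Localization P.primeCompl ⊗[B] A) (fun P _ => TensorProduct.mk B (Localization P.primeCompl) A 1) a
      fun P hP => ha ⟨P, hP.isPrime⟩
  · have hrank := hN 𝔭
    rw [Module.rankAtStalk_eq_finrank_tensorProduct] at hrank
    have := Module.free_of_flat_of_isLocalRing (R := Localization 𝔭.asIdeal.primeCompl) (P := Localization 𝔭.asIdeal.primeCompl ⊗[B] A)
    have h2 := (h.baseChange (Localization 𝔭.asIdeal.primeCompl)).finrank_nsmul_universal
    rw [E.mapPoints_nsmul, E.mapPoints_zero, ← hrank]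
    exact h2

end BaseChange
end IsogenyComplex

namespace IsogenyComplex

/-! ### Subgroup schemes of constant torsion are cut out by idempotents -/

section Constancy
open scoped TensorProduct

variable {k : Type u} [Field k] {E : EllipticCurve k} {J : Type u} [Fintype J] [DecidableEq J]

/-- The point `t` of `E` with values in `J → k` is the universal `m`-torsion point. -/
structure IsUniversalTorsion (m : ℕ) (t : E.Points (J → k)) : Prop where
  nsmul_eq_zero : m • t = 0
  exists_hom : ∀ {C : Type u} [CommRing C] [Algebra k C] (y : E.Points C), m • y = 0 →
    ∃ χ : (J → k) →ₐ[k] C, E.mapPoints χ t = y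
  hom_ext : ∀ {C : Type u} [CommRing C] [Algebra k C] (χ χ' : (J → k) →ₐ[k] C),
    E.mapPoints χ t = E.mapPoints χ' t → χ = χ'

lemma pi_algHom_apply {C : Type*} [CommRing C] [Algebra k C] (χ : (J → k) →ₐ[k] C) (f : J → k) :
    χ f = ∑ j, f j • χ (Pi.single j 1) := by
  conv_lhs => rw [← Finset.univ_sum_single f]
  rw [map_sum]
  refine Finset.sum_congr rfl fun j _ => ?_
  rw [← map_smul, ← Pi.single_smul, smul_eq_mul, _root_.mul_one]

lemma pi_algHom_single_mul_single {C : Type*} [CommRing C] [Algebra k C] (χ : (J → k) →ₐ[k] C) (i j : J) :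
    χ (Pi.single i 1) * χ (Pi.single j 1) = if i = j then χ (Pi.single i 1) else 0 := by
  rw [← map_mul]
  split_ifs with h
  · subst h; congr 1; rw [← Pi.single_mul, _root_.mul_one]
  · have : (Pi.single i 1 * Pi.single j 1 : J → k) = 0 := by
      funext l
      simp only [Pi.mul_apply, Pi.single_apply, Pi.zero_apply]
      split_ifs <;> simp_all
    rw [this, map_zero]

lemma pi_algHom_sum_single {C : Type*} [CommRing C] [Algebra k C] (χ : (J → k) →ₐ[k] C) :
    ∑ j, χ (Pi.single j 1) = 1 := by
  have := pi_algHom_apply χ 1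
  simpa using this.symm

lemma eq_zero_or_one_of_idempotent {D : Type*} [CommRing D] [IsLocalRing D] {e : D} (h : e * e = e) :
    e = 0 ∨ e = 1 := by
  rcases IsLocalRing.isUnit_or_isUnit_of_add_one (add_sub_cancel e 1) with hu | hu
  · exact Or.inr (hu.mul_left_cancel (by rw [h, _root_.mul_one]))
  · exact Or.inl (hu.mul_left_cancel (by rw [sub_mul, h]; ring))

lemma pi_algHom_eq_eval {C : Type*} [CommRing C] [Algebra k C] (χ : (J → k) →ₐ[k] C) {i : J}
    (hi : χ (Pi.single i 1) = 1) : χ = (Algebra.ofId k C).comp (Pi.evalAlgHom k (fun _ => k) i) := by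
  ext f
  have h : ∀ j ≠ i, χ (Pi.single j 1) = 0 := fun j hj => by
    have := pi_algHom_single_mul_single χ j i
    rwa [if_neg hj, hi, _root_.mul_one] at this
  rw [pi_algHom_apply, Finset.sum_eq_single i (fun j _ hj => by rw [h j hj, smul_zero]) (by simp), hi]
  simp [Algebra.ofId_apply, Algebra.smul_def]

/-- The images of the coordinate idempotents are each `0` or `1` in a local ring and sum to `1`, so
one of them is `1`. A torsion point over a local ring is therefore constant. -/
lemma exists_pi_algHom_eq_eval {C : Type*} [CommRing C] [IsLocalRing C] [Algebra k C] (χ : (J → k) →ₐ[k] C) :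
    ∃ i, χ = (Algebra.ofId k C).comp (Pi.evalAlgHom k (fun _ => k) i) := by
  by_contra! h
  have h0 : ∀ i, χ (Pi.single i 1) = 0 := fun i =>
    (eq_zero_or_one_of_idempotent (by simpa using pi_algHom_single_mul_single χ i i)).resolve_right
      fun h1 => h i (pi_algHom_eq_eval χ h1)
  have := pi_algHom_sum_single χ
  simp [h0] at this

variable {m : ℕ} {t : E.Points (J → k)}

/-- The `k`-rational point that is the value of `t` at `j`. -/
def valueAt (t : E.Points (J → k)) (j : J) : E.Points k := E.mapPoints (Pi.evalAlgHom k (fun _ => k) j) t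

lemma mapPoints_ofId_valueAt (t : E.Points (J → k)) (j : J) (C : Type u) [CommRing C] [Algebra k C] :
    E.mapPoints (Algebra.ofId k C) (valueAt t j) =
      E.mapPoints ((Algebra.ofId k C).comp (Pi.evalAlgHom k (fun _ => k) j)) t := (E.mapPoints_comp _ _ _).symm

lemma IsUniversalTorsion.nsmul_mapPoints (ht : IsUniversalTorsion m t) {C : Type u} [CommRing C] [Algebra k C]
    (χ : (J → k) →ₐ[k] C) : m • E.mapPoints χ t = 0 := by
  rw [← E.mapPoints_nsmul, ht.nsmul_eq_zero, E.mapPoints_zero]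

lemma IsUniversalTorsion.valueAt_injective (ht : IsUniversalTorsion m t) : Function.Injective (valueAt t) := by
  intro i j h
  have := congrArg (fun χ => χ (Pi.single i 1)) (ht.hom_ext _ _ h)
  by_contra hij
  simp [Ne.symm hij] at this

lemma IsUniversalTorsion.exists_valueAt (ht : IsUniversalTorsion m t) (y : E.Points k) (hy : m • y = 0) :
    ∃ j, valueAt t j = y := by
  obtain ⟨χ, rfl⟩ := ht.exists_hom y hy
  obtain ⟨i, rfl⟩ := exists_pi_algHom_eq_eval χ
  exact ⟨i, by rw [← mapPoints_ofId_valueAt]; exact (E.mapPoints_id _).symm⟩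

variable {B : Type u} [CommRing B] [Algebra k B] {G : SubgroupFunctor E B} {A : Type u} [CommRing A] [Algebra k A]
    [Algebra B A] [IsScalarTower k B A] {x : E.Points A}

lemma tensor_pi_eq_sum (z : B ⊗[k] (J → k)) : ∃ b : J → B, z = ∑ j, b j ⊗ₜ[k] Pi.single j 1 := by
  induction z with
  | zero => exact ⟨0, by simp⟩
  | tmul b f =>
    refine ⟨fun j => f j • b, ?_⟩
    conv_lhs => rw [← Finset.univ_sum_single f]
    rw [TensorProduct.tmul_sum]
    refine Finset.sum_congr rfl fun j _ => ?_
    rw [TensorProduct.smul_tmul, ← Pi.single_smul, smul_eq_mul, _root_.mul_one]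
  | add z z' hz hz' =>
    obtain ⟨b, rfl⟩ := hz
    obtain ⟨b', rfl⟩ := hz'
    exact ⟨b + b', by simp [TensorProduct.add_tmul, Finset.sum_add_distrib]⟩

/-- The homomorphism `B ⊗ (J → k) → A` given by a homomorphism `(J → k) → A`. -/
def tensorPiLift (B : Type u) [CommRing B] [Algebra k B] {A : Type u} [CommRing A] [Algebra k A]
    [Algebra B A] [IsScalarTower k B A] (χ : (J → k) →ₐ[k] A) : B ⊗[k] (J → k) →ₐ[B] A :=
  Algebra.TensorProduct.lift (Algebra.ofId B A) χ fun _ _ => Commute.all _ _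

lemma tensorPiLift_sum (χ : (J → k) →ₐ[k] A) (b : J → B) :
    tensorPiLift B χ (∑ j, b j ⊗ₜ[k] Pi.single j 1) = ∑ j, b j • χ (Pi.single j 1) := by
  simp [tensorPiLift, Algebra.ofId_apply, Algebra.smul_def]

/-- The subgroup functor embeds into the constant torsion scheme, so the comorphism is an
epimorphism of rings. It is also finite, and a finite epimorphism is surjective. -/
lemma SubgroupFunctor.Represents.tensorPiLift_surjective (h : G.Represents A x)
    [Module.Finite B A] (χ : (J → k) →ₐ[k] A) (hχ : E.mapPoints χ t = x) :
    Function.Surjective (tensorPiLift B χ) := by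
  let f : CommRingCat.of (B ⊗[k] (J → k)) ⟶ CommRingCat.of A := CommRingCat.ofHom (tensorPiLift B χ).toRingHom
  have hfin : f.hom.Finite := by
    have : Module.Finite B A := inferInstance
    refine RingHom.Finite.of_comp_finite (f := algebraMap B (B ⊗[k] (J → k))) ?_
    have h2 : f.hom.comp (algebraMap B (B ⊗[k] (J → k))) = algebraMap B A := (tensorPiLift B χ).comp_algebraMap
    rw [h2, RingHom.finite_algebraMap]
    exact this
  have hepi : Epi f := by
    refine ⟨fun {D} g₁ g₂ hg => ?_⟩
    let _ : Algebra B D := ((g₁.hom.comp f.hom).comp (algebraMap B (B ⊗[k] (J → k)))).toAlgebra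
    let _ : Algebra k D := ((algebraMap B D).comp (algebraMap k B)).toAlgebra
    have : IsScalarTower k B D := .of_algebraMap_eq' rfl
    have hg' : ∀ z, g₁.hom (tensorPiLift B χ z) = g₂.hom (tensorPiLift B χ z) := fun z => congrArg (fun l => l.hom z) hg
    have hB : ∀ b : B, tensorPiLift B χ (algebraMap B _ b) = algebraMap B A b := (tensorPiLift B χ).commutes
    let ψ₁ : A →ₐ[B] D := { g₁.hom with commutes' := fun b => congrArg g₁.hom (hB b).symm }
    have hB' : ∀ b : B, g₂.hom (algebraMap B A b) = algebraMap B D b := fun b => by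
      change _ = g₁.hom (tensorPiLift B χ _)
      rw [hg', hB]
    let ψ₂ : A →ₐ[B] D := { g₂.hom with commutes' := hB' }
    have : ψ₁ = ψ₂ := by
      refine h.hom_ext D _ _ ?_
      rw [← hχ, ← E.mapPoints_comp, ← E.mapPoints_comp]
      congr 1
      ext f
      have := hg' (1 ⊗ₜ f)
      change g₁.hom (χ f) = g₂.hom (χ f)
      simpa [tensorPiLift] using this
    ext a
    exact congrArg (fun l => l a) this
  exact RingHom.surjective_of_epi_of_finite f hfin

/-- A cyclic direct summand of `A` is cut out by an idempotent of `B`. -/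
lemma exists_idempotent_of_projective [Module.Projective B A] {ε : A} (hid : ε * ε = ε) (hε : ∀ a : A, ∃ b : B, b • ε = ε * a)  :
    ∃ e : B, e • ε = ε ∧ ∀ b : B, b • ε = 0 → b * e = 0 := by
  let N := LinearMap.range (LinearMap.toSpanSingleton B A ε)
  -- Projectivity lifts multiplication by `ε`, as a map from `A` onto the cyclic module `B • ε`, to
  -- a linear map `f : A → B`. The required element is `f ε`.
  obtain ⟨f, hf⟩ := Module.projective_lifting_property
    (LinearMap.toSpanSingleton B A ε).rangeRestrict
    ((LinearMap.mulLeft B ε).codRestrict N fun a => hε a) (LinearMap.surjective_rangeRestrict _)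
  have hf' : ∀ a, f a • ε = ε * a := fun a => congrArg Subtype.val (LinearMap.congr_fun hf a)
  exact ⟨f ε, by rw [hf', hid], fun b hb => by rw [← smul_eq_mul, ← map_smul, hb, map_zero]⟩

/-- The idempotents `e j` describe the subgroup functor `G` inside the `m`-torsion. -/
structure IsDescribedBy (G : SubgroupFunctor E B) (m : ℕ) (t : E.Points (J → k)) (e : J → B) : Prop where
  nsmul_eq_zero : ∀ {C : Type u} [CommRing C] [Algebra k C] (φ : B →ₐ[k] C), ∀ y ∈ G.points φ, m • y = 0
  mem_iff : ∀ {C : Type u} [CommRing C] [Algebra k C] (φ : B →ₐ[k] C) (χ : (J → k) →ₐ[k] C),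
    E.mapPoints χ t ∈ G.points φ ↔ ∀ j, φ (e j) * χ (Pi.single j 1) = χ (Pi.single j 1)
  idempotent : ∀ j, e j * e j = e j

/-- By Deligne's theorem `G` lies in the `m`-torsion, so `A` is a quotient of a product of copies of
`B` indexed by `J`. The image of each coordinate idempotent spans a cyclic direct summand of the
projective module `A`, whose annihilator is governed by an idempotent `e j` of `B`. If `B` is local,
the summands with `e j = 1` are free of rank one and the others vanish, so counting them gives the
rank. -/
lemma SubgroupFunctor.Represents.exists_isDescribedBy (ht : IsUniversalTorsion m t) (h : G.Represents A x)
    [Module.Finite B A] [Module.Projective B A] {N : ℕ}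
    (hN : ∀ 𝔭 : PrimeSpectrum B, Module.rankAtStalk (R := B) A 𝔭 = N) (hm : N ∣ m) :
    ∃ e : J → B, IsDescribedBy G m t e ∧
      (IsLocalRing B → N = Nat.card {j // e j = 1}) := by
  have hx : m • x = 0 := by
    obtain ⟨c, rfl⟩ := hm
    rw [mul_comm, mul_smul, h.rank_nsmul_universal hN, smul_zero]
  obtain ⟨χ, hχ⟩ := ht.exists_hom x hx
  have hsurj := h.tensorPiLift_surjective χ hχ
  have hspan : ∀ a : A, ∃ b : J → B, ∑ j, b j • χ (Pi.single j 1) = a := fun a => by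
    obtain ⟨z, rfl⟩ := hsurj a
    obtain ⟨b, rfl⟩ := tensor_pi_eq_sum z
    exact ⟨b, (tensorPiLift_sum χ b).symm⟩
  have horth := pi_algHom_single_mul_single χ
  have hmul : ∀ (b : J → B) (i : J), χ (Pi.single i 1) * ∑ j, b j • χ (Pi.single j 1) = b i • χ (Pi.single i 1) :=
    fun b i => by
      rw [Finset.mul_sum, Finset.sum_eq_single i (fun j _ hj => by rw [mul_smul_comm, horth, if_neg hj.symm, smul_zero])
        (by simp), mul_smul_comm, horth, if_pos rfl]
  have hex : ∀ j, ∃ e : B, e • χ (Pi.single j 1) = χ (Pi.single j 1) ∧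
      ∀ b : B, b • χ (Pi.single j 1) = 0 → b * e = 0 := fun j => by
    refine exists_idempotent_of_projective (by simpa using horth j j) fun a => ?_
    obtain ⟨b, rfl⟩ := hspan a
    exact ⟨b j, (hmul b j).symm⟩
  choose e he hann using hex
  have hidem : ∀ j, e j * e j = e j := fun j => by
    have := hann j (1 - e j) (by rw [sub_smul, he, one_smul, sub_self])
    rwa [sub_mul, _root_.one_mul, sub_eq_zero, eq_comm] at this
  have hind : ∀ b : J → B, ∑ j, b j • χ (Pi.single j 1) = 0 → ∀ j, b j * e j = 0 := fun b hb j =>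
    hann j _ (by rw [← hmul, hb, mul_zero])
  refine ⟨e, ⟨?_, ?_, hidem⟩, ?_⟩
  · intro C _ _ φ y hy
    let _ : Algebra B C := φ.toRingHom.toAlgebra
    have : IsScalarTower k B C := .of_algebraMap_eq fun c => (φ.commutes c).symm
    have hφ : IsScalarTower.toAlgHom k B C = φ := AlgHom.ext fun _ => rfl
    rw [← hφ] at hy
    obtain ⟨ψ, rfl⟩ := h.exists_hom C y hy
    rw [← E.mapPoints_nsmul, hx, E.mapPoints_zero]
  · intro C _ _ φ χ'
    let _ : Algebra B C := φ.toRingHom.toAlgebra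
    have : IsScalarTower k B C := .of_algebraMap_eq fun c => (φ.commutes c).symm
    have hφ : IsScalarTower.toAlgHom k B C = φ := AlgHom.ext fun _ => rfl
    have hφ' : ∀ b, φ b = algebraMap B C b := fun _ => rfl
    constructor
    · intro hy j
      rw [← hφ] at hy
      obtain ⟨ψ, hψ⟩ := h.exists_hom C _ hy
      rw [← hχ, ← E.mapPoints_comp] at hψ
      rw [← ht.hom_ext _ _ hψ]
      change φ (e j) * ψ (χ _) = ψ (χ _)
      rw [hφ', ← Algebra.smul_def, ← map_smul, he]
    · intro hy
      -- A relation among the images of the coordinate idempotents has coefficients killed by the `e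
      -- j`, and the conditions on `χ'` make those coefficients act as zero in `C`.
      have hker : RingHom.ker (tensorPiLift B χ).toRingHom ≤ RingHom.ker (tensorPiLift B χ').toRingHom := by
        intro z hz
        obtain ⟨b, rfl⟩ := tensor_pi_eq_sum z
        have hz' : tensorPiLift B χ _ = 0 := hz
        change tensorPiLift B χ' _ = 0
        rw [tensorPiLift_sum] at hz' ⊢
        refine Finset.sum_eq_zero fun j _ => ?_
        rw [← hy j, Algebra.smul_def, ← hφ', ← _root_.mul_assoc, ← map_mul, hind b hz' j, map_zero, zero_mul]
      let ψ := AlgHom.liftOfSurjective (tensorPiLift B χ) hsurj (tensorPiLift B χ') hker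
      have hψ : (ψ.restrictScalars k).comp χ = χ' := by
        ext f
        have := AlgHom.liftOfSurjective_apply (tensorPiLift B χ) hsurj (tensorPiLift B χ') hker (1 ⊗ₜ f)
        change ψ (χ f) = χ' f
        simp only [tensorPiLift, Algebra.TensorProduct.lift_tmul, map_one, _root_.one_mul] at this
        exact this
      rw [← hψ, E.mapPoints_comp, hχ, ← hφ]
      exact G.mapPoints_mem_of_tower h.mem ψ
  · intro hB
    classical
    let b : Module.Basis {j // e j = 1} B A := Module.Basis.mk (v := fun j => χ (Pi.single j.1 1))
      (by
        rw [Fintype.linearIndependent_iff]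
        intro g hg i
        have h1 := congrArg (fun a => χ (Pi.single i.1 1) * a) hg
        simp only [mul_zero, Finset.mul_sum] at h1
        rw [Finset.sum_eq_single i (fun j _ hj => by
          rw [mul_smul_comm, horth, if_neg fun h => hj (Subtype.ext h.symm), smul_zero]) (by simp),
          mul_smul_comm, horth, if_pos rfl] at h1
        have h2 := hann _ _ h1
        rwa [i.2, _root_.mul_one] at h2)
      (by
        intro a _
        obtain ⟨b, rfl⟩ := hspan a
        refine Submodule.sum_mem _ fun j _ => Submodule.smul_mem _ _ ?_
        rcases eq_zero_or_one_of_idempotent (hidem j) with h0 | h1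
        · rw [← he, h0, zero_smul]; exact zero_mem _
        · exact Submodule.subset_span ⟨⟨j, h1⟩, rfl⟩)
    have : Module.Free B A := .of_basis b
    rw [← hN (IsLocalRing.closedPoint B), Module.rankAtStalk_eq_finrank_of_free]
    rw [Module.finrank_eq_card_basis b, Nat.card_eq_fintype_card, Pi.natCast_apply]
    rfl

end Constancy
end IsogenyComplex

namespace IsogenyComplex

/-! ### Constant subgroup schemes attached to groups of rational points -/

section ConstantSubgroup
open scoped TensorProduct

variable {k : Type u} [Field k] {E : EllipticCurve k}

lemma SubgroupFunctor.IsFiniteLocallyFree.exists_represents {B : Type u} [CommRing B] [Algebra k B]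
    {G : SubgroupFunctor E B} {N : ℕ} (h : G.IsFiniteLocallyFree N) :
    ∃ (A : Type u) (_ : CommRing A) (_ : Algebra k A) (_ : Algebra B A) (_ : IsScalarTower k B A) (x : E.Points A),
      Module.Finite B A ∧ Module.Projective B A ∧
      (∀ 𝔭 : PrimeSpectrum B, Module.rankAtStalk (R := B) A 𝔭 = N) ∧ G.Represents A x := by
  obtain ⟨A, _, _, _, _, hfin, hproj, hN, x, hx, hrep⟩ := h
  refine ⟨A, _, _, _, _, x, hfin, hproj, hN, hx, ?_, ?_⟩
  · intro D _ _ _ _ y hy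
    obtain ⟨ψ, ⟨hψ, hψ'⟩, -⟩ := hrep D _ y hy
    exact ⟨{ ψ with commutes' := fun b => congrArg (fun l => l b) hψ }, hψ'⟩
  · intro D _ _ _ _ ψ ψ' h
    have hc : ∀ ψ : A →ₐ[B] D, (ψ.restrictScalars k).comp (IsScalarTower.toAlgHom k B A) = IsScalarTower.toAlgHom k B D :=
      fun ψ => AlgHom.ext fun b => ψ.commutes b
    have hy : E.mapPoints (ψ.restrictScalars k) x ∈ G.points (IsScalarTower.toAlgHom k B D) := by
      have := G.mapPoints_mem _ (ψ.restrictScalars k) x hx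
      rwa [hc] at this
    have := (hrep D _ _ hy).unique ⟨hc ψ, rfl⟩ ⟨hc ψ', h.symm⟩
    exact AlgHom.ext fun a => congrArg (fun l => l a) this

/-- The constant subgroup scheme of the `m`-torsion of `E` given by a group `c` of rational points: it consists of
the `m`-torsion points whose values at all residue fields lie in `c`. -/
def constSubgroup (m : ℕ) (c : AddSubgroup (E.Points k)) : SubgroupFunctor E k where
  points {C} _ _ _ :=
    { carrier := {y | m • y = 0 ∧ ∀ (L : Type u) [Field L] [Algebra k L] (ψ : C →ₐ[k] L),
        ∃ g ∈ c, E.mapPoints ψ y = E.mapPoints (Algebra.ofId k L) g}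
      add_mem' := fun {a b} ha hb => ⟨by rw [smul_add, ha.1, hb.1, add_zero], fun L _ _ ψ => by
        obtain ⟨g, hg, h⟩ := ha.2 L ψ
        obtain ⟨g', hg', h'⟩ := hb.2 L ψ
        exact ⟨g + g', add_mem hg hg', by rw [E.mapPoints_add, h, h', E.mapPoints_add]⟩⟩
      zero_mem' := ⟨smul_zero _, fun L _ _ ψ => ⟨0, zero_mem _, by simp⟩⟩
      neg_mem' := fun {a} ha => ⟨by rw [smul_neg, ha.1, neg_zero], fun L _ _ ψ => by
        obtain ⟨g, hg, h⟩ := ha.2 L ψ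
        refine ⟨-g, neg_mem hg, ?_⟩
        rw [← E.mapPointsHom_apply, map_neg, E.mapPointsHom_apply, h, ← E.mapPointsHom_apply, ← map_neg]
        rfl⟩ }
  mapPoints_mem φ ψ x hx := ⟨by rw [← E.mapPoints_nsmul, hx.1, E.mapPoints_zero], fun L _ _ ψ' => by
    rw [← E.mapPoints_comp]
    exact hx.2 L _⟩

variable {J : Type u} [Fintype J] [DecidableEq J] {m : ℕ} {t : E.Points (J → k)}

open Classical in
/-- The constant subgroup scheme given by `c` is described by the indicator function of `c`. -/
lemma constSubgroup_isDescribedBy (ht : IsUniversalTorsion m t) (c : AddSubgroup (E.Points k)) :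
    IsDescribedBy (constSubgroup m c) m t (fun j => if valueAt t j ∈ c then 1 else 0) := by
  refine ⟨fun _ _ h => h.1, ?_, fun j => by split_ifs <;> simp⟩
  intro C _ _ φ χ
  have hid := pi_algHom_single_mul_single χ
  constructor
  · intro h j
    split_ifs with hj
    · rw [map_one, _root_.one_mul]
    · rw [map_zero, zero_mul]
      symm
      -- The definition only tests residue fields. This is enough because an idempotent that
      -- vanishes in every residue field is nilpotent, hence zero.
      have hjj : IsIdempotentElem (χ (Pi.single j 1)) := (hid j j).trans (if_pos rfl)
      refine hjj.eq_zero_of_isNilpotent ?_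
      rw [← mem_nilradical, nilradical_eq_sInf, Ideal.mem_sInf]
      intro 𝔭 (h𝔭 : 𝔭.IsPrime)
      let ψ : C →ₐ[k] 𝔭.ResidueField := IsScalarTower.toAlgHom k C 𝔭.ResidueField
      have hψ : ψ (χ (Pi.single j 1)) = 0 := by
        by_contra h0
        have h1 : (ψ.comp χ) (Pi.single j 1) = 1 :=
          (eq_zero_or_one_of_idempotent (by simpa using pi_algHom_single_mul_single (ψ.comp χ) j j)).resolve_left h0
        obtain ⟨g, hg, hg'⟩ := h.2 _ ψ
        rw [← E.mapPoints_comp, pi_algHom_eq_eval _ h1, ← mapPoints_ofId_valueAt] at hg'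
        exact hj (E.mapPoints_injective (Algebra.ofId k _).injective hg' ▸ hg)
      exact Ideal.algebraMap_residueField_eq_zero.1 hψ
  · intro h
    refine ⟨ht.nsmul_mapPoints χ, fun L _ _ ψ => ?_⟩
    obtain ⟨i, hi⟩ := exists_pi_algHom_eq_eval (ψ.comp χ)
    refine ⟨valueAt t i, ?_, ?_⟩
    · by_contra hic
      have := h i
      rw [if_neg hic, map_zero, zero_mul] at this
      have h1 := congrArg (fun l => l (Pi.single i 1)) hi
      simp [← this] at h1
    · rw [← E.mapPoints_comp, hi, mapPoints_ofId_valueAt]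

lemma card_valueAt_mem (ht : IsUniversalTorsion m t) (c : AddSubgroup (E.Points k)) (hc : ∀ g ∈ c, m • g = 0) :
    Nat.card {j // valueAt t j ∈ c} = Nat.card c := by
  refine Nat.card_congr (Equiv.ofBijective (fun j => ⟨valueAt t j.1, j.2⟩) ⟨?_, ?_⟩)
  · intro i j h
    exact Subtype.ext (ht.valueAt_injective (congrArg Subtype.val h))
  · rintro ⟨g, hg⟩
    obtain ⟨j, rfl⟩ := ht.exists_valueAt g (hc g hg)
    exact ⟨⟨j, hg⟩, rfl⟩

/-- The representing algebra is the algebra of functions on those `j` whose point lies in `c`, a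
quotient of `J → k`. There are `N` such `j`, since `c` is killed by `m` by Lagrange. -/
lemma constSubgroup_isFiniteLocallyFree (ht : IsUniversalTorsion m t) (c : AddSubgroup (E.Points k))
    {N : ℕ} (hN : Nat.card c = N) (hm : N ∣ m) (hm0 : m ≠ 0) :
    (constSubgroup m c).IsFiniteLocallyFree N := by
  classical
  have hc : ∀ g ∈ c, m • g = 0 := fun g hg => by
    obtain ⟨d, rfl⟩ := hm
    have : N • (⟨g, hg⟩ : c) = 0 := by rw [← hN]; exact card_nsmul_eq_zero'
    rw [mul_comm, mul_smul, show N • g = 0 from congrArg Subtype.val this, smul_zero]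
  let r : (J → k) →ₐ[k] ({j // valueAt t j ∈ c} → k) :=
    AlgHom.pi fun j => Pi.evalAlgHom k (fun _ => k) j.1
  have hr : Function.Surjective r := fun f =>
    ⟨fun j => if h : valueAt t j ∈ c then f ⟨j, h⟩ else 0, by ext j; simp [r, j.2]⟩
  have hdesc := constSubgroup_isDescribedBy ht c
  refine ⟨({j // valueAt t j ∈ c} → k), inferInstance, inferInstance, inferInstance, inferInstance, inferInstance,
    inferInstance, ?_, E.mapPoints r t, ?_, ?_⟩
  · intro 𝔭
    rw [Module.rankAtStalk_eq_finrank_of_free, Pi.natCast_apply, Module.finrank_pi, ← Nat.card_eq_fintype_card,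
      card_valueAt_mem ht c hc, hN]
    rfl
  · refine (hdesc.mem_iff _ r).2 fun j => ?_
    split_ifs with hj
    · rw [map_one, _root_.one_mul]
    · rw [map_zero, zero_mul]
      ext i
      have : i.1 ≠ j := fun h => hj (h ▸ i.2)
      simp [r, this]
  · intro C _ _ φ y hy
    obtain ⟨χ, rfl⟩ := ht.exists_hom y (hdesc.nsmul_eq_zero φ y hy)
    have hχ := (hdesc.mem_iff φ χ).1 hy
    have hker : RingHom.ker r.toRingHom ≤ RingHom.ker χ.toRingHom := by
      intro f hf
      change χ f = 0
      have hf' : r f = 0 := hf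
      rw [pi_algHom_apply]
      refine Finset.sum_eq_zero fun j _ => ?_
      by_cases hj : valueAt t j ∈ c
      · have : f j = 0 := congrFun hf' ⟨j, hj⟩
        rw [this, zero_smul]
      · have := hχ j
        rw [if_neg hj, map_zero, zero_mul] at this
        rw [← this, smul_zero]
    refine ⟨AlgHom.liftOfSurjective r hr χ hker, ⟨Subsingleton.elim _ _, ?_⟩, ?_⟩
    · rw [← E.mapPoints_comp, AlgHom.liftOfSurjective_comp]
    · rintro ψ ⟨-, hψ⟩
      rw [← E.mapPoints_comp] at hψ
      have := ht.hom_ext _ _ hψ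
      refine AlgHom.ext fun a => ?_
      obtain ⟨f, rfl⟩ := hr a
      rw [AlgHom.liftOfSurjective_apply]
      exact congrArg (fun l => l f) this

end ConstantSubgroup
end IsogenyComplex

namespace IsogenyComplex

/-! ### The function ring as functions on chains of rational subgroups -/

section FunctionRing
open scoped TensorProduct

variable {k : Type u} [Field k] {E : EllipticCurve k}
variable {B : Type u} [CommRing B] [Algebra k B] {B' : Type u} [CommRing B'] [Algebra k B']

lemma SubgroupFunctor.Represents.isFiniteLocallyFree {G : SubgroupFunctor E B} {A : Type u} [CommRing A] [Algebra k A]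
    [Algebra B A] [IsScalarTower k B A] {x : E.Points A} (h : G.Represents A x)
    [Module.Finite B A] [Module.Projective B A] {N : ℕ}
    (hN : ∀ 𝔭 : PrimeSpectrum B, Module.rankAtStalk (R := B) A 𝔭 = N) : G.IsFiniteLocallyFree N := by
  refine ⟨A, _, _, _, inferInstance, inferInstance, inferInstance, hN, x, h.mem, ?_⟩
  intro C _ _ φ y hy
  let _ : Algebra B C := φ.toRingHom.toAlgebra
  have : IsScalarTower k B C := .of_algebraMap_eq fun c => (φ.commutes c).symm
  have hφ : IsScalarTower.toAlgHom k B C = φ := AlgHom.ext fun _ => rfl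
  rw [← hφ] at hy ⊢
  obtain ⟨ψ, hψ⟩ := h.exists_hom C y hy
  refine ⟨ψ.restrictScalars k, ⟨AlgHom.ext fun b => ψ.commutes b, hψ⟩, ?_⟩
  rintro ψ' ⟨h1, h2⟩
  have := h.hom_ext C { ψ' with commutes' := fun b => congrArg (fun l => l b) h1 } ψ (h2.trans hψ.symm)
  exact AlgHom.ext fun a => congrArg (fun l => l a) this

lemma SubgroupFunctor.IsFiniteLocallyFree.baseChange {G : SubgroupFunctor E B} {N : ℕ}
    (h : G.IsFiniteLocallyFree N) (φ : B →ₐ[k] B') : (G.baseChange φ).IsFiniteLocallyFree N := by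
  obtain ⟨A, _, _, _, _, x, _, _, hN, hrep⟩ := h.exists_represents
  let _ : Algebra B B' := φ.toRingHom.toAlgebra
  have : IsScalarTower k B B' := .of_algebraMap_eq fun c => (φ.commutes c).symm
  have hφ : IsScalarTower.toAlgHom k B B' = φ := AlgHom.ext fun _ => rfl
  have := hrep.baseChange B'
  rw [hφ] at this
  refine this.isFiniteLocallyFree fun 𝔭 => ?_
  rw [Module.rankAtStalk_baseChange, hN]

/-- The base change of a chain of subgroup schemes. -/
def SubgroupChain.baseChange {q : ℕ} {N : Fin q → ℕ} (G : SubgroupChain E B N) (φ : B →ₐ[k] B') :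
    SubgroupChain E B' N where
  group i := (G.group i).baseChange φ
  isFiniteLocallyFree i := (G.isFiniteLocallyFree i).baseChange φ
  mono i j h _ _ _ _ := G.mono i j h _ _

variable {J : Type u} [Fintype J] [DecidableEq J] {m : ℕ} {t : E.Points (J → k)}

lemma SubgroupFunctor.IsFiniteLocallyFree.exists_isDescribedBy (ht : IsUniversalTorsion m t) {G : SubgroupFunctor E B}
    {N : ℕ} (h : G.IsFiniteLocallyFree N) (hm : N ∣ m) :
    ∃ e : J → B, IsDescribedBy G m t e ∧ (IsLocalRing B → N = Nat.card {j // e j = 1}) := by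
  obtain ⟨A, _, _, _, _, x, _, _, hN, hrep⟩ := h.exists_represents
  exact hrep.exists_isDescribedBy ht hN hm

lemma IsDescribedBy.valueAt_mem_iff {G : SubgroupFunctor E B} {e : J → B} (h : IsDescribedBy G m t e)
    {C : Type u} [CommRing C] [Algebra k C] (φ : B →ₐ[k] C) (j : J) :
    E.mapPoints (Algebra.ofId k C) (valueAt t j) ∈ G.points φ ↔ φ (e j) = 1 := by
  rw [mapPoints_ofId_valueAt, h.mem_iff]
  constructor
  · intro h
    simpa using h j
  · intro h i
    by_cases hij : j = i
    · subst hij; simp [h]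
    · simp [hij]

lemma IsDescribedBy.isBaseChange (ht : IsUniversalTorsion m t) {G : SubgroupFunctor E B} {e : J → B} (h : IsDescribedBy G m t e)
    {G' : SubgroupFunctor E B'} {e' : J → B'} (h' : IsDescribedBy G' m t e') (φ : B →ₐ[k] B')
    (he : ∀ j, e' j = φ (e j)) : G.IsBaseChange φ G' := by
  intro C _ _ ψ
  ext y
  constructor
  · intro hy
    obtain ⟨χ, rfl⟩ := ht.exists_hom y (h'.nsmul_eq_zero _ _ hy)
    rw [h'.mem_iff] at hy
    rw [h.mem_iff]
    simpa [he] using hy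
  · intro hy
    obtain ⟨χ, rfl⟩ := ht.exists_hom y (h.nsmul_eq_zero _ _ hy)
    rw [h.mem_iff] at hy
    rw [h'.mem_iff]
    simpa [he] using hy

/-- In the quotient by `1 - e` the element `e` becomes `1`, hence so does `e'`, which gives `e * (1
- e') = 0`. By symmetry both idempotents equal their product. -/
lemma eq_of_idempotent_of_forall_eq_one_iff {e e' : B} (he : e * e = e) (he' : e' * e' = e')
    (h : ∀ (C : Type u) [CommRing C] [Algebra k C] (φ : B →ₐ[k] C), φ e = 1 ↔ φ e' = 1) : e = e' := by
  have key : ∀ e e' : B, e * e = e → (∀ (C : Type u) [CommRing C] [Algebra k C] (φ : B →ₐ[k] C), φ e = 1 → φ e' = 1) →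
      e * (1 - e') = 0 := fun e e' he h => by
    have h1 := h (B ⧸ Ideal.span ({1 - e} : Set B)) (Ideal.Quotient.mkₐ k _) (by
      rw [← sub_eq_zero, ← map_one (Ideal.Quotient.mkₐ k _), ← map_sub]
      refine Ideal.Quotient.eq_zero_iff_mem.2 ?_
      rw [← neg_sub (1 : B) e]
      exact neg_mem (Ideal.mem_span_singleton_self _))
    rw [← sub_eq_zero, ← map_one (Ideal.Quotient.mkₐ k _), ← map_sub] at h1
    obtain ⟨b, hb⟩ := Ideal.mem_span_singleton.1 (Ideal.Quotient.eq_zero_iff_mem.1 h1)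
    have : e * (e' - 1) = 0 := by rw [hb]; linear_combination (- b) * he
    linear_combination - this
  have h1 := key e e' he fun C _ _ φ => (h C φ).1
  have h2 := key e' e he' fun C _ _ φ => (h C φ).2
  linear_combination h1 - h2

/-- The constant point of index `j` lies in `G` exactly where `e j` equals `1`. The describing
idempotents are therefore intrinsic to the subgroup functor, and arbitrary choices of them are
automatically natural. -/
lemma IsDescribedBy.eq_of_isBaseChange {G : SubgroupFunctor E B} {e : J → B} (h : IsDescribedBy G m t e)
    {G' : SubgroupFunctor E B'} {e' : J → B'} (h' : IsDescribedBy G' m t e') (φ : B →ₐ[k] B')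
    (hG : G.IsBaseChange φ G') (j : J) : e' j = φ (e j) := by
  refine eq_of_idempotent_of_forall_eq_one_iff (k := k) (h'.idempotent j) (by rw [← map_mul, h.idempotent]) fun C _ _ ψ => ?_
  rw [← h'.valueAt_mem_iff, hG, h.valueAt_mem_iff]
  rfl

/-- A finite locally free subgroup scheme over a local ring is constant. -/
lemma exists_constSubgroup_isBaseChange [IsLocalRing B] (ht : IsUniversalTorsion m t) {G : SubgroupFunctor E B}
    {N : ℕ} (h : G.IsFiniteLocallyFree N) (hm : N ∣ m) :
    Nat.card ((G.points (AlgHom.id k B)).comap (E.mapPointsHom (Algebra.ofId k B))) = N ∧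
    (constSubgroup m ((G.points (AlgHom.id k B)).comap (E.mapPointsHom (Algebra.ofId k B)))).IsBaseChange
      (Algebra.ofId k B) G := by
  classical
  obtain ⟨e, he, hcard⟩ := h.exists_isDescribedBy ht hm
  have hmem : ∀ j, valueAt t j ∈ (G.points (AlgHom.id k B)).comap (E.mapPointsHom (Algebra.ofId k B)) ↔ e j = 1 :=
    fun j => he.valueAt_mem_iff (AlgHom.id k B) j
  constructor
  · rw [← card_valueAt_mem ht, hcard inferInstance]
    · exact Nat.card_congr (Equiv.subtypeEquivRight hmem)
    · intro g hg
      refine E.mapPoints_injective (Algebra.ofId k B).injective ?_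
      rw [E.mapPoints_nsmul, E.mapPoints_zero]
      exact he.nsmul_eq_zero _ _ hg
  · refine (constSubgroup_isDescribedBy ht _).isBaseChange ht he _ fun j => ?_
    rcases eq_zero_or_one_of_idempotent (he.idempotent j) with h0 | h1
    · rw [if_neg, h0, map_zero]
      rw [hmem, h0]
      exact zero_ne_one
    · rw [if_pos ((hmem j).2 h1), h1, map_one]


variable (E) in
/-- Chains of groups of rational points whose orders are given by `N`. -/
def PointChain {q : ℕ} (N : Fin q → ℕ) : Type u :=
  {c : Fin q → AddSubgroup (E.Points k) // (∀ i, Nat.card (c i) = Fin.partialProd N i.succ) ∧ Monotone c}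

variable {q : ℕ} {N : Fin q → ℕ}

/-- The chain of constant subgroup schemes given by a chain of groups of rational points. -/
def constChain (ht : IsUniversalTorsion m t) (hm0 : m ≠ 0) (hN : ∀ i : Fin q, Fin.partialProd N i.succ ∣ m)
    (c : PointChain E N) : SubgroupChain E k N where
  group i := constSubgroup m (c.1 i)
  isFiniteLocallyFree i := constSubgroup_isFiniteLocallyFree ht _ (c.2.1 i) (hN i) hm0
  mono _ _ h _ _ _ _ := fun _ hy => ⟨hy.1, fun L _ _ ψ =>
    (hy.2 L ψ).imp fun _ hg => ⟨c.2.2 h hg.1, hg.2⟩⟩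

/-- Evaluation of functions on the moduli problem at the chains of constant subgroup schemes. -/
def evalConst (ht : IsUniversalTorsion m t) (hm0 : m ≠ 0) (hN : ∀ i : Fin q, Fin.partialProd N i.succ ∣ m) :
    functionRing E N →ₗ[k] (PointChain E N → k) where
  toFun f c := f.1 (CommAlgCat.of k k) (constChain ht hm0 hN c)
  map_add' _ _ := rfl
  map_smul' _ _ := rfl

/-- A value of `f` can be tested in the local rings of `B`. Over a local ring every chain is the
base change of a constant chain, so naturality reduces the value to one over `k`. -/
lemma evalConst_injective (ht : IsUniversalTorsion m t) (hm0 : m ≠ 0) (hN : ∀ i : Fin q, Fin.partialProd N i.succ ∣ m) :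
    Function.Injective (evalConst ht hm0 hN : functionRing E N →ₗ[k] _) := by
  rw [injective_iff_map_eq_zero]
  intro f hf
  refine Subtype.ext (funext fun B => funext fun G => ?_)
  change f.1 B G = 0
  refine Module.eq_zero_of_localization_maximal (R := B) (fun P _ => Localization P.primeCompl)
    (fun P _ => Algebra.linearMap B (Localization P.primeCompl)) _ fun P hP => ?_
  let D := Localization P.primeCompl
  let φ : B →ₐ[k] D := IsScalarTower.toAlgHom k B D
  let G' := G.baseChange φ
  have h1 : f.1 (CommAlgCat.of k D) G' = φ (f.1 B G) := f.2 B (CommAlgCat.of k D) φ G G' fun _ _ _ _ _ => rfl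
  have hloc : IsLocalRing D := inferInstanceAs (IsLocalRing (Localization.AtPrime P))
  have hconst := fun i => exists_constSubgroup_isBaseChange ht (G'.isFiniteLocallyFree i) (hN i)
  let c : PointChain E N := ⟨_, fun i => (hconst i).1, fun i j hij _ hg => G'.mono i j hij _ _ hg⟩
  have h2 := f.2 (CommAlgCat.of k k) (CommAlgCat.of k D) (Algebra.ofId k D) (constChain ht hm0 hN c) G'
    fun i => (hconst i).2
  change φ (f.1 B G) = 0
  rw [← h1, h2]
  change Algebra.ofId k D (evalConst ht hm0 hN f c) = 0
  rw [hf, Pi.zero_apply, map_zero]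

lemma PointChain.ext_valueAt (ht : IsUniversalTorsion m t) (hN : ∀ i : Fin q, Fin.partialProd N i.succ ∣ m)
    {c c' : PointChain E N} (h : ∀ i j, valueAt t j ∈ c.1 i ↔ valueAt t j ∈ c'.1 i) : c = c' := by
  refine Subtype.ext (funext fun i => ?_)
  have hc : ∀ (c : PointChain E N), ∀ g ∈ c.1 i, ∃ j, valueAt t j = g := fun c g hg => by
    refine ht.exists_valueAt g ?_
    obtain ⟨d, hd⟩ := hN i
    have : Nat.card (c.1 i) • (⟨g, hg⟩ : c.1 i) = 0 := card_nsmul_eq_zero'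
    rw [hd, mul_comm, mul_smul, ← c.2.1 i, show Nat.card (c.1 i) • g = 0 from congrArg Subtype.val this, smul_zero]
  ext g
  constructor
  · intro hg
    obtain ⟨j, rfl⟩ := hc c g hg
    exact (h i j).1 hg
  · intro hg
    obtain ⟨j, rfl⟩ := hc c' g hg
    exact (h i j).2 hg

lemma PointChain.finite (ht : IsUniversalTorsion m t) (hN : ∀ i : Fin q, Fin.partialProd N i.succ ∣ m) :
    Finite (PointChain E N) :=
  Finite.of_injective (fun (c : PointChain E N) (i : Fin q) => {j | valueAt t j ∈ c.1 i}) fun _ _ h =>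
    PointChain.ext_valueAt ht hN fun i j => Set.ext_iff.1 (congrFun h i) j

open Classical in
/-- The idempotent describing where the chain `G` is the constant chain `c`. -/
def chainIdempotent (t : E.Points (J → k)) (c : PointChain E N) (e : Fin q → J → B) : B :=
  ∏ i, ∏ j, if valueAt t j ∈ c.1 i then e i j else 1 - e i j

/-- The function with prescribed values `v` is the combination of the chain idempotents with
coefficients `v`. It is natural because the describing idempotents are, and at a constant chain `c₀`
every chain idempotent vanishes except that of `c₀`, which is `1`. -/
lemma evalConst_surjective (ht : IsUniversalTorsion m t) (hm0 : m ≠ 0) (hN : ∀ i : Fin q, Fin.partialProd N i.succ ∣ m) :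
    Function.Surjective (evalConst ht hm0 hN : functionRing E N →ₗ[k] _) := by
  classical
  have := PointChain.finite ht hN
  have := Fintype.ofFinite (PointChain E N)
  intro v
  have hex := fun (B : CommAlgCat.{u} k) (G : SubgroupChain E B N) (i : Fin q) =>
    (G.isFiniteLocallyFree i).exists_isDescribedBy ht (hN i)
  choose e he _ using hex
  refine ⟨⟨fun B G => ∑ c, v c • chainIdempotent t c (e B G), ?_⟩, ?_⟩
  · intro B B' φ G G' h
    simp only [map_sum, map_smul, chainIdempotent, map_prod]
    refine Finset.sum_congr rfl fun c _ => ?_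
    congr 1
    refine Finset.prod_congr rfl fun i _ => Finset.prod_congr rfl fun j _ => ?_
    rw [(he B G i).eq_of_isBaseChange (he B' G' i) φ (h i)]
    split_ifs <;> simp
  · funext c₀
    change ∑ c, v c • chainIdempotent t c (e (CommAlgCat.of k k) (constChain ht hm0 hN c₀)) = v c₀
    have he0 : ∀ i j, e (CommAlgCat.of k k) (constChain ht hm0 hN c₀) i j = if valueAt t j ∈ c₀.1 i then 1 else 0 := fun i j =>
      (constSubgroup_isDescribedBy ht (c₀.1 i)).eq_of_isBaseChange (he (CommAlgCat.of k k) (constChain ht hm0 hN c₀) i)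
        (AlgHom.id k k) (fun _ _ _ _ => rfl) j
    rw [Finset.sum_eq_single c₀]
    · have : chainIdempotent t c₀ (e (CommAlgCat.of k k) (constChain ht hm0 hN c₀)) = 1 :=
        Finset.prod_eq_one fun i _ => Finset.prod_eq_one fun j _ => by
          rw [he0]; split_ifs <;> simp
      rw [this, smul_eq_mul, _root_.mul_one]
    · intro c _ hc
      have : ∃ i j, ¬ (valueAt t j ∈ c.1 i ↔ valueAt t j ∈ c₀.1 i) := by
        by_contra! h
        exact hc (PointChain.ext_valueAt ht hN h)
      obtain ⟨i, j, hij⟩ := this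
      have : chainIdempotent t c (e (CommAlgCat.of k k) (constChain ht hm0 hN c₀)) = 0 := by
        refine Finset.prod_eq_zero (Finset.mem_univ i) (Finset.prod_eq_zero (Finset.mem_univ j) ?_)
        rw [he0]
        split_ifs <;> simp_all
      rw [this, smul_zero]
    · simp

/-- The function ring of the moduli problem is the ring of functions on the chains of rational points. -/
def functionRingEquiv (ht : IsUniversalTorsion m t) (hm0 : m ≠ 0) (hN : ∀ i : Fin q, Fin.partialProd N i.succ ∣ m) :
    functionRing E N ≃ₗ[k] (PointChain E N → k) :=
  LinearEquiv.ofBijective (evalConst ht hm0 hN) ⟨evalConst_injective ht hm0 hN, evalConst_surjective ht hm0 hN⟩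

end FunctionRing
end IsogenyComplex

namespace IsogenyComplex

/-! ### Differentials in degrees that differ by one only propositionally -/

section Complexes

variable {P : Type u} [PartialOrder P]

open Classical in
/-- The face of a simplex opposite to a vertex, in a degree that is only propositionally one less. -/
def Simplices.faceOf {i j : ℤ} (h : j + 1 = i) (s : Simplices P i) (x : P) (hx : x ∈ s.1) : Simplices P j :=
  Simplices.face (h ▸ s) x (by subst h; exact hx)

open Classical in
lemma Simplices.faceOf_val {i j : ℤ} (h : j + 1 = i) (s : Simplices P i) (x : P) (hx : x ∈ s.1) :
    (s.faceOf h x hx).1 = s.1.erase x := by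
  subst h
  rfl

/-- The degrees used later, such as `((q + 1 : ℕ) : ℤ) - 2` and `(q : ℤ) - 2`, are not literally of
the form `j + 1` and `j`; this form isolates the transport. -/
lemma reducedChains_d_single {i j : ℤ} (h : j + 1 = i) (s : Simplices P i) :
    ((reducedChains P).d i j).hom (Finsupp.single s 1 : Simplices P i →₀ ℤ) =
      (∑ x : {x // x ∈ s.1}, (-1 : ℤ) ^ position s.1 x.1 •
        Finsupp.single (s.faceOf h x.1 x.2) 1 : Simplices P j →₀ ℤ) := by
  subst h
  have h : (reducedChains P).d (j + 1) j = ModuleCat.ofHom (boundary P j) :=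
    ChainComplex.of_d (fun q => ModuleCat.of ℤ (Simplices P q →₀ ℤ)) (fun q => ModuleCat.ofHom (boundary P q)) j
  rw [h]
  exact boundary_single P s

lemma Simplices.isEmpty_of_lt {q : ℤ} (h : q < -1) : IsEmpty (Simplices P q) :=
  ⟨fun s => by have := s.2.2; omega⟩

variable (R : Type w) [CommRing R] (G : Type u) [AddCommGroup G]
  (M : Type v) [AddCommGroup M] [Module R M]

lemma homComplex_d_apply (q : ℕ)
    (f : (reducedChains (ProperSubgroups G)).X ((q : ℤ) - 2) →ₗ[ℤ] M) :
    ((homComplex R G M).d q (q + 1)).hom f =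
      (f ∘ₗ ((reducedChains (ProperSubgroups G)).d (((q + 1 : ℕ) : ℤ) - 2) ((q : ℤ) - 2)).hom :
        (reducedChains (ProperSubgroups G)).X (((q + 1 : ℕ) : ℤ) - 2) →ₗ[ℤ] M) := by
  refine (congrArg (fun g => g.hom f) (CochainComplex.of_d
    (fun q : ℕ => ModuleCat.of R ((reducedChains (ProperSubgroups G)).X ((q : ℤ) - 2) →ₗ[ℤ] M)) _ q)).trans ?_
  rfl

lemma complexD_eq_homComplex [Nontrivial G] : complexD R G M = homComplex R G M :=
  if_neg (not_subsingleton G)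

lemma complexD_eq_single [Subsingleton G] : complexD R G M =
    (CochainComplex.single₀ (ModuleCat.{max u v} R)).obj (ModuleCat.of R (ULift.{u} M)) :=
  if_pos ‹_›

end Complexes
end IsogenyComplex

namespace IsogenyComplex

/-! ### Chains of subgroups and simplices of the order complex -/

section Flags

/-- A finite chain is sorted with respect to a linear extension of the order, which agrees with the
given order on the chain. -/
lemma exists_strictMono_range_eq {α : Type u} [PartialOrder α] {t : Finset α}
    (ht : IsChain (· ≤ ·) (t : Set α)) {q : ℕ} (hq : t.card = q) :
    ∃ c : Fin q → α, StrictMono c ∧ Set.range c = t := by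
  classical
  let T : Finset (LinearExtension α) := t
  have hf : ∃ f : Fin q → LinearExtension α, StrictMono f ∧ Set.range f = T :=
    ⟨T.orderEmbOfFin hq, (T.orderEmbOfFin hq).strictMono, T.range_orderEmbOfFin hq⟩
  obtain ⟨f, hf, hr⟩ := hf
  have hmem : ∀ i, f i ∈ (T : Set (LinearExtension α)) := fun i => hr ▸ ⟨i, rfl⟩
  refine ⟨f, fun i j hij => ?_, hr⟩
  have h := hf hij
  refine lt_of_le_of_ne (α := α) ((ht.total (hmem i) (hmem j)).resolve_right fun h' => ?_) h.ne
  exact not_le_of_gt h ((toLinearExtension (α := α)).monotone (a := f j) (b := f i) h')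

variable {X : Type u} [AddCommGroup X]

/-- The tuple `c` lists `G` and the subgroups of `G` belonging to the simplex `s`. -/
def IsFlagOf {q : ℕ} (c : Fin q → AddSubgroup X) (G : AddSubgroup X) (s : Finset (ProperSubgroups G)) : Prop :=
  Set.range c = insert G ((fun K : ProperSubgroups G => K.1.map G.subtype) '' (s : Set (ProperSubgroups G)))

lemma map_properSubgroups_injective (G : AddSubgroup X) :
    Function.Injective fun K : ProperSubgroups G => K.1.map G.subtype := fun _ _ h =>
  Subtype.ext (AddSubgroup.map_injective G.subtype_injective h)

lemma map_properSubgroups_lt {G : AddSubgroup X} (K : ProperSubgroups G) : K.1.map G.subtype < G := by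
  refine lt_of_le_of_ne (AddSubgroup.map_subtype_le _) fun h => K.2.2 ?_
  refine AddSubgroup.map_injective G.subtype_injective (h.trans ?_)
  rw [← AddMonoidHom.range_eq_map, AddSubgroup.range_subtype]

lemma map_properSubgroups_ne_bot {G : AddSubgroup X} (K : ProperSubgroups G) : K.1.map G.subtype ≠ ⊥ := fun h =>
  K.2.1 (AddSubgroup.map_injective G.subtype_injective (h.trans (AddSubgroup.map_bot _).symm))

lemma map_properSubgroups_le_iff {G : AddSubgroup X} {K K' : ProperSubgroups G} :
    K.1.map G.subtype ≤ K'.1.map G.subtype ↔ K ≤ K' :=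
  AddSubgroup.map_le_map_iff_of_injective G.subtype_injective

lemma IsFlagOf.le {q : ℕ} {c : Fin q → AddSubgroup X} {G : AddSubgroup X} {s : Finset (ProperSubgroups G)}
    (h : IsFlagOf c G s) (i : Fin q) : c i ≤ G := by
  have : c i ∈ Set.range c := ⟨i, rfl⟩
  rw [h] at this
  obtain h1 | ⟨K, -, h1⟩ := this
  · exact h1.le
  · exact h1 ▸ (map_properSubgroups_lt K).le

lemma IsFlagOf.exists_eq {q : ℕ} {c : Fin q → AddSubgroup X} {G : AddSubgroup X} {s : Finset (ProperSubgroups G)}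
    (h : IsFlagOf c G s) : ∃ i, c i = G := by
  have : G ∈ Set.range c := h ▸ Set.mem_insert _ _
  exact this

lemma IsFlagOf.last {q : ℕ} {c : Fin (q + 1) → AddSubgroup X} {G : AddSubgroup X} {s : Finset (ProperSubgroups G)}
    (h : IsFlagOf c G s) (hc : Monotone c) : c (Fin.last q) = G := by
  obtain ⟨i, hi⟩ := h.exists_eq
  exact le_antisymm (h.le _) (hi ▸ hc (Fin.le_last i))

lemma IsFlagOf.group_unique {q : ℕ} {c : Fin q → AddSubgroup X} {G G' : AddSubgroup X}
    {s : Finset (ProperSubgroups G)} {s' : Finset (ProperSubgroups G')}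
    (h : IsFlagOf c G s) (h' : IsFlagOf c G' s') : G = G' := by
  obtain ⟨i, hi⟩ := h.exists_eq
  obtain ⟨i', hi'⟩ := h'.exists_eq
  exact le_antisymm (hi ▸ h'.le i) (hi' ▸ h.le i')

lemma IsFlagOf.simplex_unique {q : ℕ} {c : Fin q → AddSubgroup X} {G : AddSubgroup X}
    {s s' : Finset (ProperSubgroups G)} (h : IsFlagOf c G s) (h' : IsFlagOf c G s') : s = s' := by
  have key : ∀ {s s' : Finset (ProperSubgroups G)}, IsFlagOf c G s → IsFlagOf c G s' → s ⊆ s' := by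
    intro s s' h h' K hK
    have : K.1.map G.subtype ∈ Set.range c := h ▸ Set.mem_insert_of_mem _ ⟨K, hK, rfl⟩
    rw [h'] at this
    obtain h1 | ⟨K', hK', h1⟩ := this
    · exact absurd h1 (map_properSubgroups_lt K).ne
    · exact map_properSubgroups_injective G h1 ▸ hK'
  exact (key h h').antisymm (key h' h)

/-- The last group plays the role of `G`; the `q` groups before it are proper nontrivial subgroups
of it. Thus `q + 1` groups give `q` vertices, a simplex of dimension `(q + 1) - 2`. -/
lemma exists_isFlagOf {q : ℕ} {c : Fin (q + 1) → AddSubgroup X} (hc : StrictMono c) (hbot : ∀ i, c i ≠ ⊥) :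
    ∃ s : Finset (ProperSubgroups (c (Fin.last q))),
      IsChain (· ≤ ·) (s : Set (ProperSubgroups (c (Fin.last q)))) ∧ s.card = q ∧ IsFlagOf c (c (Fin.last q)) s := by
  classical
  set G := c (Fin.last q) with hG
  have hmap : ∀ i : Fin q, ((c i.castSucc).addSubgroupOf G).map G.subtype = c i.castSucc := fun i => by
    rw [AddSubgroup.map_addSubgroupOf_eq_of_le (hc.monotone (Fin.le_last _))]
  let K : Fin q → ProperSubgroups G := fun i => ⟨(c i.castSucc).addSubgroupOf G, fun h => by
    have h1 := hmap i
    rw [h, AddSubgroup.map_bot] at h1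
    exact hbot _ h1.symm, fun h => by
    have h1 := hmap i
    rw [h, ← AddMonoidHom.range_eq_map, AddSubgroup.range_subtype] at h1
    exact (hc (Fin.castSucc_lt_last i)).ne h1.symm⟩
  have hK : ∀ i, (K i).1.map G.subtype = c i.castSucc := hmap
  have hKinj : Function.Injective K := fun i j h =>
    Fin.castSucc_injective _ (hc.injective (by rw [← hK, ← hK, h]))
  refine ⟨Finset.univ.image K, ?_, ?_, ?_⟩
  · rintro x hx y hy -
    simp only [Finset.coe_image, Finset.coe_univ, Set.image_univ, Set.mem_range] at hx hy
    obtain ⟨i, rfl⟩ := hx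
    obtain ⟨j, rfl⟩ := hy
    change K i ≤ K j ∨ K j ≤ K i
    rw [← map_properSubgroups_le_iff, ← map_properSubgroups_le_iff, hK, hK]
    exact (le_total i j).imp (fun h => hc.monotone (Fin.castSucc_le_castSucc_iff.2 h))
      fun h => hc.monotone (Fin.castSucc_le_castSucc_iff.2 h)
  · rw [Finset.card_image_of_injective _ hKinj, Finset.card_univ, Fintype.card_fin]
  · unfold IsFlagOf
    ext H
    simp only [Finset.coe_image, Finset.coe_univ, Set.image_univ, Set.mem_range, Set.mem_insert_iff, Set.mem_image,
      exists_exists_eq_and, hK]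
    rw [Fin.exists_fin_succ']
    rw [or_comm, eq_comm]

lemma exists_flag_of_simplex {G : AddSubgroup X} (hG : G ≠ ⊥) {s : Finset (ProperSubgroups G)}
    (hs : IsChain (· ≤ ·) (s : Set (ProperSubgroups G))) {q : ℕ} (hq : s.card + 1 = q) :
    ∃ c : Fin q → AddSubgroup X, StrictMono c ∧ (∀ i, c i ≠ ⊥) ∧ IsFlagOf c G s := by
  classical
  let t : Finset (AddSubgroup X) := insert G (s.image fun K => K.1.map G.subtype)
  have hcard : t.card = q := by
    rw [Finset.card_insert_of_notMem, Finset.card_image_of_injective _ (map_properSubgroups_injective G), hq]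
    intro h
    obtain ⟨K, -, hK⟩ := Finset.mem_image.1 h
    exact (map_properSubgroups_lt K).ne hK
  have ht : IsChain (· ≤ ·) (t : Set (AddSubgroup X)) := by
    simp only [t, Finset.coe_insert, Finset.coe_image]
    refine IsChain.insert ?_ ?_
    · rintro _ ⟨K, hK, rfl⟩ _ ⟨K', hK', rfl⟩ -
      simp only [map_properSubgroups_le_iff]
      exact hs.total hK hK'
    · rintro _ ⟨K, hK, rfl⟩ -
      exact Or.inr (map_properSubgroups_lt K).le
  obtain ⟨c, hc, hrange⟩ := exists_strictMono_range_eq ht hcard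
  have hflag : IsFlagOf c G s := by
    unfold IsFlagOf
    rw [hrange]
    simp [t]
  refine ⟨c, hc, fun i => ?_, hflag⟩
  have : c i ∈ Set.range c := ⟨i, rfl⟩
  rw [hflag] at this
  obtain h1 | ⟨K, -, h1⟩ := this
  · exact h1 ▸ hG
  · exact h1 ▸ map_properSubgroups_ne_bot K

lemma exists_factorization {q N : ℕ} {c : Fin q → AddSubgroup X} (hc : StrictMono c) (hbot : ∀ i, c i ≠ ⊥)
    {G : AddSubgroup X} (hle : ∀ i, c i ≤ G) (hex : ∃ i, c i = G) (hN : Nat.card G = N) (hN0 : N ≠ 0) :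
    ∃ n : Factorizations q N, ∀ i, Nat.card (c i) = Fin.partialProd n.1 i.succ := by
  have hfinG : Finite G := Nat.finite_of_card_ne_zero (hN ▸ hN0)
  have hfin : ∀ i, Finite (c i) := fun i =>
    Finite.of_injective _ (AddSubgroup.inclusion_injective (hle i))
  -- The trivial group is put in front, so that the factors are the quotients of consecutive orders,
  -- including the first one. Strict inclusions make them greater than `1`.
  let d : Fin (q + 1) → AddSubgroup X := Fin.cons ⊥ c
  have hdfin : ∀ i, Finite (d i) := fun i => by
    refine Fin.cases ?_ (fun i => ?_) i
    · exact inferInstanceAs (Finite (⊥ : AddSubgroup X))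
    · exact hfin i
  have hd : ∀ i : Fin q, d i.castSucc < d i.succ := by
    cases q with
    | zero => exact fun i => i.elim0
    | succ q =>
      intro i
      refine Fin.cases ?_ (fun i => ?_) i
      · exact bot_lt_iff_ne_bot.2 (hbot 0)
      · exact hc (Fin.castSucc_lt_succ (i := i))
  let a : Fin (q + 1) → ℕ := fun i => Nat.card (d i)
  have hapos : ∀ i, 0 < a i := fun i => Nat.card_pos
  have hdvd : ∀ i : Fin q, a i.castSucc ∣ a i.succ := fun i => AddSubgroup.card_dvd_of_le (hd i).le
  have hlt : ∀ i : Fin q, a i.castSucc < a i.succ := fun i => by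
    refine lt_of_le_of_ne (Nat.le_of_dvd (hapos _) (hdvd i)) fun h => (hd i).ne ?_
    exact AddSubgroup.eq_of_le_of_card_ge (hd i).le h.ge
  let n : Fin q → ℕ := fun i => a i.succ / a i.castSucc
  have hn : ∀ i, Fin.partialProd n i = a i := fun i => by
    induction i using Fin.induction with
    | zero => simp [a, d]
    | succ i ih =>
      rw [Fin.partialProd_succ, ih]
      exact Nat.mul_div_cancel' (hdvd i)
  refine ⟨⟨n, fun i => ?_, ?_⟩, fun i => (hn i.succ).symm⟩
  · by_contra! h
    have h1 : a i.succ = a i.castSucc * n i := (Nat.mul_div_cancel' (hdvd i)).symm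
    have h2 := hlt i
    have := Nat.mul_le_mul_left (a i.castSucc) h
    omega
  · have h1 := hn (Fin.last q)
    have h2 : Fin.partialProd n (Fin.last q) = ∏ i, n i := by
      simp [Fin.partialProd, List.prod_ofFn, List.take_of_length_le]
    rw [← h2, h1]
    cases q with
    | zero => exact hex.choose.elim0
    | succ q =>
      obtain ⟨i, hi⟩ := hex
      have : c (Fin.last q) = G := le_antisymm (hle _) (hi ▸ hc.monotone (Fin.le_last i))
      change Nat.card (c (Fin.last q)) = N
      rw [this, hN]

lemma partialProd_strictMono {q : ℕ} {n : Fin q → ℕ} (hn : ∀ i, 1 < n i) : StrictMono (Fin.partialProd n) := by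
  have pos : ∀ i, 0 < Fin.partialProd n i := fun i => by
    induction i using Fin.induction with
    | zero => simp
    | succ i ih =>
      rw [Fin.partialProd_succ]
      exact Nat.mul_pos ih (lt_trans one_pos (hn i))
  refine Fin.strictMono_iff_lt_succ.2 fun i => ?_
  rw [Fin.partialProd_succ]
  exact lt_mul_of_one_lt_right (pos _) (hn i)

lemma partialProd_last {q : ℕ} (n : Fin q → ℕ) : Fin.partialProd n (Fin.last q) = ∏ i, n i := by
  simp [Fin.partialProd, List.prod_ofFn, List.take_of_length_le]

lemma Factorizations.partialProd_dvd {q N : ℕ} (n : Factorizations q N) (i : Fin q) :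
    Fin.partialProd n.1 i.succ ∣ N := by
  have key : ∀ j : Fin (q + 1), Fin.partialProd n.1 j ∣ Fin.partialProd n.1 (Fin.last q) := fun j => by
    induction j using Fin.reverseInduction with
    | last => exact dvd_rfl
    | cast j ih =>
      refine dvd_trans ?_ ih
      rw [Fin.partialProd_succ]
      exact dvd_mul_right _ _
  exact (key _).trans (((partialProd_last n.1).trans n.2.2).dvd)

variable {q : ℕ} {c : Fin (q + 1) → AddSubgroup X} {G : AddSubgroup X} {s : Finset (ProperSubgroups G)}

lemma IsFlagOf.exists_vertex (h : IsFlagOf c G s) (hc : StrictMono c) (i : Fin q) :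
    ∃ K : {x // x ∈ s}, K.1.1.map G.subtype = c i.castSucc := by
  have : c i.castSucc ∈ Set.range c := ⟨_, rfl⟩
  rw [h] at this
  obtain h1 | ⟨K, hK, h1⟩ := this
  · exact absurd (h1.trans (h.last hc.monotone).symm) (hc (Fin.castSucc_lt_last i)).ne
  · exact ⟨⟨K, hK⟩, h1⟩

/-- The vertices of the simplex belonging to a flag. -/
def IsFlagOf.vertex (h : IsFlagOf c G s) (hc : StrictMono c) (i : Fin q) : {x // x ∈ s} :=
  (h.exists_vertex hc i).choose

lemma IsFlagOf.map_vertex (h : IsFlagOf c G s) (hc : StrictMono c) (i : Fin q) :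
    (h.vertex hc i).1.1.map G.subtype = c i.castSucc :=
  (h.exists_vertex hc i).choose_spec

lemma IsFlagOf.vertex_bijective (h : IsFlagOf c G s) (hc : StrictMono c) : Function.Bijective (h.vertex hc) := by
  constructor
  · intro i j hij
    refine Fin.castSucc_injective _ (hc.injective ?_)
    rw [← h.map_vertex hc, ← h.map_vertex hc, hij]
  · intro x
    have : x.1.1.map G.subtype ∈ Set.range c := h ▸ Set.mem_insert_of_mem _ ⟨x.1, x.2, rfl⟩
    obtain ⟨j, hj⟩ := this
    obtain ⟨i, rfl⟩ | rfl := j.eq_castSucc_or_eq_last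
    · refine ⟨i, Subtype.ext (map_properSubgroups_injective G ?_)⟩
      change (h.vertex hc i).1.1.map G.subtype = _
      rw [h.map_vertex hc, hj]
    · exact absurd (hj.symm.trans (h.last hc.monotone)) (map_properSubgroups_lt x.1).ne

lemma IsFlagOf.vertex_lt_iff (h : IsFlagOf c G s) (hc : StrictMono c) {i j : Fin q} :
    (h.vertex hc i).1 < (h.vertex hc j).1 ↔ i < j := by
  rw [lt_iff_le_not_ge, ← map_properSubgroups_le_iff, ← map_properSubgroups_le_iff, h.map_vertex, h.map_vertex,
    hc.le_iff_le, hc.le_iff_le, Fin.castSucc_le_castSucc_iff, Fin.castSucc_le_castSucc_iff, ← lt_iff_le_not_ge]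

/-- This matches the sign of a face in the simplicial boundary with the index of the forgotten
group. -/
lemma IsFlagOf.position_vertex (h : IsFlagOf c G s) (hc : StrictMono c) (i : Fin q) :
    position s (h.vertex hc i).1 = i := by
  classical
  unfold position
  rw [← Fin.card_Iio i]
  symm
  refine Finset.card_bij (fun j _ => (h.vertex hc j).1) ?_ ?_ ?_
  · intro j hj
    refine Finset.mem_filter.2 ⟨(h.vertex hc j).2, ?_⟩
    exact (h.vertex_lt_iff hc).2 (Finset.mem_Iio.1 hj)
  · intro j _ j' _ e
    exact (h.vertex_bijective hc).1 (Subtype.ext e)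
  · intro x hx
    obtain ⟨h1, h2⟩ := Finset.mem_filter.1 hx
    obtain ⟨j, hj⟩ := (h.vertex_bijective hc).2 ⟨x, h1⟩
    refine ⟨j, Finset.mem_Iio.2 ((h.vertex_lt_iff hc).1 ?_), congrArg Subtype.val hj⟩
    rw [hj]
    exact h2

/-- Forgetting a group other than the last keeps `G` and deletes one vertex of the simplex. This is
why the coboundary never forgets the last group. -/
lemma IsFlagOf.face [DecidableEq (ProperSubgroups G)] (h : IsFlagOf c G s) (hc : StrictMono c) (i : Fin q) :
    IsFlagOf (c ∘ i.castSucc.succAbove) G (s.erase (h.vertex hc i).1) := by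
  unfold IsFlagOf
  rw [Set.range_comp, Fin.range_succAbove, Set.image_compl_eq_range_sdiff_image hc.injective, h, Set.image_singleton,
    ← h.map_vertex hc i, Finset.coe_erase, Set.image_sdiff (map_properSubgroups_injective G), Set.image_singleton]
  refine Set.insert_sdiff_of_notMem _ fun h' => ?_
  exact (map_properSubgroups_lt _).ne' h'

end Flags
end IsogenyComplex

namespace IsogenyComplex

/-! ### Comparison of the isogeny complex with the complexes of subgroups -/

section Comparison

variable {k : Type u} [Field k] {E : EllipticCurve k} {N q : ℕ}

/-- A chain of rational subgroups is the flag of a simplex of a rational subgroup. -/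
def FlagRel (a : Σ n : Factorizations q N, PointChain E n.1)
    (b : Σ G : {G : AddSubgroup (E.Points k) // Nat.card G = N}, Simplices (ProperSubgroups G.1) ((q : ℤ) - 2)) : Prop :=
  IsFlagOf a.2.1 b.1.1 b.2.1

lemma PointChain.strictMono {n : Factorizations q N} (c : PointChain E n.1) : StrictMono c.1 := by
  refine c.2.2.strictMono_of_injective fun i j h => ?_
  have h1 : Fin.partialProd n.1 i.succ = Fin.partialProd n.1 j.succ := by rw [← c.2.1 i, ← c.2.1 j, h]
  exact Fin.succ_injective _ ((partialProd_strictMono n.2.1).injective h1)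

lemma PointChain.ne_bot {n : Factorizations q N} (c : PointChain E n.1) (i : Fin q) : c.1 i ≠ ⊥ := by
  intro h
  have h1 := c.2.1 i
  rw [h, AddSubgroup.card_bot] at h1
  have h2 := partialProd_strictMono n.2.1 (Fin.succ_pos i)
  rw [Fin.partialProd_zero, ← h1] at h2
  exact lt_irrefl _ h2

/-- The condition `1 < N` excludes the empty chain, which has no last group and so belongs to no
simplex. -/
lemma existsUnique_flagRel_right (hN : 1 < N) (a : Σ n : Factorizations q N, PointChain E n.1) :
    ∃! b, FlagRel a b := by
  obtain ⟨n, c⟩ := a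
  refine existsUnique_of_exists_of_unique ?_ ?_
  · cases q with
    | zero =>
      have := n.2.2
      simp only [Finset.univ_eq_empty, Finset.prod_empty] at this
      omega
    | succ q =>
      obtain ⟨s, h1, h2, h3⟩ := exists_isFlagOf c.strictMono c.ne_bot
      exact ⟨⟨⟨c.1 (Fin.last q), by rw [c.2.1, Fin.succ_last, partialProd_last, n.2.2]⟩, ⟨s, h1, by push_cast; omega⟩⟩, h3⟩
  · rintro ⟨⟨G, hG⟩, s⟩ ⟨⟨G', hG'⟩, s'⟩ h h'
    obtain rfl : G = G' := IsFlagOf.group_unique h h'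
    obtain rfl : s = s' := Subtype.ext (IsFlagOf.simplex_unique h h')
    rfl

lemma existsUnique_flagRel_left (hN : 1 < N)
    (b : Σ G : {G : AddSubgroup (E.Points k) // Nat.card G = N}, Simplices (ProperSubgroups G.1) ((q : ℤ) - 2)) :
    ∃! a, FlagRel a b := by
  obtain ⟨⟨G, hG⟩, s⟩ := b
  refine existsUnique_of_exists_of_unique ?_ ?_
  · have hbot : G ≠ ⊥ := by
      rintro rfl
      rw [AddSubgroup.card_bot] at hG
      omega
    obtain ⟨c, hc, hcb, h⟩ := exists_flag_of_simplex hbot s.2.1 (q := q) (by have := s.2.2; omega)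
    obtain ⟨n, hn⟩ := exists_factorization hc hcb h.le h.exists_eq hG (by omega)
    exact ⟨⟨n, c, hn, hc.monotone⟩, h⟩
  · rintro ⟨n, c⟩ ⟨n', c'⟩ h h'
    have hcc : c.1 = c'.1 := (StrictMono.range_inj c.strictMono c'.strictMono).1 (Eq.trans h (Eq.symm h'))
    obtain rfl : n = n' := by
      refine Subtype.ext (eq_of_partialProd_eq n.2.1 (funext fun i => ?_))
      refine Fin.cases ?_ (fun i => ?_) i
      · simp
      · rw [← c.2.1, ← c'.2.1, hcc]
    obtain rfl : c = c' := Subtype.ext hcc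
    rfl

/-- Chains of rational subgroups correspond to simplices of rational subgroups. -/
def flagEquiv (hN : 1 < N) : (Σ n : Factorizations q N, PointChain E n.1) ≃
    (Σ G : {G : AddSubgroup (E.Points k) // Nat.card G = N}, Simplices (ProperSubgroups G.1) ((q : ℤ) - 2)) where
  toFun a := (existsUnique_flagRel_right hN a).choose
  invFun b := (existsUnique_flagRel_left hN b).choose
  left_inv a := (existsUnique_flagRel_left hN _).unique (existsUnique_flagRel_left hN _).choose_spec.1
    (existsUnique_flagRel_right hN a).choose_spec.1
  right_inv b := (existsUnique_flagRel_right hN _).unique (existsUnique_flagRel_right hN _).choose_spec.1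
    (existsUnique_flagRel_left hN b).choose_spec.1

lemma flagEquiv_symm_eq (hN : 1 < N) {a : Σ n : Factorizations q N, PointChain E n.1}
    {b : Σ G : {G : AddSubgroup (E.Points k) // Nat.card G = N}, Simplices (ProperSubgroups G.1) ((q : ℤ) - 2)}
    (h : FlagRel a b) : (flagEquiv hN).symm b = a :=
  (existsUnique_flagRel_left hN b).unique (existsUnique_flagRel_left hN _).choose_spec.1 h

variable {J : Type u} [Fintype J] [DecidableEq J] {t : E.Points (J → k)}

/-- Cochains are functions on the chains of rational subgroups. -/
def cochainEquiv (ht : IsUniversalTorsion N t) (hN0 : N ≠ 0) (q : ℕ) :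
    IsogenyCochains E N q ≃ₗ[k] ((Σ n : Factorizations q N, PointChain E n.1) → k) :=
  (LinearEquiv.piCongrRight fun n : Factorizations q N => functionRingEquiv ht hN0 n.partialProd_dvd).trans
    (LinearEquiv.piCurry k fun (n : Factorizations q N) (_ : PointChain E n.1) => k).symm

lemma cochainEquiv_apply (ht : IsUniversalTorsion N t) (hN0 : N ≠ 0) (f : IsogenyCochains E N q)
    (a : Σ n : Factorizations q N, PointChain E n.1) :
    cochainEquiv ht hN0 q f a = (f a.1).1 (CommAlgCat.of k k) (constChain ht hN0 a.1.partialProd_dvd a.2) :=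
  rfl

/-- The comparison between cochains and families of functionals on simplices, with the sign that makes it
compatible with the differentials. -/
def comparisonEquiv (ht : IsUniversalTorsion N t) (hN : 1 < N) (q : ℕ) : IsogenyCochains E N q ≃ₗ[k]
    (∀ G : {G : AddSubgroup (E.Points k) // Nat.card G = N},
      (Simplices (ProperSubgroups G.1) ((q : ℤ) - 2) →₀ ℤ) →ₗ[ℤ] k) :=
  ((cochainEquiv ht (by omega) q).trans (LinearEquiv.smulOfUnit ((-1 : kˣ) ^ q))).trans <|
    (LinearEquiv.funCongrLeft k k (flagEquiv hN).symm).trans <|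
    (LinearEquiv.piCurry k fun (G : {G : AddSubgroup (E.Points k) // Nat.card G = N})
      (_ : Simplices (ProperSubgroups G.1) ((q : ℤ) - 2)) => k).trans <|
    LinearEquiv.piCongrRight fun _ => Finsupp.llift k ℤ k _

lemma comparisonEquiv_apply_single (ht : IsUniversalTorsion N t) (hN : 1 < N) (f : IsogenyCochains E N q)
    {G : {G : AddSubgroup (E.Points k) // Nat.card G = N}} {s : Simplices (ProperSubgroups G.1) ((q : ℤ) - 2)}
    {n : Factorizations q N} {c : PointChain E n.1} (h : IsFlagOf c.1 G.1 s.1) :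
    comparisonEquiv ht hN q f G (Finsupp.single s 1) =
      (-1) ^ q * (f n).1 (CommAlgCat.of k k) (constChain ht (by omega) n.partialProd_dvd c) := by
  have h1 : (flagEquiv hN).symm ⟨G, s⟩ = ⟨n, c⟩ := flagEquiv_symm_eq hN h
  have h2 : comparisonEquiv ht hN q f G (Finsupp.single s 1) =
      (-1 : k) ^ q * cochainEquiv ht (by omega) q f ((flagEquiv hN).symm ⟨G, s⟩) := by
    simp only [comparisonEquiv, LinearEquiv.trans_apply, LinearEquiv.piCongrRight_apply, LinearEquiv.funCongrLeft_apply,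
      Finsupp.llift_apply, Finsupp.lift_apply, Finsupp.sum_single_index, zero_smul, one_smul]
    change ((-1 : kˣ) ^ q) • cochainEquiv ht (by omega) q f _ = _
    rw [Units.smul_def]
    simp
  rw [h2, h1, cochainEquiv_apply]

/-- Forgetting the group of index `i` corresponds to the face opposite the vertex of position `i`.
The coboundary carries the sign `(-1) ^ (i + 1)` and the boundary `(-1) ^ i`; the discrepancy is
absorbed by the factor `(-1) ^ q` of the comparison in degree `q`. -/
lemma comparisonEquiv_coboundary (ht : IsUniversalTorsion N t) (hN : 1 < N) (f : IsogenyCochains E N q)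
    (G : {G : AddSubgroup (E.Points k) // Nat.card G = N}) :
    comparisonEquiv ht hN (q + 1) (coboundary E N q f) G =
      (comparisonEquiv ht hN q f G) ∘ₗ ((reducedChains (ProperSubgroups G.1)).d (((q + 1 : ℕ) : ℤ) - 2) ((q : ℤ) - 2)).hom := by
  classical
  refine Finsupp.lhom_ext' fun s => LinearMap.ext_ring ?_
  have hq : ((q : ℤ) - 2) + 1 = ((q + 1 : ℕ) : ℤ) - 2 := by push_cast; ring
  obtain ⟨⟨n, c⟩, h, -⟩ := existsUnique_flagRel_left hN ⟨G, s⟩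
  have h : IsFlagOf c.1 G.1 s.1 := h
  change comparisonEquiv ht hN (q + 1) (coboundary E N q f) G (Finsupp.single s 1) =
    comparisonEquiv ht hN q f G (((reducedChains (ProperSubgroups G.1)).d (((q + 1 : ℕ) : ℤ) - 2) ((q : ℤ) - 2)).hom
      (Finsupp.single s 1 : Simplices (ProperSubgroups G.1) (((q + 1 : ℕ) : ℤ) - 2) →₀ ℤ))
  rw [comparisonEquiv_apply_single ht hN _ h, coboundary_apply, reducedChains_d_single hq, Finset.mul_sum]
  refine Eq.trans ?_ (map_sum (comparisonEquiv ht hN q f G) _ _).symm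
  refine Fintype.sum_bijective (h.vertex c.strictMono) (h.vertex_bijective c.strictMono) _ _ fun i => ?_
  rw [map_zsmul, h.position_vertex c.strictMono]
  let c' : PointChain E (n.merge i).1 := ⟨c.1 ∘ i.castSucc.succAbove, fun j => by
    rw [Function.comp_apply, c.2.1]
    simp only [Factorizations.merge]
    rw [Fin.partialProd_contractNth, Function.comp_apply, Fin.succ_succAbove_succ],
    c.2.2.comp (Fin.strictMono_succAbove _).monotone⟩
  have hface : IsFlagOf c'.1 G.1 (s.faceOf hq (h.vertex c.strictMono i).1 (h.vertex c.strictMono i).2).1 := by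
    rw [Simplices.faceOf_val]
    convert h.face c.strictMono i
  rw [comparisonEquiv_apply_single ht hN _ hface]
  change (-1 : k) ^ (q + 1) * ((-1 : k) ^ ((i : ℕ) + 1) * (f (n.merge i)).1 (CommAlgCat.of k k) _) = _
  rw [zsmul_eq_mul]
  push_cast
  simp only [pow_succ]
  ring_nf
  rfl

end Comparison
end IsogenyComplex

namespace IsogenyComplex

/-! ### Discrete Morse theory: exactness where a matching has no critical sets -/

section Matching

open Classical

variable {α : Type u} [PartialOrder α]

/-- The simplicial boundary on formal combinations of finite subsets of a poset. -/
def finsetBoundary : (Finset α →₀ ℤ) →ₗ[ℤ] (Finset α →₀ ℤ) :=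
  Finsupp.lift _ ℤ _ fun s => ∑ x ∈ s, (-1 : ℤ) ^ position s x • Finsupp.single (s.erase x) 1

lemma finsetBoundary_single (s : Finset α) : finsetBoundary (Finsupp.single s 1) =
    ∑ x ∈ s, (-1 : ℤ) ^ position s x • (Finsupp.single (s.erase x) 1 : Finset α →₀ ℤ) := by
  simp [finsetBoundary]

lemma finsetBoundary_single_apply (s t : Finset α) : finsetBoundary (Finsupp.single s 1) t =
    ∑ x ∈ s, if s.erase x = t then (-1 : ℤ) ^ position s x else 0 := by
  rw [finsetBoundary_single, Finsupp.finsetSum_apply]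
  refine Finset.sum_congr rfl fun x _ => ?_
  rw [Finsupp.smul_apply, Finsupp.single_apply]
  split_ifs <;> simp

lemma finsetBoundary_apply (z : Finset α →₀ ℤ) (t : Finset α) :
    finsetBoundary z t = ∑ s ∈ z.support, z s * finsetBoundary (Finsupp.single s 1) t := by
  conv_lhs => rw [← Finsupp.sum_single z, Finsupp.sum, map_sum, Finsupp.finsetSum_apply]
  refine Finset.sum_congr rfl fun s _ => ?_
  rw [← Finsupp.smul_single_one, map_smul, Finsupp.smul_apply, smul_eq_mul]

/-- A matching on a family of finite sets closed under removing elements: the set `s` is matched by inserting or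
removing the vertex `v s`, unless it is critical. The rank `ρ` certifies that the matching is acyclic. -/
structure Matching (S : Finset α → Prop) where
  v : Finset α → α
  crit : Finset α → Prop
  ρ : Finset α → ℕ
  erase_mem : ∀ s y, S s → S (s.erase y)
  insert_mem : ∀ s, S s → ¬ crit s → v s ∉ s → S (insert (v s) s)
  v_erase : ∀ t, S t → ¬ crit t → v t ∈ t → v (t.erase (v t)) = v t ∧ ¬ crit (t.erase (v t))
  rank_lt : ∀ s, S s → ¬ crit s → v s ∉ s → ∀ y ∈ s, ¬ crit ((insert (v s) s).erase y) →
    v ((insert (v s) s).erase y) ∉ (insert (v s) s).erase y → ρ ((insert (v s) s).erase y) < ρ s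

variable {S : Finset α → Prop} (V : Matching S)
include V

/-- If `s` does not contain its matching vertex, it is up to sign one face of `insert (V.v s) s`.
Modulo a boundary it is thus a combination of the other faces, each of which contains its own
matching vertex or has smaller rank. Induction on the rank concludes. -/
lemma Matching.single_mem {m : ℕ} (hm : ∀ s, S s → s.card = m → ¬ V.crit s) (s : Finset α) (hs : S s) (hsm : s.card = m) :
    (Finsupp.single s 1 : Finset α →₀ ℤ) ∈ Finsupp.supported ℤ ℤ {t | S t ∧ t.card = m ∧ V.v t ∈ t} ⊔
      (Finsupp.supported ℤ ℤ {t | S t ∧ t.card = m + 1}).map finsetBoundary := by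
  induction h : V.ρ s using Nat.strong_induction_on generalizing s with
  | _ n ih =>
  by_cases hv : V.v s ∈ s
  · exact Submodule.mem_sup_left (Finsupp.single_mem_supported ℤ _ ⟨hs, hsm, hv⟩)
  set t := insert (V.v s) s with ht
  have htS : S t := V.insert_mem s hs (hm s hs hsm) hv
  have htc : t.card = m + 1 := by rw [ht, Finset.card_insert_of_notMem hv, hsm]
  have h1 : finsetBoundary (Finsupp.single t 1) ∈ Finsupp.supported ℤ ℤ {t | S t ∧ t.card = m ∧ V.v t ∈ t} ⊔
      (Finsupp.supported ℤ ℤ {t | S t ∧ t.card = m + 1}).map finsetBoundary :=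
    Submodule.mem_sup_right ⟨_, Finsupp.single_mem_supported ℤ _ ⟨htS, htc⟩, rfl⟩
  rw [finsetBoundary_single, ht, Finset.sum_insert hv, Finset.erase_insert hv, ← ht] at h1
  have h2 : ∑ x ∈ s, (-1 : ℤ) ^ position t x • (Finsupp.single (t.erase x) 1 : Finset α →₀ ℤ) ∈
      Finsupp.supported ℤ ℤ {t | S t ∧ t.card = m ∧ V.v t ∈ t} ⊔
      (Finsupp.supported ℤ ℤ {t | S t ∧ t.card = m + 1}).map finsetBoundary := by
    refine Submodule.sum_mem _ fun y hy => Submodule.smul_mem _ _ ?_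
    have hyc : (t.erase y).card = m := by
      rw [Finset.card_erase_of_mem (Finset.mem_insert_of_mem hy), htc, Nat.add_sub_cancel]
    have hyS := V.erase_mem t y htS
    by_cases hvy : V.v (t.erase y) ∈ t.erase y
    · exact Submodule.mem_sup_left (Finsupp.single_mem_supported ℤ _ ⟨hyS, hyc, hvy⟩)
    · exact ih _ (h ▸ V.rank_lt s hs (hm s hs hsm) hv y hy (hm _ hyS hyc) hvy) _ hyS hyc rfl
  have h3 := (Submodule.add_mem_iff_left _ h2).1 h1
  have h4 := Submodule.smul_mem _ ((-1 : ℤ) ^ position t (V.v s)) h3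
  rwa [smul_smul, ← mul_pow, neg_one_mul, neg_neg, one_pow, one_smul] at h4

lemma Matching.supported_le {m : ℕ} (hm : ∀ s, S s → s.card = m → ¬ V.crit s) :
    Finsupp.supported ℤ ℤ {t | S t ∧ t.card = m} ≤ Finsupp.supported ℤ ℤ {t | S t ∧ t.card = m ∧ V.v t ∈ t} ⊔
      (Finsupp.supported ℤ ℤ {t | S t ∧ t.card = m + 1}).map finsetBoundary := by
  rw [Finsupp.supported_eq_span_single, Submodule.span_le]
  rintro _ ⟨s, hs, rfl⟩
  exact V.single_mem hm s hs.1 hs.2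

/-- Take `t` in the support of `z` with `t.erase (V.v t)` of maximal rank. No other member of the
support has `t.erase (V.v t)` as a face, because its own matched face would have larger rank. So the
coefficient of this face in the boundary is that of `t` up to sign, and cannot vanish. -/
lemma Matching.eq_zero_of_boundary_eq_zero {m : ℕ} (hm : ∀ s, S s → s.card = m → ¬ V.crit s) {z : Finset α →₀ ℤ}
    (hz : z ∈ Finsupp.supported ℤ ℤ {t | S t ∧ t.card = m ∧ V.v t ∈ t}) (hbz : finsetBoundary z = 0) : z = 0 := by
  by_contra hne
  obtain ⟨t, ht, hmax⟩ := z.support.exists_max_image (fun t => V.ρ (t.erase (V.v t))) (Finsupp.support_nonempty_iff.2 hne)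
  have hmem : ∀ t ∈ z.support, S t ∧ t.card = m ∧ V.v t ∈ t := fun t ht => hz ht
  obtain ⟨htS, htm, hvt⟩ := hmem t ht
  obtain ⟨hv, hc⟩ := V.v_erase t htS (hm t htS htm) hvt
  have h1 := finsetBoundary_apply z (t.erase (V.v t))
  rw [hbz, Finset.sum_eq_single_of_mem t ht, finsetBoundary_single_apply, Finset.sum_eq_single_of_mem _ hvt, if_pos rfl] at h1
  · refine Finsupp.mem_support_iff.1 ht ((mul_eq_zero.1 h1.symm).resolve_right ?_)
    exact pow_ne_zero _ (by norm_num)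
  · intro y hy hyv
    rw [if_neg]
    intro h
    exact hyv ((Finset.erase_inj t hy).1 h)
  · intro t' ht' htt'
    rw [finsetBoundary_single_apply, Finset.sum_eq_zero, mul_zero]
    intro y hy
    rw [if_neg]
    intro h
    obtain ⟨htS', htm', hvt'⟩ := hmem t' ht'
    obtain ⟨hv', hc'⟩ := V.v_erase t' htS' (hm t' htS' htm') hvt'
    have hyv : y ≠ V.v t' := by
      rintro rfl
      refine htt' ?_
      have hvv : V.v t' = V.v t := hv'.symm.trans ((congrArg V.v h).trans hv)
      rw [← Finset.insert_erase hvt', h, hvv, Finset.insert_erase hvt]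
    have h5 := V.rank_lt (t'.erase (V.v t')) (V.erase_mem _ _ htS') hc' (by rw [hv']; exact Finset.notMem_erase _ _) y
      (Finset.mem_erase.2 ⟨hyv, hy⟩)
    rw [hv', Finset.insert_erase hvt', h, hv] at h5
    exact (h5 hc (Finset.notMem_erase _ _)).not_ge (hmax t' ht')

end Matching
end IsogenyComplex

namespace IsogenyComplex

/-! ### Pivot and base of a chain in a modular lattice with chosen atoms -/

section LatticeMatching

open Classical

variable {α : Type u} [Lattice α] [BoundedOrder α]

/-- Chains of elements other than the bounds. -/
def IsProperChain (s : Finset α) : Prop := IsChain (· ≤ ·) (s : Set α) ∧ ∀ x ∈ s, x ≠ ⊥ ∧ x ≠ ⊤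

/-- No element of `s` is a complement of the chosen atom `a x` below `x`. -/
def IsGood (a : α → α) (s : Finset α) (x : α) : Prop := ∀ y ∈ s, y < x → y ⊔ a x ≠ x

/-- `W` is the largest good element of `s ∪ {⊤}`. -/
def IsPivot (a : α → α) (s : Finset α) (W : α) : Prop :=
  W ∈ insert ⊤ s ∧ IsGood a s W ∧ ∀ x ∈ insert ⊤ s, IsGood a s x → x ≤ W

/-- `H` is the largest element of `s ∪ {⊥}` below `W` that does not contain the chosen atom `a W`. -/
def IsBase (a : α → α) (s : Finset α) (W H : α) : Prop :=
  H ∈ insert ⊥ s ∧ H < W ∧ ¬ a W ≤ H ∧ ∀ y ∈ s, y < W → ¬ a W ≤ y → y ≤ H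

variable {a : α → α} {s : Finset α}

lemma IsProperChain.erase (h : IsProperChain s) (y : α) : IsProperChain (s.erase y) :=
  ⟨h.1.mono (by simp), fun x hx => h.2 x (Finset.mem_of_mem_erase hx)⟩

lemma IsProperChain.total (h : IsProperChain s) {x y : α} (hx : x ∈ insert ⊤ s) (hy : y ∈ insert ⊤ s) : x ≤ y ∨ y ≤ x := by
  obtain rfl | hx := Finset.mem_insert.1 hx
  · exact Or.inr le_top
  obtain rfl | hy := Finset.mem_insert.1 hy
  · exact Or.inl le_top
  exact h.1.total hx hy

lemma IsProperChain.le_or_lt (h : IsProperChain s) {x y : α} (hx : x ∈ insert ⊤ s) (hy : y ∈ insert ⊤ s) : x ≤ y ∨ y < x := by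
  obtain h1 | h1 := h.total hx hy
  · exact Or.inl h1
  · exact (eq_or_lt_of_le h1).imp (fun e => e.ge) id

lemma IsProperChain.exists_greatest (h : IsProperChain s) {p : α → Prop} {x : α} (hx : x ∈ insert ⊤ s) (hp : p x) :
    ∃ y ∈ insert ⊤ s, p y ∧ ∀ z ∈ insert ⊤ s, p z → z ≤ y := by
  obtain ⟨y, hy, hmax⟩ := ((insert ⊤ s).filter p).exists_maximal ⟨x, Finset.mem_filter.2 ⟨hx, hp⟩⟩
  obtain ⟨h1, h2⟩ := Finset.mem_filter.1 hy
  refine ⟨y, h1, h2, fun z hz hpz => ?_⟩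
  obtain h3 | h3 := h.total hz h1
  · exact h3
  · exact hmax (Finset.mem_filter.2 ⟨hz, hpz⟩) h3

lemma IsProperChain.exists_pivot (h : IsProperChain s) : ∃ W, IsPivot a s W := by
  obtain ⟨x, hx, hmin⟩ := (insert ⊤ s).exists_minimal ⟨⊤, Finset.mem_insert_self _ _⟩
  have hgood : IsGood a s x := fun y hy hyx =>
    absurd (hmin (Finset.mem_insert_of_mem hy) hyx.le) hyx.not_ge
  obtain ⟨W, h1, h2, h3⟩ := h.exists_greatest hx hgood
  exact ⟨W, h1, h2, h3⟩

lemma IsPivot.unique {W W' : α} (h : IsPivot a s W) (h' : IsPivot a s W') : W = W' :=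
  le_antisymm (h'.2.2 W h.1 h.2.1) (h.2.2 W' h'.1 h'.2.1)

lemma IsBase.unique {W H H' : α} (h : IsBase a s W H) (h' : IsBase a s W H') : H = H' := by
  have key : ∀ {H H'}, IsBase a s W H → IsBase a s W H' → H ≤ H' := by
    intro H H' h h'
    obtain h1 | h1 := Finset.mem_insert.1 h.1
    · exact h1 ▸ bot_le
    · exact h'.2.2.2 H h1 h.2.1 h.2.2.1
  exact le_antisymm (key h h') (key h' h)

variable (ha : ∀ x : α, x ≠ ⊥ → IsAtom (a x) ∧ a x ≤ x)
include ha

lemma IsProperChain.exists_base (h : IsProperChain s) {W : α} (hW : W ≠ ⊥) : ∃ H, IsBase a s W H := by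
  by_cases hex : ∃ y ∈ s, y < W ∧ ¬ a W ≤ y
  · obtain ⟨y, hy, hyW⟩ := hex
    obtain ⟨H, h1, h2, h3⟩ := h.exists_greatest (p := fun y => y ∈ s ∧ y < W ∧ ¬ a W ≤ y) (Finset.mem_insert_of_mem hy) ⟨hy, hyW⟩
    exact ⟨H, Finset.mem_insert_of_mem h2.1, h2.2.1, h2.2.2, fun z hz h4 h5 => h3 z (Finset.mem_insert_of_mem hz) ⟨hz, h4, h5⟩⟩
  · refine ⟨⊥, Finset.mem_insert_self _ _, bot_lt_iff_ne_bot.2 hW, fun h => (ha W hW).1.1 (le_bot_iff.1 h), ?_⟩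
    exact fun y hy h1 h2 => absurd ⟨y, hy, h1, h2⟩ hex

/-- An atom not below `y` meets `y` in `⊥`, and modularity carries the covering of `⊥` by the atom
up to a covering of `y`. -/
lemma covBy_sup_atom [IsModularLattice α] {x y : α} (hx : x ≠ ⊥) (h : ¬ a x ≤ y) : y ⋖ y ⊔ a x := by
  have h1 : y ⊓ a x = ⊥ := by
    have := (ha x hx).1.le_iff.1 (inf_le_right : y ⊓ a x ≤ a x)
    exact this.resolve_right fun h2 => h (inf_eq_right.1 h2)
  refine covBy_sup_of_inf_covBy_right ?_
  rw [h1]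
  exact (ha x hx).1.bot_covBy

lemma covBy_of_not_good [IsModularLattice α] {x y : α} (hx : x ≠ ⊥) (hy : y < x) (h : y ⊔ a x = x) : y ⋖ x := by
  have := covBy_sup_atom ha (y := y) hx fun h1 => hy.ne (by rw [← h, sup_eq_left.2 h1])
  rwa [h] at this

omit ha in
lemma IsProperChain.ne_bot [Nontrivial α] (h : IsProperChain s) {x : α} (hx : x ∈ insert ⊤ s) : x ≠ ⊥ := by
  obtain rfl | hx := Finset.mem_insert.1 hx
  · exact top_ne_bot
  · exact (h.2 x hx).1

lemma IsBase.sup_le {W H : α} (hW : W ≠ ⊥) (h : IsBase a s W H) : H ⊔ a W ≤ W := _root_.sup_le h.2.1.le (ha W hW).2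

/-- The new vertex is comparable with every member below `W`: a member containing the atom `a W`
lies above `H`, hence above the join, and any other lies below `H` by the choice of `H`. -/
lemma IsProperChain.insert_sup [Nontrivial α] (hs : IsProperChain s) {W H : α} (hW : IsPivot a s W) (hH : IsBase a s W H)
    (hne : H ⊔ a W ≠ W) : IsProperChain (insert (H ⊔ a W) s) := by
  have hW0 := hs.ne_bot hW.1
  have hlt : H ⊔ a W < W := lt_of_le_of_ne (hH.sup_le ha hW0) hne
  refine ⟨?_, ?_⟩
  · rw [Finset.coe_insert]
    refine hs.1.insert fun y hy _ => ?_
    obtain h1 | h1 := hs.le_or_lt hW.1 (Finset.mem_insert_of_mem hy)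
    · exact Or.inl (hlt.le.trans h1)
    · by_cases h2 : a W ≤ y
      · left
        refine _root_.sup_le ?_ h2
        obtain h3 | h3 := Finset.mem_insert.1 hH.1
        · exact h3 ▸ bot_le
        · exact (hs.1.total h3 hy).resolve_right fun h4 => hH.2.2.1 (h2.trans h4)
      · exact Or.inr ((hH.2.2.2 y hy h1 h2).trans le_sup_left)
  · intro x hx
    obtain rfl | hx := Finset.mem_insert.1 hx
    · refine ⟨fun h => ?_, (hlt.trans_le le_top).ne⟩
      exact (ha W hW0).1.1 (le_bot_iff.1 (h ▸ le_sup_right))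
    · exact hs.2 x hx

/-- The matching vertex lies strictly below `W`, so it is covered by no element above `W` and its
removal creates no larger good element. It contains `a W`, so it is not a candidate for the base
either. -/
lemma pivot_base_erase [Nontrivial α] [IsModularLattice α] (hs : IsProperChain s) {W H : α} (hW : IsPivot a s W)
    (hH : IsBase a s W H) (hne : H ⊔ a W ≠ W) :
    IsPivot a (s.erase (H ⊔ a W)) W ∧ IsBase a (s.erase (H ⊔ a W)) W H := by
  have hW0 := hs.ne_bot hW.1
  have hlt : H ⊔ a W < W := lt_of_le_of_ne (hH.sup_le ha hW0) hne
  refine ⟨⟨?_, fun y hy => hW.2.1 y (Finset.mem_of_mem_erase hy), fun x hx hgood => ?_⟩, ?_, hH.2.1, hH.2.2.1,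
    fun y hy => hH.2.2.2 y (Finset.mem_of_mem_erase hy)⟩
  · obtain h1 | h1 := Finset.mem_insert.1 hW.1
    · exact h1 ▸ Finset.mem_insert_self _ _
    · exact Finset.mem_insert_of_mem (Finset.mem_erase.2 ⟨hne.symm, h1⟩)
  · have hx' : x ∈ insert ⊤ s := Finset.insert_subset_insert _ (Finset.erase_subset _ _) hx
    refine (hs.le_or_lt hx' hW.1).resolve_right fun hWx => ?_
    refine hWx.not_ge (hW.2.2 x hx' fun y hy hyx h => ?_)
    by_cases hyv : y = H ⊔ a W
    · subst hyv
      exact (covBy_of_not_good ha (hs.ne_bot hx') hyx h).2 hlt hWx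
    · exact hgood y (Finset.mem_erase.2 ⟨hyv, hy⟩) hyx h
  · obtain h1 | h1 := Finset.mem_insert.1 hH.1
    · exact h1 ▸ Finset.mem_insert_self _ _
    · refine Finset.mem_insert_of_mem (Finset.mem_erase.2 ⟨fun h => hH.2.2.1 ?_, h1⟩)
      rw [h]
      exact le_sup_right

/-- Inserting the matching vertex and removing another one either increases the pivot, or keeps the pivot and
decreases the base, or yields a set that contains its matching vertex. -/
lemma pivot_base_insert_erase [Nontrivial α] [IsModularLattice α] (hs : IsProperChain s) {W H W' H' y : α}
    (hW : IsPivot a s W) (hH : IsBase a s W H) (hne : H ⊔ a W ≠ W) (hv : H ⊔ a W ∉ s) (hy : y ∈ s)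
    (hW' : IsPivot a ((insert (H ⊔ a W) s).erase y) W') (hH' : IsBase a ((insert (H ⊔ a W) s).erase y) W' H')
    (hv' : H' ⊔ a W' ∉ (insert (H ⊔ a W) s).erase y) : W < W' ∨ W = W' ∧ H' < H := by
  have hW0 := hs.ne_bot hW.1
  have hlt : H ⊔ a W < W := lt_of_le_of_ne (hH.sup_le ha hW0) hne
  set V := H ⊔ a W with hV
  have hVy : V ≠ y := fun h => hv (h ▸ hy)
  have hmem : ∀ z ∈ (insert V s).erase y, z = V ∨ z ∈ s := fun z hz =>
    Finset.mem_insert.1 (Finset.mem_of_mem_erase hz)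
  have hVt : V ∈ (insert V s).erase y := Finset.mem_erase.2 ⟨hVy, Finset.mem_insert_self _ _⟩
  have hst : ∀ z ∈ s, z ≠ y → z ∈ (insert V s).erase y := fun z hz hzy =>
    Finset.mem_erase.2 ⟨hzy, Finset.mem_insert_of_mem hz⟩
  obtain hWy | hyW := hs.le_or_lt hW.1 (Finset.mem_insert_of_mem hy)
  · left
    -- Let `x` be the successor of `y`. A complement of `a x` in the chain is covered by `x`, so
    -- only `y` could be one; after its removal `x` is good and the pivot moves above `W`.
    obtain ⟨x, hx, hmin⟩ := ((insert ⊤ s).filter (y < ·)).exists_minimal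
      ⟨⊤, Finset.mem_filter.2 ⟨Finset.mem_insert_self _ _, lt_top_iff_ne_top.2 (hs.2 y hy).2⟩⟩
    obtain ⟨hxs, hyx⟩ := Finset.mem_filter.1 hx
    have hx0 := hs.ne_bot hxs
    have key : ∀ z ∈ s, z < x → z ⊔ a x = x → z = y := by
      intro z hz hzx h
      have hcov := covBy_of_not_good ha hx0 hzx h
      obtain h1 | h1 := hs.le_or_lt (Finset.mem_insert_of_mem hz) (Finset.mem_insert_of_mem hy)
      · exact (eq_or_lt_of_le h1).resolve_right fun h2 => hcov.2 h2 hyx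
      · exact absurd (hmin (Finset.mem_filter.2 ⟨Finset.mem_insert_of_mem hz, h1⟩) hzx.le) hzx.not_ge
    have hxt : x ∈ insert ⊤ ((insert V s).erase y) := by
      obtain h1 | h1 := Finset.mem_insert.1 hxs
      · exact h1 ▸ Finset.mem_insert_self _ _
      · exact Finset.mem_insert_of_mem (hst x h1 hyx.ne')
    refine (hWy.trans_lt hyx).trans_le (hW'.2.2 x hxt fun z hz hzx h => ?_)
    obtain rfl | hzs := hmem z hz
    · exact (covBy_of_not_good ha hx0 hzx h).2 hlt (hWy.trans_lt hyx)
    · exact Finset.ne_of_mem_erase hz (key z hzs hzx h)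
  · right
    -- When `y < W`, the pivot stays. The inserted vertex is no complement of `a W`, since joining
    -- it with `a W` does not change it, and removing `y` makes nothing above `W` good, since such
    -- an element does not cover `y`.
    have hWt : IsPivot a ((insert V s).erase y) W := by
      refine ⟨?_, fun z hz hzW h => ?_, fun x hx hgood => ?_⟩
      · obtain h1 | h1 := Finset.mem_insert.1 hW.1
        · exact h1 ▸ Finset.mem_insert_self _ _
        · exact Finset.mem_insert_of_mem (hst W h1 hyW.ne')
      · obtain rfl | hzs := hmem z hz
        · rw [hV, sup_assoc, sup_idem, ← hV] at h
          exact hne h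
        · exact hW.2.1 z hzs hzW h
      · obtain rfl | hx := Finset.mem_insert.1 hx
        · have hT : (⊤ : α) ∈ insert ⊤ s := Finset.mem_insert_self _ _
          refine (hs.le_or_lt hT hW.1).resolve_right fun hWx => hWx.not_ge (hW.2.2 _ hT fun z hz hzx h => ?_)
          exact hgood z (hst z hz fun hzy => (covBy_of_not_good ha top_ne_bot hzx h).2 (hzy ▸ hyW) hWx) hzx h
        · obtain rfl | hxs := hmem x hx
          · exact hlt.le
          have hT : x ∈ insert ⊤ s := Finset.mem_insert_of_mem hxs
          refine (hs.le_or_lt hT hW.1).resolve_right fun hWx => hWx.not_ge (hW.2.2 _ hT fun z hz hzx h => ?_)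
          exact hgood z (hst z hz fun hzy => (covBy_of_not_good ha (hs.ne_bot hT) hzx h).2 (hzy ▸ hyW) hWx) hzx h
    obtain rfl := hWt.unique hW'
    refine ⟨rfl, ?_⟩
    -- Removing the base lowers it. Removing anything else keeps the base, hence the matching
    -- vertex, which is then present, contrary to assumption.
    by_cases hyH : y = H
    · subst hyH
      obtain h1 | h1 := Finset.mem_insert.1 hH'.1
      · exact h1 ▸ bot_lt_iff_ne_bot.2 (hs.2 y hy).1
      · obtain rfl | h2 := hmem H' h1
        · exact absurd le_sup_right hH'.2.2.1
        · exact lt_of_le_of_ne (hH.2.2.2 H' h2 hH'.2.1 hH'.2.2.1) (Finset.ne_of_mem_erase h1)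
    · have hHt : IsBase a ((insert V s).erase y) W H := by
        refine ⟨?_, hH.2.1, hH.2.2.1, fun z hz hzW haz => ?_⟩
        · obtain h1 | h1 := Finset.mem_insert.1 hH.1
          · exact h1 ▸ Finset.mem_insert_self _ _
          · exact Finset.mem_insert_of_mem (hst H h1 (Ne.symm hyH))
        · obtain rfl | hzs := hmem z hz
          · exact absurd le_sup_right haz
          · exact hH.2.2.2 z hzs hzW haz
      obtain rfl := hHt.unique hH'
      exact absurd hVt hv'

end LatticeMatching
end IsogenyComplex

namespace IsogenyComplex

/-! ### The acyclic matching on proper chains and its critical chains -/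

section LatticeMatching

open Classical

variable {α : Type u} [Lattice α] [BoundedOrder α] {a : α → α} {s : Finset α}

variable (a s) in
/-- The largest good element of `s ∪ {⊤}`. -/
def pivot : α := if h : ∃ W, IsPivot a s W then h.choose else ⊤

variable (a s) in
/-- The largest element of `s ∪ {⊥}` below the pivot that does not contain the chosen atom of the pivot. -/
def base : α := if h : ∃ H, IsBase a s (pivot a s) H then h.choose else ⊥

lemma IsProperChain.isPivot (h : IsProperChain s) : IsPivot a s (pivot a s) := by
  rw [pivot, dif_pos h.exists_pivot]
  exact h.exists_pivot.choose_spec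

lemma IsProperChain.isBase [Nontrivial α] (h : IsProperChain s) (ha : ∀ x : α, x ≠ ⊥ → IsAtom (a x) ∧ a x ≤ x) :
    IsBase a s (pivot a s) (base a s) := by
  have hex := h.exists_base ha (h.ne_bot (h.isPivot (a := a)).1)
  rw [base, dif_pos hex]
  exact hex.choose_spec

lemma pivot_base_eq [Nontrivial α] (h : IsProperChain s) (ha : ∀ x : α, x ≠ ⊥ → IsAtom (a x) ∧ a x ≤ x) {W H : α}
    (hW : IsPivot a s W) (hH : IsBase a s W H) : pivot a s = W ∧ base a s = H := by
  have h1 := h.isPivot.unique hW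
  refine ⟨h1, ?_⟩
  have h2 := h.isBase ha
  rw [h1] at h2
  exact h2.unique hH

/-- The matching on proper chains of a modular lattice given by a choice of atoms. -/
def latticeMatching [Nontrivial α] [IsModularLattice α] (ha : ∀ x : α, x ≠ ⊥ → IsAtom (a x) ∧ a x ≤ x) {c : α → ℕ} (hc : StrictMono c) :
    Matching (IsProperChain (α := α)) where
  v s := base a s ⊔ a (pivot a s)
  crit s := base a s ⊔ a (pivot a s) = pivot a s
  -- Lexicographic order in one number: a larger pivot comes first, then a smaller base. The factor
  -- `c ⊤ + 1` exceeds every value of `c`.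
  ρ s := (c ⊤ - c (pivot a s)) * (c ⊤ + 1) + c (base a s)
  erase_mem s y h := h.erase y
  insert_mem s h h1 _ := h.insert_sup ha h.isPivot (h.isBase ha) h1
  v_erase t h h1 _ := by
    obtain ⟨h3, h4⟩ := pivot_base_erase ha h h.isPivot (h.isBase ha) h1
    obtain ⟨h5, h6⟩ := pivot_base_eq (h.erase _) ha h3 h4
    rw [h5, h6]
    exact ⟨rfl, h1⟩
  rank_lt s h h1 h2 y hy h3 h4 := by
    set t := (insert (base a s ⊔ a (pivot a s)) s).erase y
    have ht : IsProperChain t := (h.insert_sup ha h.isPivot (h.isBase ha) h1).erase y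
    have hle : ∀ x, c x ≤ c ⊤ := fun x => hc.monotone le_top
    obtain h5 | ⟨h5, h6⟩ := pivot_base_insert_erase ha h h.isPivot (h.isBase ha) h1 h2 hy ht.isPivot (ht.isBase ha) h4
    · have h7 := hc h5
      have h8 := hle (pivot a t)
      have h9 := hle (base a t)
      have h10 : c ⊤ - c (pivot a t) + 1 ≤ c ⊤ - c (pivot a s) := by omega
      have h11 := Nat.mul_le_mul_right (c ⊤ + 1) h10
      rw [Nat.add_mul] at h11
      omega
    · have h7 := hc h6
      rw [h5]
      omega

/-- A critical chain starts with an atom, and each further element is the join of its predecessor with an atom. -/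
lemma IsProperChain.exists_of_critical [Nontrivial α] (h : IsProperChain s) (ha : ∀ x : α, x ≠ ⊥ → IsAtom (a x) ∧ a x ≤ x)
    (hcrit : base a s ⊔ a (pivot a s) = pivot a s) {x : α} (hx : x ∈ insert ⊤ s) :
    IsAtom x ∨ ∃ y ∈ s, y < x ∧ y ⊔ a x = x := by
  have hW := h.isPivot (a := a)
  have hH := h.isBase ha
  -- The pivot is good, so no member of `s` complements its atom. Criticality therefore forces the
  -- base to be `⊥`, and the pivot is its own chosen atom.
  have hat : IsAtom (pivot a s) := by
    obtain h1 | h1 := Finset.mem_insert.1 hH.1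
    · rw [h1, bot_sup_eq] at hcrit
      exact hcrit ▸ (ha _ (h.ne_bot hW.1)).1
    · exact absurd hcrit (hW.2.1 _ h1 hH.2.1)
  obtain h1 | h1 := h.le_or_lt hx hW.1
  · left
    obtain h2 | h2 := hat.le_iff.1 h1
    · exact absurd h2 (h.ne_bot hx)
    · exact h2 ▸ hat
  · right
    by_contra! h2
    exact h1.not_ge (hW.2.2 x hx fun y hy hyx h3 => h2 y hy hyx h3)

end LatticeMatching

/-! ### Critical chains of subgroups of a finite `p`-group -/

section Groups

variable {G : Type u} [AddCommGroup G] [Finite G] {p n : ℕ}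

lemma card_of_isAtom (hp : p.Prime) (hG : Nat.card G = p ^ n) {A : AddSubgroup G} (hA : IsAtom A) : Nat.card A = p := by
  have : Fact p.Prime := ⟨hp⟩
  have : Nontrivial A := (AddSubgroup.nontrivial_iff_ne_bot A).2 hA.1
  obtain ⟨i, -, hi⟩ := (Nat.dvd_prime_pow hp).1 (hG ▸ AddSubgroup.card_addSubgroup_dvd_card A)
  have hi0 : i ≠ 0 := by
    rintro rfl
    exact (Finite.one_lt_card (α := A)).ne' hi
  obtain ⟨g, hg⟩ := exists_prime_addOrderOf_dvd_card' (G := A) p (hi ▸ dvd_pow_self p hi0)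
  have h1 : AddSubgroup.zmultiples (g : G) ≤ A := by simp
  have hg' : addOrderOf (g : G) = p := by rw [AddSubgroup.addOrderOf_coe, hg]
  obtain h2 | h2 := hA.le_iff.1 h1
  · rw [AddSubgroup.zmultiples_eq_bot] at h2
    rw [h2, addOrderOf_zero] at hg'
    exact absurd hg'.symm hp.one_lt.ne'
  · rw [← h2, Nat.card_zmultiples, hg']

lemma nsmul_eq_zero_of_isAtom (hp : p.Prime) (hG : Nat.card G = p ^ n) {A : AddSubgroup G} (hA : IsAtom A) {g : G} (hg : g ∈ A) :
    p • g = 0 := by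
  have h : Nat.card A • (⟨g, hg⟩ : A) = 0 := card_nsmul_eq_zero'
  rw [card_of_isAtom hp hG hA] at h
  exact congrArg Subtype.val h

lemma card_sup_of_disjoint {y A : AddSubgroup G} (h : Disjoint y A) :
    Nat.card (y ⊔ A : AddSubgroup G) = Nat.card y * Nat.card A := by
  have h1 := AddSubgroup.relIndex_mul_relIndex ⊥ y (y ⊔ A) bot_le le_sup_left
  rwa [AddSubgroup.relIndex_sup_left, ← AddSubgroup.inf_relIndex_right y A, disjoint_iff.1 h, AddSubgroup.relIndex_bot_left,
    AddSubgroup.relIndex_bot_left, AddSubgroup.relIndex_bot_left, eq_comm] at h1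

lemma card_strictMono : StrictMono fun H : AddSubgroup G => Nat.card H := fun _ _ h =>
  lt_of_le_of_ne (Nat.card_le_card_of_injective _ (AddSubgroup.inclusion_injective h.le))
    fun h' => h.ne (AddSubgroup.eq_of_le_of_card_ge h.le h'.ge)

open Classical in
-- Climb the flag: the bottom is an atom, of order `p`, and each further member is the join of the
-- preceding one with a disjoint atom. Every step keeps the group killed by `p` and multiplies its
-- order by `p`. At `⊤` this counts `s` together with `⊤` as `n` members.
lemma card_of_critical [Nontrivial G] (hp : p.Prime) (hG : Nat.card G = p ^ n) {s : Finset (AddSubgroup G)} (hs : IsProperChain s)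
    {a : AddSubgroup G → AddSubgroup G} (ha : ∀ x, x ≠ ⊥ → IsAtom (a x) ∧ a x ≤ x)
    (hcrit : base a s ⊔ a (pivot a s) = pivot a s) : (∀ g : G, p • g = 0) ∧ s.card + 1 = n := by
  have key : ∀ x ∈ insert ⊤ s, (∀ g ∈ x, p • g = 0) ∧ Nat.card x = p ^ ((insert ⊤ s).filter (· ≤ x)).card := by
    intro x
    induction x using WellFoundedLT.induction with
    | _ x ih =>
    intro hx
    have hx0 := hs.ne_bot hx
    obtain hat | ⟨y, hy, hyx, hsup⟩ := hs.exists_of_critical ha hcrit hx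
    · refine ⟨fun g hg => nsmul_eq_zero_of_isAtom hp hG hat hg, ?_⟩
      have : (insert ⊤ s).filter (· ≤ x) = {x} := by
        ext z
        simp only [Finset.mem_filter, Finset.mem_singleton]
        refine ⟨fun h => (hat.le_iff.1 h.2).resolve_left (hs.ne_bot h.1), ?_⟩
        rintro rfl
        exact ⟨hx, le_rfl⟩
      rw [this, Finset.card_singleton, pow_one, card_of_isAtom hp hG hat]
    · obtain ⟨h1, h2⟩ := ih y hyx (Finset.mem_insert_of_mem hy)
      have hcov := covBy_of_not_good ha hx0 hyx hsup
      have hdisj : Disjoint y (a x) := by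
        refine ((ha x hx0).1.not_le_iff_disjoint.1 fun h => hyx.ne ?_).symm
        rw [← hsup, sup_eq_left.2 h]
      constructor
      · intro g hg
        rw [← hsup] at hg
        obtain ⟨g₁, hg₁, g₂, hg₂, rfl⟩ := AddSubgroup.mem_sup.1 hg
        rw [smul_add, h1 _ hg₁, nsmul_eq_zero_of_isAtom hp hG (ha x hx0).1 hg₂, add_zero]
      · have h3 : (insert ⊤ s).filter (· ≤ x) = insert x ((insert ⊤ s).filter (· ≤ y)) := by
          ext z
          simp only [Finset.mem_filter, Finset.mem_insert (a := z) (b := x)]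
          constructor
          · rintro ⟨hz, hzx⟩
            obtain h4 | h4 := eq_or_lt_of_le hzx
            · exact Or.inl h4
            · refine Or.inr ⟨hz, ?_⟩
              exact (hs.le_or_lt hz (Finset.mem_insert_of_mem hy)).resolve_right fun h5 => hcov.2 h5 h4
          · rintro (rfl | ⟨hz, hzy⟩)
            · exact ⟨hx, le_rfl⟩
            · exact ⟨hz, hzy.trans hyx.le⟩
        have h4 : x ∉ (insert ⊤ s).filter (· ≤ y) := fun h => hyx.not_ge (Finset.mem_filter.1 h).2
        rw [h3, Finset.card_insert_of_notMem h4, pow_succ, ← h2, ← card_of_isAtom hp hG (ha x hx0).1,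
          ← card_sup_of_disjoint hdisj, hsup]
  obtain ⟨h1, h2⟩ := key ⊤ (Finset.mem_insert_self _ _)
  refine ⟨fun g => h1 g (AddSubgroup.mem_top g), ?_⟩
  rw [Finset.filter_true_of_mem (fun _ _ => le_top), Finset.card_insert_of_notMem fun h => (hs.2 _ h).2 rfl,
    AddSubgroup.card_top, hG] at h2
  exact (Nat.pow_right_injective hp.two_le h2).symm

/-- The orders along the chain and `⊤` are powers of `p` with distinct exponents between `1` and
`n`. -/
lemma card_le_of_isProperChain [Nontrivial G] (hp : p.Prime) (hG : Nat.card G = p ^ n) {s : Finset (AddSubgroup G)} (hs : IsProperChain s) :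
    s.card + 1 ≤ n := by
  classical
  have hdvd : ∀ H : AddSubgroup G, ∃ i ≤ n, Nat.card H = p ^ i := fun H =>
    (Nat.dvd_prime_pow hp).1 (hG ▸ AddSubgroup.card_addSubgroup_dvd_card H)
  choose i hi hcard using hdvd
  have hmono : StrictMono i := fun H K h => by
    have := card_strictMono h
    simp only [hcard] at this
    exact (Nat.pow_lt_pow_iff_right hp.one_lt).1 this
  have h1 : (insert ⊤ s).card ≤ (Finset.Ioc (i ⊥) (i ⊤)).card := by
    refine Finset.card_le_card_of_injOn i (fun x hx => ?_) fun x hx y hy h => ?_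
    · exact Finset.mem_coe.2 (Finset.mem_Ioc.2 ⟨hmono (bot_lt_iff_ne_bot.2 (hs.ne_bot hx)), hmono.monotone le_top⟩)
    · obtain h1 | h1 := hs.le_or_lt hx hy
      · exact h1.eq_of_not_lt fun h2 => (hmono h2).ne h
      · exact absurd h (hmono h1).ne'
  rw [Finset.card_insert_of_notMem fun h => (hs.2 _ h).2 rfl, Nat.card_Ioc] at h1
  have := hi ⊤
  omega

lemma exists_atom_choice : ∃ a : AddSubgroup G → AddSubgroup G, ∀ x, x ≠ ⊥ → IsAtom (a x) ∧ a x ≤ x := by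
  have : ∀ x : AddSubgroup G, ∃ y, x ≠ ⊥ → IsAtom y ∧ y ≤ x := fun x => by
    by_cases h : x = ⊥
    · exact ⟨⊥, fun h' => absurd h h'⟩
    · obtain ⟨y, hy⟩ := (eq_bot_or_exists_atom_le x).resolve_left h
      exact ⟨y, fun _ => hy⟩
  choose a ha using this
  exact ⟨a, ha⟩

end Groups
end IsogenyComplex

namespace IsogenyComplex

/-! ### Exactness of the reduced chain complex of a `p`-group -/

section Acyclicity

open Classical

variable {G : Type u} [AddCommGroup G]

/-- Simplices as finite sets of subgroups. -/
def simplexFinset (j : ℤ) (s : Simplices (ProperSubgroups G) j) : Finset (AddSubgroup G) :=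
  s.1.map (Function.Embedding.subtype _)

lemma simplexFinset_injective (j : ℤ) : Function.Injective (simplexFinset (G := G) j) := fun _ _ h =>
  Subtype.ext (Finset.map_injective _ h)

lemma isProperChain_simplexFinset {j : ℤ} (s : Simplices (ProperSubgroups G) j) : IsProperChain (simplexFinset j s) := by
  constructor
  · rintro x hx y hy -
    obtain ⟨x', hx', rfl⟩ := Finset.mem_map.1 (Finset.mem_coe.1 hx)
    obtain ⟨y', hy', rfl⟩ := Finset.mem_map.1 (Finset.mem_coe.1 hy)
    exact s.2.1.total hx' hy'
  · intro x hx
    obtain ⟨x, hx, rfl⟩ := Finset.mem_map.1 hx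
    exact x.2

lemma card_simplexFinset {j : ℤ} (s : Simplices (ProperSubgroups G) j) : ((simplexFinset j s).card : ℤ) = j + 1 := by
  rw [simplexFinset, Finset.card_map, s.2.2]

lemma exists_simplexFinset_eq {j : ℤ} {t : Finset (AddSubgroup G)} (ht : IsProperChain t) (hj : (t.card : ℤ) = j + 1) :
    ∃ s : Simplices (ProperSubgroups G) j, simplexFinset j s = t := by
  have h1 : (t.subtype fun H => H ≠ ⊥ ∧ H ≠ ⊤).map (Function.Embedding.subtype _) = t :=
    Finset.subtype_map_of_mem ht.2
  refine ⟨⟨t.subtype _, ?_, ?_⟩, h1⟩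
  · intro x hx y hy _
    exact ht.1.total (Finset.mem_subtype.1 hx) (Finset.mem_subtype.1 hy)
  · rw [← hj, ← h1, Finset.card_map, h1]

/-- Chains as formal combinations of finite sets of subgroups. -/
def chainsToFinsets (j : ℤ) : (Simplices (ProperSubgroups G) j →₀ ℤ) →ₗ[ℤ] (Finset (AddSubgroup G) →₀ ℤ) :=
  Finsupp.lmapDomain ℤ ℤ (simplexFinset j)

lemma chainsToFinsets_injective (j : ℤ) : Function.Injective (chainsToFinsets (G := G) j) :=
  Finsupp.mapDomain_injective (simplexFinset_injective j)

lemma range_chainsToFinsets (j : ℤ) : LinearMap.range (chainsToFinsets (G := G) j) =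
    Finsupp.supported ℤ ℤ {t | IsProperChain t ∧ (t.card : ℤ) = j + 1} := by
  rw [LinearMap.range_eq_map, ← Finsupp.supported_univ, chainsToFinsets, Finsupp.lmapDomain_supported, Set.image_univ]
  congr 1
  ext t
  constructor
  · rintro ⟨s, rfl⟩
    exact ⟨isProperChain_simplexFinset s, card_simplexFinset s⟩
  · rintro ⟨h1, h2⟩
    exact exists_simplexFinset_eq h1 h2

lemma chainsToFinsets_d {i j : ℤ} (h : j + 1 = i) (x : Simplices (ProperSubgroups G) i →₀ ℤ) :
    chainsToFinsets j (((reducedChains (ProperSubgroups G)).d i j).hom x) = finsetBoundary (chainsToFinsets i x) := by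
  have key : (chainsToFinsets j) ∘ₗ ((reducedChains (ProperSubgroups G)).d i j).hom = finsetBoundary ∘ₗ chainsToFinsets (G := G) i := by
    refine Finsupp.lhom_ext' fun s => LinearMap.ext_ring ?_
    change chainsToFinsets j (((reducedChains (ProperSubgroups G)).d i j).hom (Finsupp.single s 1 : Simplices (ProperSubgroups G) i →₀ ℤ))
      = finsetBoundary (chainsToFinsets i (Finsupp.single s 1))
    rw [reducedChains_d_single h]
    refine (map_sum (chainsToFinsets j) _ _).trans ?_
    simp only [map_zsmul, chainsToFinsets, Finsupp.lmapDomain_apply, Finsupp.mapDomain_single]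
    rw [finsetBoundary_single, simplexFinset, Finset.sum_map]
    refine Eq.trans ?_ (Finset.sum_attach s.1 _)
    refine Finset.sum_congr (Finset.univ_eq_attach _) fun x _ => ?_
    congr 2
    · simp only [position]
      rw [Finset.filter_map, Finset.card_map]
      rfl
    · rw [simplexFinset, Simplices.faceOf_val]
      convert Finset.map_erase _ _ _
  exact congrArg (fun g => g x) key

/-- The reduced chain complex of the proper nontrivial subgroups of a finite `p`-group of order `p ^ n` is exact in degree
`j`, unless the group is elementary and `j = n - 2`. -/
theorem reducedChains_exact [Finite G] [Nontrivial G] {p n : ℕ} (hp : p.Prime) (hG : Nat.card G = p ^ n) {i j l : ℤ}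
    (hij : j + 1 = i) (hjl : l + 1 = j) (h : (∀ g : G, p • g = 0) → j ≠ n - 2)
    (z : Simplices (ProperSubgroups G) j →₀ ℤ) (hz : ((reducedChains (ProperSubgroups G)).d j l).hom z = 0) :
    ∃ y : Simplices (ProperSubgroups G) i →₀ ℤ, ((reducedChains (ProperSubgroups G)).d i j).hom y = z := by
  by_cases hj : j < -1
  · have := Simplices.isEmpty_of_lt (P := ProperSubgroups G) hj
    exact ⟨0, Subsingleton.elim (α := Simplices (ProperSubgroups G) j →₀ ℤ) _ _⟩
  obtain ⟨m, hm⟩ := Int.eq_ofNat_of_zero_le (a := j + 1) (by omega)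
  obtain ⟨a, ha⟩ := exists_atom_choice (G := G)
  let V := latticeMatching ha (card_strictMono (G := G))
  have hcrit : ∀ s : Finset (AddSubgroup G), IsProperChain s → s.card = m → ¬ V.crit s := by
    intro s hs hsm hc
    obtain ⟨h1, h2⟩ := card_of_critical hp hG hs ha hc
    exact h h1 (by omega)
  have hset : ∀ m : ℕ, ∀ j : ℤ, j + 1 = m → LinearMap.range (chainsToFinsets (G := G) j) =
      Finsupp.supported ℤ ℤ {t | IsProperChain t ∧ t.card = m} := fun m j hm => by
    rw [range_chainsToFinsets, hm]
    simp only [Nat.cast_inj]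
  have h1 : chainsToFinsets j z ∈ Finsupp.supported ℤ ℤ {t : Finset (AddSubgroup G) | IsProperChain t ∧ t.card = m} :=
    hset m j hm ▸ ⟨z, rfl⟩
  -- Modulo a boundary the cycle becomes a combination `x` of sets containing their matching vertex.
  -- As `x` is again a cycle, it vanishes.
  obtain ⟨x, hx, _, ⟨y', hy', rfl⟩, hxy⟩ := Submodule.mem_sup.1 (V.supported_le hcrit h1)
  rw [SetLike.mem_coe, ← hset (m + 1) i (by push_cast; omega)] at hy'
  obtain ⟨y, rfl⟩ := hy'
  refine ⟨y, chainsToFinsets_injective j ?_⟩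
  rw [chainsToFinsets_d hij, ← hxy, right_eq_add]
  refine V.eq_zero_of_boundary_eq_zero hcrit hx ?_
  let dij : (Simplices (ProperSubgroups G) i →₀ ℤ) →ₗ[ℤ] (Simplices (ProperSubgroups G) j →₀ ℤ) :=
    ((reducedChains (ProperSubgroups G)).d i j).hom
  let djl : (Simplices (ProperSubgroups G) j →₀ ℤ) →ₗ[ℤ] (Simplices (ProperSubgroups G) l →₀ ℤ) :=
    ((reducedChains (ProperSubgroups G)).d j l).hom
  have hdd : djl (dij y) = 0 := congrArg (fun g => g.hom y) ((reducedChains (ProperSubgroups G)).d_comp_d i j l)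
  have hx' : x = chainsToFinsets j (z - dij y) := by
    refine (eq_sub_of_add_eq hxy).trans ?_
    rw [← chainsToFinsets_d hij]
    exact (map_sub (chainsToFinsets j) z (dij y)).symm
  rw [hx', ← chainsToFinsets_d hjl]
  change chainsToFinsets l (djl (z - dij y)) = 0
  have hz' : djl z = 0 := hz
  rw [map_sub, hdd, hz', sub_zero, map_zero]

lemma isEmpty_simplices_of_lt [Finite G] [Nontrivial G] {p n : ℕ} (hp : p.Prime) (hG : Nat.card G = p ^ n) {j : ℤ}
    (hj : (n : ℤ) - 2 < j) : IsEmpty (Simplices (ProperSubgroups G) j) :=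
  ⟨fun s => by
    have h1 := card_le_of_isProperChain hp hG (isProperChain_simplexFinset s)
    have h2 := card_simplexFinset s
    omega⟩

end Acyclicity
end IsogenyComplex

namespace IsogenyComplex

/-! ### Homology of complexes of modules in terms of elements -/

section Homology

lemma isZero_homology_iff {R : Type w} [Ring R] {I : Type*} {c : ComplexShape I} (C : HomologicalComplex (ModuleCat.{v} R) c)
    {i j l : I} (hi : c.prev j = i) (hl : c.next j = l) :
    Limits.IsZero (C.homology j) ↔ ∀ x : C.X j, C.d j l x = 0 → ∃ y : C.X i, C.d i j y = x := by
  rw [← HomologicalComplex.exactAt_iff_isZero_homology, HomologicalComplex.exactAt_iff' C i j l hi hl,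
    ShortComplex.moduleCat_exact_iff]
  rfl

/-- At the end of a complex homology is a cokernel, and any surjection whose kernel is the image of
the incoming differential computes it. -/
lemma nonempty_homology_equiv {R : Type w} [Ring R] {I : Type*} {c : ComplexShape I} (C : HomologicalComplex (ModuleCat.{v} R) c)
    {i j l : I} (hi : c.prev j = i) (hl : c.next j = l) (h0 : Subsingleton (C.X l)) {T : Type*} [AddCommGroup T] [Module R T]
    (f : C.X j →ₗ[R] T) (hf : Function.Surjective f) (hker : ∀ x, f x = 0 ↔ ∃ y : C.X i, C.d i j y = x) :
    Nonempty (C.homology j ≃ₗ[R] T) := by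
  have hd : C.d j l = 0 := by
    ext x
    exact Subsingleton.elim _ _
  have := C.isIso_homologyι j l hl hd
  have hsurj : Function.Surjective (C.pOpcycles j).hom := (ModuleCat.epi_iff_surjective _).1 inferInstance
  have hex := (ShortComplex.moduleCat_exact_iff _).1 (ShortComplex.exact_of_g_is_cokernel
    (ShortComplex.mk _ _ (C.d_pOpcycles i j)) (C.opcyclesIsCokernel i j hi))
  have hk : LinearMap.ker (C.pOpcycles j).hom = LinearMap.ker f := by
    ext x
    rw [LinearMap.mem_ker, LinearMap.mem_ker, hker]
    refine ⟨fun h => hex x h, ?_⟩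
    rintro ⟨y, rfl⟩
    exact congrArg (fun g => g.hom y) (C.d_pOpcycles i j)
  exact ⟨(asIso (C.homologyι j)).toLinearEquiv.trans <|
    ((C.pOpcycles j).hom.quotKerEquivOfSurjective hsurj).symm.trans <|
    (Submodule.quotEquivOfEq _ _ hk).trans (f.quotKerEquivOfSurjective hf)⟩

lemma exists_injective_homology {R : Type w} [Ring R] {I : Type*} {c : ComplexShape I} (C : HomologicalComplex (ModuleCat.{v} R) c)
    {i j : I} (hi : c.prev j = i) (h0 : Subsingleton (C.X i)) :
    ∃ f : C.homology j →ₗ[R] C.X j, Function.Injective f := by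
  have hd : C.d i j = 0 := by
    ext x
    rw [Subsingleton.elim x 0, map_zero, map_zero]
  have := C.isIso_homologyπ i j hi hd
  refine ⟨(inv (C.homologyπ j) ≫ C.iCycles j).hom, (ModuleCat.mono_iff_injective _).1 inferInstance⟩

end Homology

/-! ### Splitting over `ℤ` and exactness of `Hom` into an arbitrary module -/

section Extension

variable {M : Type v} [AddCommGroup M]

/-- The image of `g` is a subgroup of a finitely generated free group, hence free, so `g` splits
onto its image. -/
lemma exists_projection_ker {B C : Type*} [AddCommGroup B] [AddCommGroup C] [Module.Finite ℤ C]
    [Module.Free ℤ C] (g : B →ₗ[ℤ] C) : ∃ P : B →ₗ[ℤ] LinearMap.ker g, ∀ x : LinearMap.ker g, P x = x := by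
  have : Module.IsTorsionFree ℤ C := inferInstance
  have : Module.Free ℤ (LinearMap.range g) := Module.free_of_finite_type_torsion_free'
  obtain ⟨σ, hσ⟩ := Module.projective_lifting_property g.rangeRestrict LinearMap.id g.surjective_rangeRestrict
  refine ⟨(LinearMap.id - σ ∘ₗ g.rangeRestrict).codRestrict _ fun x => ?_, fun x => Subtype.ext ?_⟩
  · have h1 : g.rangeRestrict x.1 = 0 := Subtype.ext x.2
    simp [h1]
  · have h1 := congrArg Subtype.val (LinearMap.congr_fun hσ (g.rangeRestrict x))
    rw [LinearMap.mem_ker, LinearMap.sub_apply, map_sub, sub_eq_zero]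
    exact h1.symm

/-- On the image of `f`, which is the kernel of `g`, the functional is forced; it extends to `B`
because that kernel is a direct summand. -/
lemma exists_extension {A B C : Type*} [AddCommGroup A] [AddCommGroup B] [AddCommGroup C] [Module.Finite ℤ C]
    [Module.Free ℤ C] (f : A →ₗ[ℤ] B) (g : B →ₗ[ℤ] C) (hfg : ∀ x, g x = 0 ↔ ∃ y, f y = x) (φ : A →ₗ[ℤ] M)
    (hφ : ∀ x, f x = 0 → φ x = 0) : ∃ ψ : B →ₗ[ℤ] M, ψ ∘ₗ f = φ := by
  obtain ⟨P, hP⟩ := exists_projection_ker g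
  have hk : LinearMap.ker g = LinearMap.range f := by
    ext x
    exact hfg x
  let e : LinearMap.ker g ≃ₗ[ℤ] A ⧸ LinearMap.ker f := (LinearEquiv.ofEq _ _ hk).trans f.quotKerEquivRange.symm
  refine ⟨(LinearMap.ker f).liftQ φ hφ ∘ₗ e.toLinearMap ∘ₗ P, LinearMap.ext fun x => ?_⟩
  have hx : f x ∈ LinearMap.ker g := (hfg _).2 ⟨x, rfl⟩
  have h1 : P (f x) = ⟨f x, hx⟩ := hP ⟨f x, hx⟩
  have h2 : e ⟨f x, hx⟩ = Submodule.Quotient.mk x := f.quotKerEquivRange_symm_apply_image x _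
  simp only [LinearMap.comp_apply, h1, LinearEquiv.coe_coe, h2]
  exact Submodule.liftQ_apply _ _ _

end Extension

/-! ### Homology and cohomology of the complexes of a `p`-group -/

section PGroups

variable {G : Type u} [AddCommGroup G] [Finite G] {p n : ℕ}

instance (q : ℤ) : Finite (Simplices (ProperSubgroups G) q) :=
  Subtype.finite

lemma reducedChains_d_eq_zero_iff [Nontrivial G] (hp : p.Prime) (hG : Nat.card G = p ^ n) {i j l : ℤ}
    (hij : j + 1 = i) (hjl : l + 1 = j) (h : (∀ g : G, p • g = 0) → j ≠ n - 2)
    (z : Simplices (ProperSubgroups G) j →₀ ℤ) : ((reducedChains (ProperSubgroups G)).d j l).hom z = 0 ↔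
    ∃ y : Simplices (ProperSubgroups G) i →₀ ℤ, ((reducedChains (ProperSubgroups G)).d i j).hom y = z := by
  refine ⟨reducedChains_exact hp hG hij hjl h z, ?_⟩
  rintro ⟨y, rfl⟩
  exact congrArg (fun g => g.hom y) ((reducedChains (ProperSubgroups G)).d_comp_d i j l)

theorem isZero_reducedChains_homology [Nontrivial G] (hp : p.Prime) (hG : Nat.card G = p ^ n) {q : ℤ}
    (h : (∀ g : G, p • g = 0) → q ≠ n - 2) : Limits.IsZero ((reducedChains (ProperSubgroups G)).homology q) :=
  (isZero_homology_iff _ (ChainComplex.prev ℤ q) (ChainComplex.next ℤ q)).2 fun x hx =>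
    reducedChains_exact hp hG rfl (sub_add_cancel q 1) h x hx

theorem free_reducedChains_homology [Nontrivial G] (hp : p.Prime) (hG : Nat.card G = p ^ n) :
    Module.Free ℤ ((reducedChains (ProperSubgroups G)).homology ((n : ℤ) - 2)) := by
  have := isEmpty_simplices_of_lt (j := (n : ℤ) - 2 + 1) hp hG (by omega)
  obtain ⟨f, hf⟩ := exists_injective_homology (reducedChains (ProperSubgroups G)) (ChainComplex.prev ℤ ((n : ℤ) - 2))
    (inferInstanceAs (Subsingleton (Simplices (ProperSubgroups G) ((n : ℤ) - 2 + 1) →₀ ℤ)))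
  let F : (reducedChains (ProperSubgroups G)).homology ((n : ℤ) - 2) →ₗ[ℤ] (Simplices (ProperSubgroups G) ((n : ℤ) - 2) →₀ ℤ) := f
  have : Module.Finite ℤ (LinearMap.range F) := inferInstance
  have : Module.Free ℤ (LinearMap.range F) := Module.free_of_finite_type_torsion_free'
  exact Module.Free.of_equiv (LinearEquiv.ofInjective F hf).symm

variable (R : Type w) [CommRing R] (M : Type v) [AddCommGroup M] [Module R M]

theorem isZero_complexD_homology [Nontrivial G] (hp : p.Prime) (hG : Nat.card G = p ^ n) {q : ℕ}
    (h : (∀ g : G, p • g = 0) → q ≠ n) : Limits.IsZero ((complexD R G M).homology q) := by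
  rw [complexD_eq_homComplex]
  cases q with
  | zero =>
    refine (isZero_homology_iff _ CochainComplex.prev_nat_zero (CochainComplex.next ℕ 0)).2 fun x _ => ⟨0, ?_⟩
    have := Simplices.isEmpty_of_lt (P := ProperSubgroups G) (q := ((0 : ℕ) : ℤ) - 2) (by simp)
    have : Subsingleton ((Simplices (ProperSubgroups G) (((0 : ℕ) : ℤ) - 2) →₀ ℤ) →ₗ[ℤ] M) := inferInstance
    exact Subsingleton.elim (α := (Simplices (ProperSubgroups G) (((0 : ℕ) : ℤ) - 2) →₀ ℤ) →ₗ[ℤ] M) _ _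
  | succ q =>
    refine (isZero_homology_iff _ (CochainComplex.prev_nat_succ q) (CochainComplex.next ℕ (q + 1))).2 fun x hx => ?_
    by_cases hq : (n : ℤ) - 2 < ((q + 1 : ℕ) : ℤ) - 2
    · have := isEmpty_simplices_of_lt hp hG hq
      exact ⟨0, Subsingleton.elim (α := (Simplices (ProperSubgroups G) (((q + 1 : ℕ) : ℤ) - 2) →₀ ℤ) →ₗ[ℤ] M) _ _⟩
    let φ : (Simplices (ProperSubgroups G) (((q + 1 : ℕ) : ℤ) - 2) →₀ ℤ) →ₗ[ℤ] M := x
    have hx' : φ ∘ₗ ((reducedChains (ProperSubgroups G)).d (((q + 1 + 1 : ℕ) : ℤ) - 2) (((q + 1 : ℕ) : ℤ) - 2)).hom = 0 :=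
      (homComplex_d_apply R G M (q + 1) x).symm.trans hx
    -- Here `q + 1 ≤ n`. Degree `q - 2` lies below the exceptional degree `n - 2`, so the sequence
    -- is exact there. Degree `(q + 1) - 2` is allowed by `h`, so the cocycle vanishes on the kernel
    -- of the boundary, which consists of boundaries.
    obtain ⟨ψ, hψ⟩ := exists_extension (A := Simplices (ProperSubgroups G) (((q + 1 : ℕ) : ℤ) - 2) →₀ ℤ)
      (B := Simplices (ProperSubgroups G) ((q : ℤ) - 2) →₀ ℤ) (C := Simplices (ProperSubgroups G) ((q : ℤ) - 3) →₀ ℤ)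
      ((reducedChains (ProperSubgroups G)).d (((q + 1 : ℕ) : ℤ) - 2) ((q : ℤ) - 2)).hom
      ((reducedChains (ProperSubgroups G)).d ((q : ℤ) - 2) ((q : ℤ) - 3)).hom
      (reducedChains_d_eq_zero_iff hp hG (by push_cast; ring) (by ring) fun _ => by omega) φ fun y hy => by
        obtain ⟨z, rfl⟩ := (reducedChains_d_eq_zero_iff hp hG (i := ((q + 1 + 1 : ℕ) : ℤ) - 2) (by push_cast; ring)
          (by push_cast; ring) (fun h1 => by have := h h1; omega) y).1 hy
        exact LinearMap.congr_fun hx' z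
    exact ⟨ψ, (homComplex_d_apply R G M q ψ).trans hψ⟩

/-- The top cohomology is the group of homomorphisms from `ker d` to `M`: restriction to `ker d` is
onto because `ker d` is a direct summand, and a functional vanishing on it factors through `d`. As
`ker d` is finitely generated and free over `ℤ`, this is a finite power of `M`. -/
theorem free_complexD_homology [Nontrivial G] (hp : p.Prime) (hG : Nat.card G = p ^ n) [Module.Free R M] :
    Module.Free R ((complexD R G M).homology n) := by
  rw [complexD_eq_homComplex]
  obtain ⟨m, rfl⟩ : ∃ m, n = m + 1 := Nat.exists_eq_succ_of_ne_zero (by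
    rintro rfl
    exact (Finite.one_lt_card (α := G)).ne' hG)
  let B := Simplices (ProperSubgroups G) (((m + 1 : ℕ) : ℤ) - 2) →₀ ℤ
  let C := Simplices (ProperSubgroups G) ((m : ℤ) - 2) →₀ ℤ
  let d : B →ₗ[ℤ] C := ((reducedChains (ProperSubgroups G)).d (((m + 1 : ℕ) : ℤ) - 2) ((m : ℤ) - 2)).hom
  have : IsEmpty (Simplices (ProperSubgroups G) (((m + 1 + 1 : ℕ) : ℤ) - 2)) :=
    isEmpty_simplices_of_lt hp hG (by push_cast; omega)
  let ρ : (B →ₗ[ℤ] M) →ₗ[R] (LinearMap.ker d →ₗ[ℤ] M) :=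
    { toFun := fun f => f ∘ₗ (LinearMap.ker d).subtype
      map_add' := fun _ _ => rfl
      map_smul' := fun _ _ => rfl }
  obtain ⟨P, hP⟩ := exists_projection_ker d
  have hρ : Function.Surjective ρ := fun f => ⟨f ∘ₗ P, LinearMap.ext fun x => congrArg f (hP x)⟩
  have hfree : Module.Free ℤ (LinearMap.ker d) := Module.free_of_finite_type_torsion_free'
  obtain ⟨e⟩ := nonempty_homology_equiv (homComplex R G M) (CochainComplex.prev_nat_succ m) (CochainComplex.next ℕ (m + 1))
    (inferInstanceAs (Subsingleton ((Simplices (ProperSubgroups G) (((m + 1 + 1 : ℕ) : ℤ) - 2) →₀ ℤ) →ₗ[ℤ] M)))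
    ρ hρ fun x => by
      let φ : B →ₗ[ℤ] M := x
      constructor
      · intro hx
        obtain ⟨ψ, hψ⟩ := exists_extension (A := B) (B := C) (C := Simplices (ProperSubgroups G) ((m : ℤ) - 3) →₀ ℤ)
          d ((reducedChains (ProperSubgroups G)).d ((m : ℤ) - 2) ((m : ℤ) - 3)).hom
          (reducedChains_d_eq_zero_iff hp hG (by push_cast; ring) (by ring) fun _ => by push_cast; omega) φ fun y hy =>
            LinearMap.congr_fun hx ⟨y, hy⟩
        exact ⟨ψ, (homComplex_d_apply R G M m ψ).trans hψ⟩
      · rintro ⟨y, rfl⟩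
        refine LinearMap.ext fun z => ?_
        have h1 := LinearMap.congr_fun (homComplex_d_apply R G M m y) z.1
        refine Eq.trans h1 ?_
        let y' : C →ₗ[ℤ] M := y
        change y' (d z.1) = 0
        rw [z.2, map_zero]
  let b := Module.Free.chooseBasis ℤ (LinearMap.ker d)
  have e' : (LinearMap.ker d →ₗ[ℤ] M) ≃ₗ[R] (Module.Free.ChooseBasisIndex ℤ (LinearMap.ker d) → M) := (b.constr R).symm
  exact Module.Free.of_equiv (e.trans e').symm

theorem isZero_complexD_homology_of_subsingleton [Subsingleton G] {q : ℕ} (hq : q ≠ 0) :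
    Limits.IsZero ((complexD R G M).homology q) := by
  rw [complexD_eq_single]
  exact HomologicalComplex.isZero_single_obj_homology _ _ _ _ hq

theorem free_complexD_homology_of_subsingleton [Subsingleton G] [Module.Free R M] :
    Module.Free R ((complexD R G M).homology 0) := by
  rw [complexD_eq_single]
  exact Module.Free.of_equiv (ULift.moduleEquiv.symm.trans
    (HomologicalComplex.singleObjHomologySelfIso (ComplexShape.up ℕ) 0 (ModuleCat.of R (ULift.{u} M))).symm.toLinearEquiv)

lemma exists_equiv_of_module [Fact p.Prime] [Module (ZMod p) G] : ∃ r : ℕ, Nonempty (G ≃+ (Fin r → ZMod p)) := by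
  have : Module.Finite (ZMod p) G := .of_finite
  exact ⟨_, ⟨(Module.finBasis (ZMod p) G).equivFun.toAddEquiv⟩⟩

lemma exists_equiv_of_nsmul_eq_zero (hp : p.Prime) (h : ∀ g : G, p • g = 0) : ∃ r : ℕ, Nonempty (G ≃+ (Fin r → ZMod p)) :=
  have : Fact p.Prime := ⟨hp⟩
  let _ : Module (ZMod p) G := AddCommGroup.zmodModule h
  exists_equiv_of_module

lemma card_of_equiv {r : ℕ} (e : G ≃+ (Fin r → ZMod p)) : Nat.card G = p ^ r := by
  rw [Nat.card_congr e.toEquiv, Nat.card_fun, Nat.card_zmod, Nat.card_fin]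

end PGroups
end IsogenyComplex

namespace IsogenyComplex

/-! ### Homology of products of complexes -/

section Homology

lemma finite_homology {R : Type w} [Ring R] [IsNoetherianRing R] {I : Type*} {c : ComplexShape I}
    (C : HomologicalComplex (ModuleCat.{v} R) c) (j : I) [Module.Finite R (C.X j)] : Module.Finite R (C.homology j) := by
  have : Module.Finite R (C.cycles j) :=
    Module.Finite.of_injective (C.iCycles j).hom ((ModuleCat.mono_iff_injective _).1 inferInstance)
  exact Module.Finite.of_surjective (C.homologyπ j).hom ((ModuleCat.epi_iff_surjective _).1 inferInstance)

/-- The complexes live in different universes, so they are compared through elements: a cycle is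
bounded in each factor, and the primitives are assembled into one. -/
lemma isZero_homology_of_equiv_pi {R : Type w} [Ring R] {I α : Type*} {c : ComplexShape I}
    (C : HomologicalComplex (ModuleCat.{v} R) c) (D : α → HomologicalComplex (ModuleCat.{u} R) c)
    (e : ∀ q, C.X q ≃ₗ[R] ∀ a, (D a).X q)
    (he : ∀ i j, c.Rel i j → ∀ (x : C.X i) a, e j (C.d i j x) a = (D a).d i j (e i x a)) {j : I}
    (h : ∀ a, Limits.IsZero ((D a).homology j)) : Limits.IsZero (C.homology j) := by
  have he' : ∀ i j (x : C.X i) a, e j (C.d i j x) a = (D a).d i j (e i x a) := by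
    intro i j x a
    by_cases hij : c.Rel i j
    · exact he i j hij x a
    · rw [C.shape i j hij, (D a).shape i j hij]
      simp
  rw [isZero_homology_iff C rfl rfl]
  intro x hx
  have h1 := fun a => (isZero_homology_iff (D a) rfl rfl).1 (h a) (e j x a) (by rw [← he', hx, map_zero]; rfl)
  choose y hy using h1
  refine ⟨(e _).symm y, (e j).injective (funext fun a => ?_)⟩
  rw [he', LinearEquiv.apply_symm_apply, hy]

end Homology

/-! ### The comparison for every order, and the theorem -/

section Main

variable {k : Type u} [Field k] {E : EllipticCurve k} {N : ℕ}

lemma Factorizations.finite (q : ℕ) (hN : N ≠ 0) : Finite (Factorizations q N) :=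
  Finite.of_injective (fun (n : Factorizations q N) (i : Fin q) =>
    (⟨n.1 i, Nat.lt_succ_of_le (Nat.le_of_dvd (Nat.pos_of_ne_zero hN)
      ((Finset.dvd_prod_of_mem n.1 (Finset.mem_univ i)).trans n.2.2.dvd))⟩ : Fin (N + 1)))
    fun _ _ h => Subtype.ext (funext fun i => congrArg Fin.val (congrFun h i))

lemma exists_isUniversalTorsion [IsAlgClosed k] (E : EllipticCurve k) {m : ℕ} (hm : (m : k) ≠ 0) :
    ∃ (J : Type u) (_ : Fintype J) (_ : DecidableEq J) (t : E.Points (J → k)), IsUniversalTorsion m t := by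
  classical
  obtain ⟨J, _, t, h1, h2⟩ := E.exists_universal_torsion_point hm
  refine ⟨J, Fintype.ofFinite J, inferInstance, t, ⟨h1, fun y hy => (h2 _ y hy).exists, fun χ χ' h => ?_⟩⟩
  refine (h2 _ (E.mapPoints χ' t) ?_).unique h rfl
  rw [← E.mapPoints_nsmul, h1, E.mapPoints_zero]

lemma exists_comparison_of_one_lt [IsAlgClosed k] (E : EllipticCurve k) (hN : 1 < N) (hNk : (N : k) ≠ 0) :
    ∃ e : ∀ q : ℕ, (isogenyComplex E N).X q ≃ₗ[k]
        (∀ G : {G : AddSubgroup (E.Points k) // Nat.card G = N}, (complexD k G.1 k).X q),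
      ∀ (q : ℕ) (x : (isogenyComplex E N).X q) (G : {G : AddSubgroup (E.Points k) // Nat.card G = N}),
        e (q + 1) ((isogenyComplex E N).d q (q + 1) x) G = (complexD k G.1 k).d q (q + 1) (e q x G) := by
  obtain ⟨J, _, _, t, ht⟩ := exists_isUniversalTorsion E hNk
  have hnt : ∀ G : {G : AddSubgroup (E.Points k) // Nat.card G = N}, Nontrivial G.1 := fun G =>
    by
    have : Finite G.1 := Nat.finite_of_card_ne_zero (by rw [G.2]; omega)
    exact Finite.one_lt_card_iff_nontrivial.1 (by rw [G.2]; exact hN)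
  let i : ∀ G : {G : AddSubgroup (E.Points k) // Nat.card G = N}, homComplex k G.1 k ≅ complexD k G.1 k := fun G =>
    eqToIso (complexD_eq_homComplex k G.1 k).symm
  refine ⟨fun q => (comparisonEquiv ht hN q).trans (LinearEquiv.piCongrRight fun G =>
    ((HomologicalComplex.eval _ _ q).mapIso (i G)).toLinearEquiv), fun q x G => ?_⟩
  have hd : ((isogenyComplex E N).d q (q + 1)).hom x = coboundary E N q x := by
    refine (congrArg (fun g => g.hom x) (CochainComplex.of_d
      (fun q : ℕ => ModuleCat.of k (IsogenyCochains E N q)) (fun q => ModuleCat.ofHom (coboundary E N q)) q))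
  have h1 : comparisonEquiv ht hN (q + 1) (((isogenyComplex E N).d q (q + 1)).hom x) G =
      ((homComplex k G.1 k).d q (q + 1)).hom (comparisonEquiv ht hN q x G) := by
    rw [hd]
    exact (comparisonEquiv_coboundary ht hN x G).trans (homComplex_d_apply k G.1 k q _).symm
  change ((i G).hom.f (q + 1)).hom (comparisonEquiv ht hN (q + 1) (((isogenyComplex E N).d q (q + 1)).hom x) G) =
    ((complexD k G.1 k).d q (q + 1)).hom (((i G).hom.f q).hom (comparisonEquiv ht hN q x G))
  rw [h1]
  exact congrArg (fun g => g.hom (comparisonEquiv ht hN q x G)) ((i G).hom.comm q (q + 1)).symm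

/-- For `N = 1` both sides are `k` in degree `0`: there is only the empty factorization with the
empty chain, and only the trivial subgroup, whose complex is the single module. -/
lemma exists_comparison_one [IsAlgClosed k] (E : EllipticCurve k) :
    ∃ e : ∀ q : ℕ, (isogenyComplex E 1).X q ≃ₗ[k]
        (∀ G : {G : AddSubgroup (E.Points k) // Nat.card G = 1}, (complexD k G.1 k).X q),
      ∀ (q : ℕ) (x : (isogenyComplex E 1).X q) (G : {G : AddSubgroup (E.Points k) // Nat.card G = 1}),
        e (q + 1) ((isogenyComplex E 1).d q (q + 1) x) G = (complexD k G.1 k).d q (q + 1) (e q x G) := by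
  obtain ⟨J, _, _, t, ht⟩ := exists_isUniversalTorsion E (m := 1) (by simp)
  have hss : ∀ G : {G : AddSubgroup (E.Points k) // Nat.card G = 1}, Subsingleton G.1 := fun G =>
    (Nat.card_eq_one_iff_unique.1 G.2).1
  have : Unique {G : AddSubgroup (E.Points k) // Nat.card G = 1} :=
    ⟨⟨⟨⊥, AddSubgroup.card_bot⟩⟩, fun G => Subtype.ext (AddSubgroup.card_eq_one.1 G.2)⟩
  let i : ∀ G : {G : AddSubgroup (E.Points k) // Nat.card G = 1},
      (CochainComplex.single₀ (ModuleCat.{u} k)).obj (ModuleCat.of k (ULift.{u} k)) ≅ complexD k G.1 k := fun G =>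
    eqToIso (complexD_eq_single k G.1 k).symm
  have h1 : ∀ q, Subsingleton ((isogenyComplex E 1).X (q + 1)) := fun q => by
    have : IsEmpty (Factorizations (q + 1) 1) := ⟨fun n => by
      have h1 := n.2.1 0
      have h2 : n.1 0 ∣ 1 := (Finset.dvd_prod_of_mem n.1 (Finset.mem_univ 0)).trans n.2.2.dvd
      have := Nat.le_of_dvd one_pos h2
      omega⟩
    exact inferInstanceAs (Subsingleton (IsogenyCochains E 1 (q + 1)))
  have h2 : ∀ q (G : {G : AddSubgroup (E.Points k) // Nat.card G = 1}), Subsingleton ((complexD k G.1 k).X (q + 1)) :=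
    fun q G => ModuleCat.subsingleton_of_isZero <| Limits.IsZero.of_iso
      (HomologicalComplex.isZero_single_obj_X (ComplexShape.up ℕ) 0 (ModuleCat.of k (ULift.{u} k)) (q + 1) (Nat.succ_ne_zero q))
      ((HomologicalComplex.eval _ _ (q + 1)).mapIso (i G)).symm
  have : Unique (Factorizations 0 1) := ⟨⟨⟨Fin.elim0, fun i => i.elim0, by simp⟩⟩, fun n => Subtype.ext (funext fun i => i.elim0)⟩
  have : ∀ n : Factorizations 0 1, Unique (PointChain E n.1) := fun n =>
    ⟨⟨⟨Fin.elim0, fun i => i.elim0, fun i => i.elim0⟩⟩, fun n => Subtype.ext (funext fun i => i.elim0)⟩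
  have : Unique (Σ n : Factorizations 0 1, PointChain E n.1) :=
    ⟨⟨⟨default, default⟩⟩, fun ⟨n, c⟩ => by
      obtain rfl := Subsingleton.elim n default
      obtain rfl := Subsingleton.elim c default
      rfl⟩
  let e0 : (isogenyComplex E 1).X 0 ≃ₗ[k]
      (∀ G : {G : AddSubgroup (E.Points k) // Nat.card G = 1}, (complexD k G.1 k).X 0) :=
    (cochainEquiv ht one_ne_zero 0).trans <| (LinearEquiv.funUnique _ k k).trans <| (LinearEquiv.funUnique
      {G : AddSubgroup (E.Points k) // Nat.card G = 1} k k).symm.trans <| LinearEquiv.piCongrRight fun G =>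
      ULift.moduleEquiv.symm.trans <|
        ((HomologicalComplex.singleObjXSelf (ComplexShape.up ℕ) 0 (ModuleCat.of k (ULift.{u} k))).symm ≪≫
        ((HomologicalComplex.eval _ _ 0).mapIso (i G))).toLinearEquiv
  -- In positive degrees both modules are trivial, so the zero equivalence serves and compatibility
  -- with the differentials is automatic.
  refine ⟨fun q => Nat.casesOn q e0 fun q => 0, fun q x G => Subsingleton.elim _ _⟩

theorem exists_comparison [IsAlgClosed k] (E : EllipticCurve k) (hNk : (N : k) ≠ 0) :
    ∃ e : ∀ q : ℕ, (isogenyComplex E N).X q ≃ₗ[k]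
        (∀ G : {G : AddSubgroup (E.Points k) // Nat.card G = N}, (complexD k G.1 k).X q),
      ∀ (q : ℕ) (x : (isogenyComplex E N).X q) (G : {G : AddSubgroup (E.Points k) // Nat.card G = N}),
        e (q + 1) ((isogenyComplex E N).d q (q + 1) x) G = (complexD k G.1 k).d q (q + 1) (e q x G) := by
  have h0 : N ≠ 0 := by rintro rfl; simp at hNk
  obtain rfl | h1 := eq_or_ne N 1
  · exact exists_comparison_one E
  · exact exists_comparison_of_one_lt E (by omega) hNk

theorem finite_isogenyComplex_homology [IsAlgClosed k] (E : EllipticCurve k) (hNk : (N : k) ≠ 0) (q : ℕ) :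
    Module.Finite k ((isogenyComplex E N).homology q) := by
  have h0 : N ≠ 0 := by rintro rfl; simp at hNk
  obtain ⟨J, _, _, t, ht⟩ := exists_isUniversalTorsion E hNk
  have := Factorizations.finite q h0
  have := fun n : Factorizations q N => PointChain.finite ht n.partialProd_dvd
  have : Module.Finite k ((isogenyComplex E N).X q) := Module.Finite.equiv (cochainEquiv ht h0 q).symm
  exact finite_homology _ q

end Main
end IsogenyComplex

theorem mainTheorem4 (p : ℕ) (hp : p.Prime) :
    (∀ (G : Type u) [AddCommGroup G] [Finite G], (∃ n : ℕ, Nat.card G = p ^ n) →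
      ((∃ g : G, p • g ≠ 0) →
        (∀ q : ℤ, Limits.IsZero
          ((IsogenyComplex.reducedChains (IsogenyComplex.ProperSubgroups G)).homology q)) ∧
        (∀ (R : Type w) [CommRing R] (M : Type v) [AddCommGroup M] [Module R M] (q : ℕ),
          Limits.IsZero ((IsogenyComplex.complexD R G M).homology q))) ∧
      ((∀ g : G, p • g = 0) →
        (∃ r : ℕ, Nonempty (G ≃+ (Fin r → ZMod p))) ∧
        ∀ r : ℕ, Nonempty (G ≃+ (Fin r → ZMod p)) →
          (Nontrivial G →
            (∀ q : ℤ, q ≠ (r : ℤ) - 2 → Limits.IsZero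
              ((IsogenyComplex.reducedChains (IsogenyComplex.ProperSubgroups G)).homology q)) ∧
            Module.Free ℤ ((IsogenyComplex.reducedChains
              (IsogenyComplex.ProperSubgroups G)).homology ((r : ℤ) - 2))) ∧
          (∀ (R : Type w) [CommRing R] (M : Type v) [AddCommGroup M] [Module R M],
            (∀ q : ℕ, q ≠ r → Limits.IsZero ((IsogenyComplex.complexD R G M).homology q)) ∧
            (Module.Free R M → Module.Free R ((IsogenyComplex.complexD R G M).homology r))))) ∧
    (∀ (k : Type u) [Field k] [IsAlgClosed k], (p : k) ≠ 0 →
      ∀ (E : IsogenyComplex.EllipticCurve k) (r : ℕ),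
        (∃ e : ∀ q : ℕ, (IsogenyComplex.isogenyComplex E (p ^ r)).X q ≃ₗ[k]
            (∀ G : {G : AddSubgroup (E.Points k) // Nat.card G = p ^ r},
              (IsogenyComplex.complexD k G.1 k).X q),
          ∀ (q : ℕ) (x : (IsogenyComplex.isogenyComplex E (p ^ r)).X q)
            (G : {G : AddSubgroup (E.Points k) // Nat.card G = p ^ r}),
            e (q + 1) ((IsogenyComplex.isogenyComplex E (p ^ r)).d q (q + 1) x) G =
              (IsogenyComplex.complexD k G.1 k).d q (q + 1) (e q x G)) ∧
        (∀ j : ℕ, j ≠ r →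
          Limits.IsZero ((IsogenyComplex.isogenyComplex E (p ^ r)).homology j)) ∧
        Module.Finite k ((IsogenyComplex.isogenyComplex E (p ^ r)).homology r) ∧
        Module.Projective k ((IsogenyComplex.isogenyComplex E (p ^ r)).homology r)) := by
  refine ⟨fun G _ _ ⟨n, hG⟩ => ⟨fun ⟨g, hg⟩ => ?_, fun h => ⟨IsogenyComplex.exists_equiv_of_nsmul_eq_zero hp h, ?_⟩⟩, ?_⟩
  · have : Nontrivial G := ⟨g, 0, fun h => hg (by rw [h, smul_zero])⟩
    exact ⟨fun q => IsogenyComplex.isZero_reducedChains_homology hp hG fun h => absurd (h g) hg,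
      fun R _ M _ _ q => IsogenyComplex.isZero_complexD_homology R M hp hG fun h => absurd (h g) hg⟩
  · rintro r ⟨e⟩
    have hGr := IsogenyComplex.card_of_equiv e
    refine ⟨fun _ => ⟨fun q hq => IsogenyComplex.isZero_reducedChains_homology hp hGr fun _ => hq,
      IsogenyComplex.free_reducedChains_homology hp hGr⟩, fun R _ M _ _ => ?_⟩
    obtain hs | hn := subsingleton_or_nontrivial G
    -- The trivial group has order `1 = p ^ r`, so the exceptional degree is `0`, where its complex
    -- is concentrated.
    · obtain rfl : r = 0 := by
        rw [Nat.card_unique] at hGr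
        exact (Nat.pow_eq_one.1 hGr.symm).resolve_left hp.one_lt.ne'
      exact ⟨fun q hq => IsogenyComplex.isZero_complexD_homology_of_subsingleton R M hq,
        fun _ => IsogenyComplex.free_complexD_homology_of_subsingleton R M⟩
    · exact ⟨fun q hq => IsogenyComplex.isZero_complexD_homology R M hp hGr fun _ => hq,
        fun _ => IsogenyComplex.free_complexD_homology R M hp hGr⟩
  · intro k _ _ hpk E r
    have hk : ((p ^ r : ℕ) : k) ≠ 0 := by
      rw [Nat.cast_pow]
      exact pow_ne_zero r hpk
    obtain ⟨e, he⟩ := IsogenyComplex.exists_comparison E hk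
    refine ⟨⟨e, he⟩, fun j hj => ?_, IsogenyComplex.finite_isogenyComplex_homology E hk r, inferInstance⟩
    refine IsogenyComplex.isZero_homology_of_equiv_pi _ (fun G : {G : AddSubgroup (E.Points k) // Nat.card G = p ^ r} =>
      IsogenyComplex.complexD k G.1 k) e ?_ fun G => ?_
    · rintro i _ rfl x G
      exact he i x G
    · have : Finite G.1 := Nat.finite_of_card_ne_zero (by rw [G.2]; exact pow_ne_zero r hp.ne_zero)
      obtain hs | hn := subsingleton_or_nontrivial G.1
      · obtain rfl : r = 0 := by
          have := G.2
          rw [Nat.card_unique] at this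
          exact (Nat.pow_eq_one.1 this.symm).resolve_left hp.one_lt.ne'
        exact IsogenyComplex.isZero_complexD_homology_of_subsingleton k k hj
      · exact IsogenyComplex.isZero_complexD_homology k k hp G.2 fun _ => hj

end
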